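/- Let $M$ be a Riemann surface (connected, Hausdorff), $m\ge 0$ and $n=2m+1$. All vectors and matrices are written with respect to a fixed null basis of $\mathbb C^n$, i.e. a Hermitian-orthonormal basis with $(\tilde e_i,\tilde e_j)=\delta_{i,\,n+1-j}$ for the standard symmetric bilinear form; in it, transposition with respect to this form is $(A^{\mathsf T})_{ij}=a_{n+1-j,\,n+1-i}$, and $A$ is complex-orthogonal if $A^{\mathsf T}A=I$. Write $'$ for the derivative in any local coordinate; quotients $\nu'/\beta'$ of derivatives of meromorphic functions do not depend on the coordinate. *Parameters.* For an $m$-tuple $\mu=(\mu_1,\dots,\mu_m)$ of meromorphic functions on $M$, define inductively for $i=1,\dots,m$ $$\mu_i^{(0)}=\mu_i,\qquad \mu_i^{(j)}=(\mu_i^{(j-1)})'/\rho_{m+i-j}'\quad(1\le j\le 2i-2),\qquad \rho_{m-i+1}=\mu_i^{(2i-2)},\quad \rho_{m+i}=-\mu_i^{(2i-2)}.$$ Let $\mathcal M_{ND}$ (resp. $\mathcal M_{\widetilde{ND}}$) be the set of $\mu$ such that $\mu_i^{(2i-2)}$ is non-constant for all $i\le m$ (resp. for all $i\le m-1$). *Solutions.*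 Let $\gamma(\lambda)=\mathrm{diag}(\lambda^{n-1},\dots,\lambda,1)$. Let $\mathrm{Sol}$ be the set of meromorphic maps $A=(a_{ij})$ from $M$ to the complex-orthogonal upper unitriangular $n\times n$ matrices whose columns satisfy $c_k'=a_{k-1,k}'\,c_{k-1}$ $(2\le k\le n)$. A unitriangular matrix of meromorphic functions is called non-degenerate if all its superdiagonal entries are non-constant; $\tilde A=(a_{ij})_{2\le i,j\le n-1}$ is $A$ without its border. An extended solution is a smooth map $\Phi:M\to\Omega U(n)$ such that $\Phi^{-1}\Phi_z=(1-\lambda^{-1})P$ in each coordinate domain, with $P$ independent of $\lambda$. It maps to $\Omega_{r}U(n)^{\mathbb R}$ if it is polynomial in $\lambda$ of degree at most $r$ and $\Phi^{\mathsf T}\Phi=\lambda^{r}I$; it is $S^1$-invariant if $\Phi_{\lambda\kappa}=\Phi_\lambda\Phi_\kappa$ for all $\lambda,\kappa\in S^1$. It is of type $(1,\dots,1)$ if $\Phi=[a\gamma]$ for a meromorphic map $a$ from $M$ to upper unitriangular matrices with $a_{ij}$ polynomial in $\lambda$ of degree at most $j-i-1$ for $i<j$; here $[\,\cdot\,]$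 is the projection to $\Omega U(n)$ in the Iwasawa decomposition (factors in $\Omega U(n)$ and in the loops in $GL(n,\mathbb C)$ extending holomorphically to the unit disc), the equality being off a closed discrete set. Such a $\Phi$ is non-degenerate if the superdiagonal entries of $a$ are non-constant. **Theorem.** (a) For each $\mu\in\mathcal M_{\widetilde{ND}}$ there is a unique meromorphic map $A=A(\mu)$ from $M$ to the complex-orthogonal upper unitriangular matrices with $$a_{ij}=\mu_{m+1-i}^{(2m+1-i-j)}\qquad\text{for } i<j,\ i+j\le 2m+1.$$ (b) $\mu\mapsto A(\mu)$ is a bijection from $\mathcal M_{ND}$ onto $\{A\in\mathrm{Sol}: A\text{ non-degenerate}\}$ and, more generally, from $\mathcal M_{\widetilde{ND}}$ onto $\{A\in\mathrm{Sol}:\tilde A\text{ non-degenerate}\}$. The inverse is given by $\mu_i=a_{m-i+1,\,m+i}$ $(1\le i\le m)$. (c) For each $\mu\in\mathcal M_{\widetilde{ND}}$ there is an $S^1$-invariant extended solution $h(\mu)=\Phi:M\to\Omega_{n-1}U(n)^{\mathbb R}$ with $\Phi=[A(\mu)\gamma]$, and $A(\mu)$ is the only meromorphic map to the complex-orthogonal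 upper unitriangular matrices with this property. The map $h$ restricts to a bijection from $\mathcal M_{ND}$ onto the non-degenerate $S^1$-invariant extended solutions $M\to\Omega_{n-1}U(n)^{\mathbb R}$ of type $(1,\dots,1)$. (d) For $\mu\in\mathcal M_{\widetilde{ND}}$ and $0\le i\le n$, let $\alpha_i$ be the holomorphic subbundle of rank $i$ of $M\times\mathbb C^n$ that, off a closed discrete set, is the span of the last $i$ columns of $A(\mu)$. These subbundles exist, and with $\pi_\alpha$, $\pi_\alpha^\perp$ the orthogonal projections onto $\alpha$, $\alpha^\perp$, one has everywhere on $M$ $$\Phi_\lambda=(\pi_{\alpha_1}+\lambda\pi_{\alpha_1}^\perp)\cdots(\pi_{\alpha_{2m}}+\lambda\pi_{\alpha_{2m}}^\perp).$$ The map $\varphi=\Phi_{-1}:M\to U(n)$ is harmonic and is given by $\varphi=\pi_V-\pi_V^\perp$ with $V=\sum_{i=0}^{m}\psi_{2i}$, $\psi_i=\alpha_i^\perp\cap\alpha_{i+1}$. -/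

import Mathlib

open Filter Topology Polynomial
open scoped Manifold ContDiff Matrix

noncomputable section

namespace HarmonicOn

/-! ### Meromorphic functions and generalized derivatives on a Riemann surface -/

section Surface

variable {M : Type*} [TopologicalSpace M] [ChartedSpace ℂ M]

/-- `f` is meromorphic on `M`: in a local complex coordinate around each point it is a meromorphic
function of one variable (the values of `f` at its poles are irrelevant). -/
def IsMeromorphic (f : M → ℂ) : Prop :=
  ∀ x : M, MeromorphicAt (f ∘ (chartAt ℂ x).symm) (chartAt ℂ x x)

variable (M) in
/-- Complex functions on `M`, identified when they agree off a closed discrete set. -/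
abbrev FunGerm := Germ (codiscrete M) ℂ

variable (M) in
/-- The space of meromorphic functions on `M`, two representatives that agree off a closed
discrete set being the same meromorphic function. -/
def meroFun : Set (FunGerm M) :=
  {φ | ∃ f : M → ℂ, IsMeromorphic f ∧ (f : FunGerm M) = φ}

/-- The meromorphic function `φ` is not constant. -/
def IsNonconst (φ : FunGerm M) : Prop := ∀ c : ℂ, φ ≠ ((fun _ : M => c : M → ℂ) : FunGerm M)

/-- The derivative of `f` at `x` in the preferred local coordinate at `x`.  It is used only in
quotients of two derivatives and in equations homogeneous of degree one in derivatives, which do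
not depend on the choice of coordinate. -/
def coordDeriv (f : M → ℂ) (x : M) : ℂ :=
  deriv (f ∘ (chartAt ℂ x).symm) (chartAt ℂ x x)

lemma coordDeriv_congr [T1Space M] {f g : M → ℂ} (h : f =ᶠ[codiscrete M] g) :
    coordDeriv f =ᶠ[codiscrete M] coordDeriv g := by
  have h1 : ∀ x : M, ∀ᶠ y in 𝓝[≠] x, f y = g y := by
    intro x
    have := mem_codiscrete.1 h x
    rw [disjoint_principal_right, compl_compl] at this
    exact this
  refine mem_codiscrete.2 fun x => ?_
  rw [disjoint_principal_right, compl_compl]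
  have h2 : ∀ᶠ y in 𝓝[≠] x, ∀ᶠ z in 𝓝 y, f z = g z := by
    have h3 := eventually_eventually_nhdsWithin.2 (h1 x)
    filter_upwards [h3, self_mem_nhdsWithin] with y hy hyx
    rwa [IsOpen.nhdsWithin_eq isOpen_compl_singleton hyx] at hy
  filter_upwards [h2] with y hy
  refine Filter.EventuallyEq.deriv_eq ?_
  have hc : Tendsto (chartAt ℂ y).symm (𝓝 (chartAt ℂ y y)) (𝓝 y) := by
    have := (chartAt ℂ y).continuousAt_symm (mem_chart_target ℂ y)
    rw [ContinuousAt, (chartAt ℂ y).left_inv (mem_chart_source ℂ y)] at this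
    exact this
  exact hc.eventually hy

/-- The derivative `φ'` (in the preferred local coordinates) on classes of functions. -/
def D [T1Space M] : FunGerm M → FunGerm M :=
  Quotient.map coordDeriv fun _ _ h => coordDeriv_congr h

/-- Iterated generalized derivatives: `ν^(0) = ν` and
`ν^(j) = (ν^(j-1))' / (ρ_{c-j})'`. -/
def iterGenDeriv [T1Space M] (ρ : ℕ → FunGerm M) (ν : FunGerm M) (c : ℕ) : ℕ → FunGerm M
  | 0 => ν
  | j + 1 => D (iterGenDeriv ρ ν c j) / D (ρ (c - (j + 1)))

/-- All indices start at `0`: `μ t`, `ρ k` and the matrix entry `A i j` stand for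
`μ_{t+1}`, `ρ_{k+1}` and `a_{i+1,j+1}`.
`rhoUpTo m μ t` holds the functions `ρ_k` that are determined by `μ_0, …, μ_{t-1}`
(and `0` elsewhere): with `σ = μ_t^(2t)`, step `t` adds `ρ_{m-1-t} = σ` and `ρ_{m+t} = -σ`. -/
def rhoUpTo [T1Space M] (m : ℕ) (μ : Fin m → FunGerm M) : ℕ → ℕ → FunGerm M
  | 0 => fun _ => 0
  | t + 1 => fun k =>
      let σ : FunGerm M :=
        if h : t < m then iterGenDeriv (rhoUpTo m μ t) (μ ⟨t, h⟩) (m + t) (2 * t) else 0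
      if k = m - 1 - t then σ else if k = m + t then -σ else rhoUpTo m μ t k

/-- The functions `ρ_0, …, ρ_{2m-1}`. -/
def rho [T1Space M] (m : ℕ) (μ : Fin m → FunGerm M) : ℕ → FunGerm M := rhoUpTo m μ m

/-- The generalized derivatives `μ_t^(j)`, meaningful for `0 ≤ j ≤ 2t`. -/
def muDer [T1Space M] (m : ℕ) (μ : Fin m → FunGerm M) (t : Fin m) (j : ℕ) : FunGerm M :=
  iterGenDeriv (rho m μ) (μ t) (m + t) j

lemma iterGenDeriv_congr [T1Space M] {ρ ρ' : ℕ → FunGerm M} (ν : FunGerm M) (c : ℕ) :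
    ∀ j : ℕ, (∀ l, 1 ≤ l → l ≤ j → ρ (c - l) = ρ' (c - l)) →
      iterGenDeriv ρ ν c j = iterGenDeriv ρ' ν c j
  | 0, _ => rfl
  | j + 1, h => by
      simp only [iterGenDeriv]
      rw [iterGenDeriv_congr ν c j fun l h1 h2 => h l h1 (by omega), h (j + 1) (by omega) le_rfl]

lemma rhoUpTo_stable [T1Space M] (m : ℕ) (μ : Fin m → FunGerm M) {s t k : ℕ} (hst : s ≤ t)
    (htm : t ≤ m) (hk : m - s ≤ k) (hk' : k < m + s) :
    rhoUpTo m μ t k = rhoUpTo m μ s k := by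
  induction t, hst using Nat.le_induction with
  | base => rfl
  | succ t hst ih =>
      simp only [rhoUpTo]
      rw [if_neg (by omega), if_neg (by omega), ih (by omega)]

/-- The defining recursion: `μ_t^(0) = μ_t`, `μ_t^(j) = (μ_t^(j-1))' / (ρ_{m+t-j})'`,
`ρ_{m-1-t} = μ_t^(2t)` and `ρ_{m+t} = -μ_t^(2t)`. -/
lemma muDer_spec [T1Space M] (m : ℕ) (μ : Fin m → FunGerm M) (t : Fin m) :
    muDer m μ t 0 = μ t ∧
    (∀ j, muDer m μ t (j + 1) = D (muDer m μ t j) / D (rho m μ (m + t - (j + 1)))) ∧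
    rho m μ (m - 1 - t) = muDer m μ t (2 * t) ∧
    rho m μ (m + t) = -muDer m μ t (2 * t) := by
  have ht := t.2
  have key : iterGenDeriv (rhoUpTo m μ t) (μ t) (m + t) (2 * t) = muDer m μ t (2 * t) := by
    refine iterGenDeriv_congr _ _ _ fun l h1 h2 => ?_
    exact (rhoUpTo_stable m μ (s := t) (t := m) (by omega) le_rfl (by omega) (by omega)).symm
  refine ⟨rfl, fun _ => rfl, ?_, ?_⟩
  · rw [rho, rhoUpTo_stable m μ (s := t + 1) (by omega) le_rfl (by omega) (by omega)]
    simp only [rhoUpTo, if_true, dif_pos ht]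
    exact key
  · rw [rho, rhoUpTo_stable m μ (s := t + 1) (by omega) le_rfl (by omega) (by omega)]
    simp only [rhoUpTo, if_true, dif_pos ht]
    rw [if_neg (by omega)]
    exact congrArg Neg.neg key

variable (M) in
/-- `m`-tuples of meromorphic functions with `μ_t^(2t)` non-constant for all `t`. -/
def paramND [T1Space M] (m : ℕ) : Set (Fin m → FunGerm M) :=
  {μ | (∀ t, μ t ∈ meroFun M) ∧ ∀ t : Fin m, IsNonconst (muDer m μ t (2 * t))}

variable (M) in
/-- `m`-tuples of meromorphic functions with `μ_t^(2t)` non-constant for all `t` but the last. -/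
def paramWeakND [T1Space M] (m : ℕ) : Set (Fin m → FunGerm M) :=
  {μ | (∀ t, μ t ∈ meroFun M) ∧
    ∀ t : Fin m, (t : ℕ) + 1 < m → IsNonconst (muDer m μ t (2 * t))}

end Surface

/-! ### Matrices, with respect to a unitary null basis of `ℂⁿ` -/

/-- The second transpose (reflection in the second diagonal).  In a null basis
`ẽ_1, …, ẽ_n`, `(ẽ_i, ẽ_j) = δ_{i, n+1-j}`, this is the transpose with respect to the standard
symmetric bilinear form of `ℂⁿ`; the null basis is orthonormal for the Hermitian inner product. -/
def secondTranspose {R : Type*} {n : ℕ} (A : Matrix (Fin n) (Fin n) R) :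
    Matrix (Fin n) (Fin n) R :=
  Matrix.of fun i j => A j.rev i.rev

/-- `ξ_0 = i diag(n-1, …, 1, 0)`, the canonical element of type `(1, …, 1)`, given by its list of
integers. -/
def xiOne (n : ℕ) (i : Fin n) : ℕ := n - 1 - i

/-- The canonical geodesic `γ_ξ(λ) = diag(λ^{ξ_1}, …, λ^{ξ_n})`. -/
def geodesic {n : ℕ} (ξ : Fin n → ℕ) (l : Circle) : Matrix (Fin n) (Fin n) ℂ :=
  Matrix.diagonal fun i => (l : ℂ) ^ ξ i

/-- The group of matrices polynomial in `λ` with `a_ij = δ_ij` if `ξ_i ≤ ξ_j`, and `a_ij` of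
degree at most `ξ_i - ξ_j - 1` otherwise. -/
def groupC {n : ℕ} (ξ : Fin n → ℕ) : Set (Matrix (Fin n) (Fin n) ℂ[X]) :=
  {a | ∀ i j, (ξ i ≤ ξ j → a i j = if i = j then 1 else 0) ∧
    (ξ j < ξ i → (a i j).natDegree ≤ ξ i - ξ j - 1)}

/-- The matrix obtained by removing the border (empty if `n ≤ 2`). -/
def removeBorder {R : Type*} {n : ℕ} (A : Matrix (Fin n) (Fin n) R) :
    Matrix (Fin (n - 2)) (Fin (n - 2)) R :=
  Matrix.of fun i j => A ⟨i + 1, by omega⟩ ⟨j + 1, by omega⟩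

section MeroMatrix

variable {M : Type*} [TopologicalSpace M] [ChartedSpace ℂ M]

variable (M) in
/-- Meromorphic maps from `M` to the `λ`-independent block unitriangular matrices that are
complex-orthogonal. -/
def meroGroupR {n : ℕ} (ξ : Fin n → ℕ) : Set (Matrix (Fin n) (Fin n) (FunGerm M)) :=
  {A | (∀ i j, A i j ∈ meroFun M) ∧ (∀ i j, ξ i ≤ ξ j → A i j = if i = j then 1 else 0) ∧
    secondTranspose A * A = 1}

variable (M) in
/-- The solutions `A` among these of the extended solution equation, which for `λ`-independent `A`
reads `c_k' = ∑_{j : ξ_j = ξ_k + 1} a_jk' c_j` for the columns `c_k` of `A`. -/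
def solR [T1Space M] {n : ℕ} (ξ : Fin n → ℕ) : Set (Matrix (Fin n) (Fin n) (FunGerm M)) :=
  {A | A ∈ meroGroupR M ξ ∧
    ∀ i k, D (A i k) = ∑ j with ξ j = ξ k + 1, D (A j k) * A i j}

/-- The superdiagonal entries of `A` are non-constant. -/
def IsNondegenerate {n : ℕ} (A : Matrix (Fin n) (Fin n) (FunGerm M)) : Prop :=
  ∀ (k : ℕ) (h : k + 1 < n), IsNonconst (A ⟨k, by omega⟩ ⟨k + 1, h⟩)

/-- `a_ij = μ_{m+1-i}^{(2m+1-i-j)}` for `i < j`, `i + j ≤ 2m+1`, with indices from `1`. -/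
def HasEntries [T1Space M] (m : ℕ) (μ : Fin m → FunGerm M)
    (A : Matrix (Fin (2 * m + 1)) (Fin (2 * m + 1)) (FunGerm M)) : Prop :=
  ∀ (i j : Fin (2 * m + 1)) (hij : i < j) (h : (i : ℕ) + j < 2 * m),
    A i j = muDer m μ ⟨m - 1 - i, by have : (i : ℕ) < j := hij; omega⟩ (2 * m - 1 - i - j)

/-- `μ_i = a_{m-i+1, m+i}`, with indices from `1`. -/
def parameters (m : ℕ) (A : Matrix (Fin (2 * m + 1)) (Fin (2 * m + 1)) (FunGerm M))
    (t : Fin m) : FunGerm M :=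
  A ⟨m - 1 - t, by omega⟩ ⟨m + t, by omega⟩

end MeroMatrix

/-! ### Loops -/

/-- `γ` is a smooth loop in `U(n)` based at the identity. -/
def IsBasedLoop {n : ℕ} (γ : Circle → Matrix (Fin n) (Fin n) ℂ) : Prop :=
  (∀ l, γ l ∈ Matrix.unitaryGroup (Fin n) ℂ) ∧ γ 1 = 1 ∧
    ∀ i j, ContMDiff (𝓡 1) 𝓘(ℝ, ℂ) ∞ fun l => γ l i j

/-- `B` is a smooth loop in `GL(n, ℂ)` that extends holomorphically, as a map to `GL(n, ℂ)`, to
the unit disc. -/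
def IsPlusLoop {n : ℕ} (B : Circle → Matrix (Fin n) (Fin n) ℂ) : Prop :=
  (∀ i j, ContMDiff (𝓡 1) 𝓘(ℝ, ℂ) ∞ fun l => B l i j) ∧
  ∃ g : ℂ → Matrix (Fin n) (Fin n) ℂ,
    (∀ i j, DiffContOnCl ℂ (fun w => g w i j) (Metric.ball 0 1)) ∧
    (∀ w ∈ Metric.closedBall (0 : ℂ) 1, IsUnit (g w)) ∧ ∀ l : Circle, g l = B l

/-- `γ = [ψ]`: `γ` is the factor in `ΩU(n)` of the loop `ψ` in its Iwasawa decomposition. -/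
def IsIwasawaFactor {n : ℕ} (ψ γ : Circle → Matrix (Fin n) (Fin n) ℂ) : Prop :=
  IsBasedLoop γ ∧ ∃ B, IsPlusLoop B ∧ ∀ l, ψ l = γ l * B l

/-- The based loops in `U(n)` that are polynomials of degree at most `r` in `λ` and are real of
degree `r`: `γ^T γ = λ^r I`. -/
def omegaReal (n r : ℕ) : Set (Circle → Matrix (Fin n) (Fin n) ℂ) :=
  {γ | IsBasedLoop γ ∧
    (∃ S : ℕ → Matrix (Fin n) (Fin n) ℂ,
      ∀ l : Circle, γ l = ∑ k ∈ Finset.range (r + 1), (l : ℂ) ^ k • S k) ∧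
    ∀ l : Circle, secondTranspose (γ l) * γ l = (l : ℂ) ^ r • 1}

/-! ### Extended solutions and harmonic maps -/

/-- The Wirtinger derivative `∂/∂z`, entry by entry. -/
def dz {n : ℕ} (g : ℂ → Matrix (Fin n) (Fin n) ℂ) (w : ℂ) : Matrix (Fin n) (Fin n) ℂ :=
  Matrix.of fun i j => (1 / 2 : ℂ) *
    (fderiv ℝ (fun v => g v i j) w 1 - Complex.I * fderiv ℝ (fun v => g v i j) w Complex.I)

/-- The Wirtinger derivative `∂/∂z̄`, entry by entry. -/
def dzbar {n : ℕ} (g : ℂ → Matrix (Fin n) (Fin n) ℂ) (w : ℂ) : Matrix (Fin n) (Fin n) ℂ :=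
  Matrix.of fun i j => (1 / 2 : ℂ) *
    (fderiv ℝ (fun v => g v i j) w 1 + Complex.I * fderiv ℝ (fun v => g v i j) w Complex.I)

section Solutions

variable {M : Type*} [TopologicalSpace M] [ChartedSpace ℂ M]

/-- `Φ` is a smooth map from `M` to the based loop group of `U(n)` (that is, it is smooth on
`M × S¹`) such that, in each coordinate domain, `Φ⁻¹ Φ_z = (1 - λ⁻¹) P` with `P` independent
of `λ`. -/
def IsExtendedSolution {n : ℕ} (Φ : M → Circle → Matrix (Fin n) (Fin n) ℂ) : Prop :=
  (∀ x, IsBasedLoop (Φ x)) ∧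
  (∀ i j, ContMDiff (𝓘(ℝ, ℂ).prod (𝓡 1)) 𝓘(ℝ, ℂ) ∞
    fun p : M × Circle => Φ p.1 p.2 i j) ∧
  ∀ e ∈ atlas ℂ M, ∀ w ∈ e.target, ∃ P : Matrix (Fin n) (Fin n) ℂ, ∀ l : Circle,
    (Φ (e.symm w) l)⁻¹ * dz (fun v => Φ (e.symm v) l) w = (1 - (l : ℂ)⁻¹) • P

/-- `Φ` is `S¹`-invariant. -/
def IsS1Invariant {n : ℕ} (Φ : M → Circle → Matrix (Fin n) (Fin n) ℂ) : Prop :=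
  ∀ (x : M) (l k : Circle), Φ x (l * k) = Φ x l * Φ x k

/-- `Φ = [a γ_ξ]` for a meromorphic map `a` from `M` to matrices polynomial in `λ`: equality holds
off a closed discrete set, over which `Φ` is thus an extension of `[a γ_ξ]`. -/
def IsProjection {n : ℕ} (ξ : Fin n → ℕ) (a : M → Matrix (Fin n) (Fin n) ℂ[X])
    (Φ : M → Circle → Matrix (Fin n) (Fin n) ℂ) : Prop :=
  ∀ᶠ x in codiscrete M,
    IsIwasawaFactor (fun l => (a x).map (eval (l : ℂ)) * geodesic ξ l) (Φ x)

/-- `Φ = [A γ_ξ]` for a meromorphic matrix `A` independent of `λ`. -/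
def IsConstProjection {n : ℕ} (ξ : Fin n → ℕ) (A : Matrix (Fin n) (Fin n) (FunGerm M))
    (Φ : M → Circle → Matrix (Fin n) (Fin n) ℂ) : Prop :=
  ∃ b : M → Matrix (Fin n) (Fin n) ℂ,
    (∀ i j, ((fun x => b x i j : M → ℂ) : FunGerm M) = A i j) ∧
    IsProjection ξ (fun x => (b x).map C) Φ

variable (M) in
/-- The `S¹`-invariant extended solutions `Φ : M → Ω_r U(n)^ℝ`. -/
def s1Solutions (n r : ℕ) : Set (M → Circle → Matrix (Fin n) (Fin n) ℂ) :=
  {Φ | IsExtendedSolution Φ ∧ (∀ x, Φ x ∈ omegaReal n r) ∧ IsS1Invariant Φ}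

variable (M) in
/-- The non-degenerate `S¹`-invariant extended solutions `Φ : M → Ω_{n-1} U(n)^ℝ` of type
`(1, …, 1)`: `Φ = [a γ_{ξ_0}]` for a meromorphic map `a` to the group of `ξ_0`, the superdiagonal
entries of `a` (which do not involve `λ`) being non-constant. -/
def ndSolutions (n : ℕ) : Set (M → Circle → Matrix (Fin n) (Fin n) ℂ) :=
  {Φ | Φ ∈ s1Solutions M n (n - 1) ∧
    ∃ a : M → Matrix (Fin n) (Fin n) ℂ[X],
      (∀ i j q, IsMeromorphic fun x => (a x i j).coeff q) ∧
      (∀ x, a x ∈ groupC (xiOne n)) ∧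
      IsProjection (xiOne n) a Φ ∧
      IsNondegenerate (M := M)
        (Matrix.of fun i j => ((fun x => (a x i j).coeff 0 : M → ℂ) : FunGerm M))}

/-- `(1/2) φ⁻¹ φ_z` in the chart `e`. -/
def Az {n : ℕ} (φ : M → Matrix (Fin n) (Fin n) ℂ) (e : OpenPartialHomeomorph M ℂ) (w : ℂ) :
    Matrix (Fin n) (Fin n) ℂ :=
  (1 / 2 : ℂ) • ((φ (e.symm w))⁻¹ * dz (fun v => φ (e.symm v)) w)

/-- `(1/2) φ⁻¹ φ_z̄` in the chart `e`. -/
def Azbar {n : ℕ} (φ : M → Matrix (Fin n) (Fin n) ℂ) (e : OpenPartialHomeomorph M ℂ) (w : ℂ) :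
    Matrix (Fin n) (Fin n) ℂ :=
  (1 / 2 : ℂ) • ((φ (e.symm w))⁻¹ * dzbar (fun v => φ (e.symm v)) w)

/-- `φ : M → U(n)` is harmonic: it is smooth and, in each chart, `A_z` is a holomorphic
endomorphism for the operator `∂_z̄ + A_z̄`. -/
def IsHarmonicMap {n : ℕ} (φ : M → Matrix (Fin n) (Fin n) ℂ) : Prop :=
  (∀ x, φ x ∈ Matrix.unitaryGroup (Fin n) ℂ) ∧
  (∀ i j, ContMDiff 𝓘(ℝ, ℂ) 𝓘(ℝ, ℂ) ∞ fun x => φ x i j) ∧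
  ∀ e ∈ atlas ℂ M, ∀ w ∈ e.target,
    dzbar (Az φ e) w + (Azbar φ e w * Az φ e w - Az φ e w * Azbar φ e w) = 0

/-- `α` is a holomorphic subbundle of rank `k` of `M × ℂⁿ`. -/
def IsHolSubbundle {n : ℕ} (k : ℕ) (α : M → Submodule ℂ (EuclideanSpace ℂ (Fin n))) : Prop :=
  ∀ x₀ : M, ∃ U : Set M, IsOpen U ∧ x₀ ∈ U ∧ ∃ s : Fin k → M → EuclideanSpace ℂ (Fin n),
    (∀ i, MDifferentiableOn 𝓘(ℂ, ℂ) 𝓘(ℂ, EuclideanSpace ℂ (Fin n)) (s i) U) ∧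
    ∀ x ∈ U, LinearIndependent ℂ (fun i => s i x) ∧
      α x = Submodule.span ℂ (Set.range fun i => s i x)

end Solutions

/-! ### Explicit formulae -/

/-- The matrix of the orthogonal projection onto `V`. -/
def proj {n : ℕ} (V : Submodule ℂ (EuclideanSpace ℂ (Fin n))) : Matrix (Fin n) (Fin n) ℂ :=
  Matrix.toEuclideanLin.symm (V.starProjection : _ →ₗ[ℂ] _)

/-- The span of the last `k` columns of `B`. -/
def lastColumns {n : ℕ} (B : Matrix (Fin n) (Fin n) ℂ) (k : ℕ) :
    Submodule ℂ (EuclideanSpace ℂ (Fin n)) :=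
  Submodule.span ℂ {v | ∃ j : Fin n, n ≤ j + k ∧ v = WithLp.toLp 2 fun i => B i j}

/-- The product `(π_{α_1} + λ π_{α_1}^⊥) ⋯ (π_{α_r} + λ π_{α_r}^⊥)`. -/
def unitonProduct {n : ℕ} (r : ℕ) (α : ℕ → Submodule ℂ (EuclideanSpace ℂ (Fin n)))
    (l : ℂ) : Matrix (Fin n) (Fin n) ℂ :=
  (List.ofFn fun i : Fin r => proj (α (i + 1)) + l • proj (α (i + 1))ᗮ).prod

/-- The sum of the `ψ_{2i}` (`0 ≤ i ≤ [r/2]`), where `ψ_i = α_i^⊥ ∩ α_{i+1}`. -/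
def evenSum {n : ℕ} (r : ℕ) (α : ℕ → Submodule ℂ (EuclideanSpace ℂ (Fin n))) :
    Submodule ℂ (EuclideanSpace ℂ (Fin n)) :=
  ⨆ i ∈ Finset.range (r / 2 + 1), (α (2 * i))ᗮ ⊓ α (2 * i + 1)

/-- The Cartan embedding `V ↦ π_V - π_V^⊥` of the Grassmannian in `U(n)`. -/
def cartan {n : ℕ} (V : Submodule ℂ (EuclideanSpace ℂ (Fin n))) : Matrix (Fin n) (Fin n) ℂ :=
  proj V - proj Vᗮ

end HarmonicOn

end

/-!
The theorem combines an algebraic parametrization of the matrices `A`, a loop group argument that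
identifies them with extended solutions, and a computation with holomorphic flags.

*The matrices.* A complex-orthogonal upper unitriangular matrix is determined by its entries above
both diagonals, and these are arbitrary (`IsUnitriangular.eq_of_orthogonal`,
`exists_orthogonal_unitriangular`). For such an `A` the matrix `AᵀA'` is skew for the second
transpose, so that the equations `c_k' = a_{k-1,k}' c_{k-1}` hold as soon as they hold in the
entries above both diagonals (`IsDerivationOn.solves_of_half`). There they say that each entry is
the generalized derivative of the one to its right, so that `A` is computed from the entries
`μ_i` next to the antidiagonal and conversely; the divisions are possible since on a connected surface a
non-constant meromorphic function has invertible derivative (`D_mul_inv_of_isNonconst`).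

*The loops.* By the maximum principle the factor `[ψ]` of a loop `ψ` is unique
(`IsIwasawaFactor.unique`), and comparison of powers of `λ` shows that `[a γ]` determines `a`
(`groupC_eq_of_mul_geodesic`). Consequently `S¹`-invariance of `[a γ]` makes `a` independent of
`λ` (`exists_const_of_s1Invariant`), and reality of `[b γ]` is orthogonality of `b`
(`IsUnitriangular.orthogonal_of_real`, `real_of_orthogonal`). For constant `b` the factor is
explicit: it is `Φ = Σ λ^k Q_k`, where `Q_k = P_{k+1} - P_k` and `P_k` is the orthogonal
projection onto the span of the last `k` columns of `b` (`IsUnitriangular.isIwasawaFactor`). The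
product of unitons in the theorem is the same sum (`IsFlag.unitonProduct_eq`).

*The flag.* The span of the last columns of a meromorphic unitriangular matrix extends over its
poles to a holomorphic subbundle `α_k`: dividing by a minor of least order gives a holomorphic
frame (`exists_holomorphic_frame`, `isHolSubbundle_limitFlag`). Hence `Φ` extends smoothly, and
identities that hold off a closed discrete set hold everywhere by continuity.

*The differential equations.* Holomorphy of `α_k` is `P_k (P_k)_z = 0`. The equation for the
columns says that derivatives of sections of `α_k` lie in `α_{k+1}`, that is, `(1 - P_{k+1})
(P_k)_z = 0` (`eventually_coordDeriv_eq_iff`). Together they give `(P_k)_z = Q_k (P_k)_z`, whence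
`Φ_z = (λ⁻¹ - 1) Φ T_z` with `T = Σ P_k` (`dz_flagLoop`), which is the extended solution equation.
Conversely, comparing powers of `λ` in that equation recovers the condition on `α_k`
(`one_sub_proj_mul_dz_proj`), which gives surjectivity onto the extended solutions. At `λ = -1`
one gets `φ_z = -2 φ T_z` and `φ_z̄ = 2 φ T_z̄`, and equality of the mixed second derivatives of
`φ` is the harmonic map equation (`harmonic_of_dz_eq`).
-/

namespace HarmonicOn

/-! ### Meromorphic functions in charts -/

section Charts

variable {M : Type*} [TopologicalSpace M]

lemma eventually_codiscrete_iff {p : M → Prop} :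
    (∀ᶠ x in codiscrete M, p x) ↔ ∀ x, ∀ᶠ y in 𝓝[≠] x, p y := by
  rw [Filter.Eventually, mem_codiscrete]
  simp only [disjoint_principal_right, compl_compl]
  rfl

lemma tendsto_chart_nhdsNE (e : OpenPartialHomeomorph M ℂ) {x : M} (hx : x ∈ e.source) :
    Tendsto e (𝓝[≠] x) (𝓝[≠] (e x)) := by
  refine tendsto_nhdsWithin_iff.2 ⟨(e.continuousAt hx).tendsto.mono_left nhdsWithin_le_nhds, ?_⟩
  filter_upwards [self_mem_nhdsWithin, nhdsWithin_le_nhds (e.open_source.mem_nhds hx)] with y h1 h2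
  exact fun h => h1 (e.injOn h2 hx h)

lemma tendsto_chart_symm_nhdsNE (e : OpenPartialHomeomorph M ℂ) {w : ℂ} (hw : w ∈ e.target) :
    Tendsto e.symm (𝓝[≠] w) (𝓝[≠] (e.symm w)) := by
  refine tendsto_nhdsWithin_iff.2
    ⟨(e.continuousAt_symm hw).tendsto.mono_left nhdsWithin_le_nhds, ?_⟩
  filter_upwards [self_mem_nhdsWithin, nhdsWithin_le_nhds (e.open_target.mem_nhds hw)] with y h1 h2
  exact fun h => h1 (e.symm.injOn h2 hw h)

lemma eventually_chart_iff (e : OpenPartialHomeomorph M ℂ) {w : ℂ} (hw : w ∈ e.target)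
    {p : M → Prop} :
    (∀ᶠ v in 𝓝[≠] w, p (e.symm v)) ↔ ∀ᶠ y in 𝓝[≠] (e.symm w), p y := by
  refine ⟨fun h => ?_, fun h => (tendsto_chart_symm_nhdsNE e hw).eventually h⟩
  have hs := e.map_target hw
  have h1 := tendsto_chart_nhdsNE e hs
  rw [e.right_inv hw] at h1
  filter_upwards [h1.eventually h, nhdsWithin_le_nhds (e.open_source.mem_nhds hs)] with y hy hy'
  rwa [e.left_inv hy'] at hy

lemma eventually_chart_of_codiscrete {p : M → Prop} (h : ∀ᶠ x in codiscrete M, p x)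
    (e : OpenPartialHomeomorph M ℂ) {w : ℂ} (hw : w ∈ e.target) :
    ∀ᶠ v in 𝓝[≠] w, p (e.symm v) :=
  (eventually_chart_iff e hw).2 (eventually_codiscrete_iff.1 h _)

lemma comp_transition_eventuallyEq {Y : Type*} (f : M → Y) {e e' : OpenPartialHomeomorph M ℂ}
    {w : ℂ} (hw : w ∈ e.target) (hw' : e.symm w ∈ e'.source) :
    f ∘ e.symm =ᶠ[𝓝 w] (f ∘ e'.symm) ∘ (e' ∘ e.symm) := by
  have : e.target ∩ e.symm ⁻¹' e'.source ∈ 𝓝 w :=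
    (e.isOpen_inter_preimage_symm e'.open_source).mem_nhds ⟨hw, hw'⟩
  filter_upwards [this] with v hv
  simp [e'.left_inv hv.2]

variable [ChartedSpace ℂ M]

instance nhdsNE_neBot (x : M) : (𝓝[≠] x).NeBot := by
  have h := tendsto_chart_symm_nhdsNE (chartAt ℂ x) (mem_chart_target ℂ x)
  rw [(chartAt ℂ x).left_inv (mem_chart_source ℂ x)] at h
  exact h.neBot

/-- Continuous maps that agree off a closed discrete set are equal. -/
lemma eq_of_eventually_codiscrete {Y : Type*} [TopologicalSpace Y] [T2Space Y] {f g : M → Y}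
    (hf : Continuous f) (hg : Continuous g) (h : ∀ᶠ x in codiscrete M, f x = g x) : f = g := by
  funext x
  have h1 : Tendsto f (𝓝[≠] x) (𝓝 (f x)) := hf.continuousAt.tendsto.mono_left nhdsWithin_le_nhds
  have h2 : Tendsto g (𝓝[≠] x) (𝓝 (g x)) := hg.continuousAt.tendsto.mono_left nhdsWithin_le_nhds
  exact tendsto_nhds_unique_of_eventuallyEq h1 h2 (eventually_codiscrete_iff.1 h x)

lemma isMeromorphic_const (c : ℂ) : IsMeromorphic fun _ : M => c := fun _ => MeromorphicAt.const c _

variable [IsManifold 𝓘(ℂ, ℂ) ω M]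

lemma contDiffOn_transition {e e' : OpenPartialHomeomorph M ℂ} (he : e ∈ atlas ℂ M)
    (he' : e' ∈ atlas ℂ M) : ContDiffOn ℂ ω (e' ∘ e.symm) (e.symm ≫ₕ e').source := by
  have h := (StructureGroupoid.compatible (contDiffGroupoid ω 𝓘(ℂ, ℂ)) he he')
  simpa [contDiffPregroupoid] using (contDiffGroupoid ω 𝓘(ℂ, ℂ)).mem_of_eqOnSource h
    (OpenPartialHomeomorph.eqOnSource_refl _) |>.1

lemma analyticAt_transition {e e' : OpenPartialHomeomorph M ℂ} (he : e ∈ atlas ℂ M)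
    (he' : e' ∈ atlas ℂ M) {w : ℂ} (hw : w ∈ e.target) (hw' : e.symm w ∈ e'.source) :
    AnalyticAt ℂ (e' ∘ e.symm) w := by
  have h := contDiffOn_transition he he'
  have h1 : w ∈ (e.symm ≫ₕ e').source := by simp [hw, hw']
  have h2 := (h w h1).contDiffAt ((e.symm ≫ₕ e').open_source.mem_nhds h1)
  exact h2.analyticAt

lemma deriv_transition_ne_zero {e e' : OpenPartialHomeomorph M ℂ} (he : e ∈ atlas ℂ M)
    (he' : e' ∈ atlas ℂ M) {w : ℂ} (hw : w ∈ e.target) (hw' : e.symm w ∈ e'.source) :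
    deriv (e' ∘ e.symm) w ≠ 0 := by
  have h1 := (analyticAt_transition he he' hw hw').differentiableAt
  have hs : e'.symm (e' (e.symm w)) = e.symm w := e'.left_inv hw'
  have h2 : DifferentiableAt ℂ (e ∘ e'.symm) ((e' ∘ e.symm) w) :=
    (analyticAt_transition he' he (e'.map_source hw')
      (by rw [hs]; exact e.map_target hw)).differentiableAt
  have h3 : (e ∘ e'.symm) ∘ (e' ∘ e.symm) =ᶠ[𝓝 w] id := by
    have : e.target ∩ e.symm ⁻¹' e'.source ∈ 𝓝 w :=
      (e.isOpen_inter_preimage_symm e'.open_source).mem_nhds ⟨hw, hw'⟩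
    filter_upwards [this] with v hv
    simp [e'.left_inv hv.2, e.right_inv hv.1]
  have h4 := deriv_comp w h2 h1
  rw [h3.deriv_eq, deriv_id] at h4
  exact fun h => by simp [h] at h4

lemma IsMeromorphic.meromorphicAt {f : M → ℂ} (hf : IsMeromorphic f)
    {e : OpenPartialHomeomorph M ℂ} (he : e ∈ atlas ℂ M) {w : ℂ} (hw : w ∈ e.target) :
    MeromorphicAt (f ∘ e.symm) w := by
  have h1 := hf (e.symm w)
  have h2 := analyticAt_transition he (chart_mem_atlas ℂ (e.symm w)) hw (mem_chart_source ℂ _)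
  exact (h1.comp_analyticAt (g := chartAt ℂ (e.symm w) ∘ e.symm) h2).congr
    ((comp_transition_eventuallyEq f hw (mem_chart_source ℂ _)).symm.filter_mono nhdsWithin_le_nhds)

lemma analyticAt_comp_symm_of_chart {f : M → ℂ} {e e' : OpenPartialHomeomorph M ℂ}
    (he : e ∈ atlas ℂ M) (he' : e' ∈ atlas ℂ M) {w : ℂ} (hw : w ∈ e.target)
    (hw' : e.symm w ∈ e'.source) (h : AnalyticAt ℂ (f ∘ e'.symm) (e' (e.symm w))) :
    AnalyticAt ℂ (f ∘ e.symm) w :=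
  (AnalyticAt.comp (g := f ∘ e'.symm) (f := e' ∘ e.symm) h
    (analyticAt_transition he he' hw hw')).congr
    (comp_transition_eventuallyEq f hw hw').symm

/-- Off a closed discrete set, a meromorphic function is analytic in all charts. -/
lemma IsMeromorphic.eventually_analyticAt {f : M → ℂ} (hf : IsMeromorphic f) :
    ∀ᶠ x in codiscrete M, ∀ e ∈ atlas ℂ M, x ∈ e.source → AnalyticAt ℂ (f ∘ e.symm) (e x) := by
  refine eventually_codiscrete_iff.2 fun x => ?_
  have h1 := (hf x).eventually_analyticAt
  have hx := mem_chart_source ℂ x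
  filter_upwards [(tendsto_chart_nhdsNE (chartAt ℂ x) hx).eventually h1,
    nhdsWithin_le_nhds ((chartAt ℂ x).open_source.mem_nhds hx)] with y hy hys e he hye
  refine analyticAt_comp_symm_of_chart he (chart_mem_atlas ℂ x) (e.map_source hye) ?_ ?_
  · rwa [e.left_inv hye]
  · rwa [e.left_inv hye]

/-- The derivative in the preferred chart is the derivative in any other chart, times the
derivative of the coordinate change. -/
lemma coordDeriv_eq_mul {f : M → ℂ} {e : OpenPartialHomeomorph M ℂ} (he : e ∈ atlas ℂ M) {x : M}
    (hx : x ∈ e.source) (hf : AnalyticAt ℂ (f ∘ e.symm) (e x)) :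
    coordDeriv f x =
      deriv (f ∘ e.symm) (e x) * deriv (e ∘ (chartAt ℂ x).symm) (chartAt ℂ x x) := by
  have hc := chart_mem_atlas ℂ x
  have hl := (chartAt ℂ x).left_inv (mem_chart_source ℂ x)
  have hx' : (chartAt ℂ x).symm (chartAt ℂ x x) ∈ e.source := by rwa [hl]
  have h1 := comp_transition_eventuallyEq f (mem_chart_target ℂ x) hx'
  rw [coordDeriv, h1.deriv_eq]
  have h2 := analyticAt_transition hc he (mem_chart_target ℂ x) hx'
  have := deriv_comp (chartAt ℂ x x) (h₂ := f ∘ e.symm) (h := e ∘ (chartAt ℂ x).symm)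
    (by simpa [hl] using hf.differentiableAt) h2.differentiableAt
  rw [this]
  simp [hl]

lemma deriv_transition_chartAt_ne_zero {e : OpenPartialHomeomorph M ℂ} (he : e ∈ atlas ℂ M) {x : M}
    (hx : x ∈ e.source) : deriv (e ∘ (chartAt ℂ x).symm) (chartAt ℂ x x) ≠ 0 :=
  deriv_transition_ne_zero (chart_mem_atlas ℂ x) he (mem_chart_target ℂ x)
    (by rwa [(chartAt ℂ x).left_inv (mem_chart_source ℂ x)])

end Charts

/-! ### The field of meromorphic functions and its derivation -/

section MeroFun

variable {M : Type*} [TopologicalSpace M]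

lemma const_half_mul_two : ((fun _ : M => (1 / 2 : ℂ) : M → ℂ) : FunGerm M) * 2 = 1 := by
  have h2 : (2 : FunGerm M) = ((fun _ : M => (2 : ℂ) : M → ℂ) : FunGerm M) := rfl
  rw [h2, ← Germ.coe_mul]
  exact congrArg _ (funext fun x => by simp)

/-- A meromorphic function whose derivative vanishes near a point is constant near it: after
subtraction of its limit it would have a positive finite order, which differentiation lowers by
one. -/
lemma eventually_const_of_deriv {F : ℂ → ℂ} {w : ℂ} (hF : MeromorphicAt F w)
    (h : ∀ᶠ v in 𝓝[≠] w, deriv F v = 0) : ∃ c, ∀ᶠ v in 𝓝[≠] w, F v = c := by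
  have key : ∀ G : ℂ → ℂ, MeromorphicAt G w → (∀ᶠ v in 𝓝[≠] w, deriv G v = 0) →
      meromorphicOrderAt G w ≠ 0 → ∀ᶠ v in 𝓝[≠] w, G v = 0 := by
    intro G hG hd h0
    rw [← meromorphicOrderAt_eq_top_iff]
    by_contra htop
    obtain ⟨n, hn⟩ := WithTop.ne_top_iff_exists.1 htop
    have hn0 : (n : ℂ) ≠ 0 := by
      intro h'
      apply h0
      rw [← hn, Int.cast_eq_zero.1 h']
      rfl
    have h1 := meromorphicOrderAt_deriv_eq_sub_one hn0 hn.symm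
    rw [meromorphicOrderAt_eq_top_iff.2 hd] at h1
    exact WithTop.top_ne_coe h1
  by_cases h0 : meromorphicOrderAt F w = 0
  · obtain ⟨c, hc⟩ := tendsto_nhds_of_meromorphicOrderAt_nonneg hF h0.ge
    have hG : MeromorphicAt (fun v => F v - c) w := hF.sub (MeromorphicAt.const c w)
    refine ⟨c, ?_⟩
    have hlim : Tendsto (fun v => F v - c) (𝓝[≠] w) (𝓝 0) := by
      simpa using hc.sub_const c
    have := key (fun v => F v - c) hG (by
      filter_upwards [h] with v hv
      simpa using hv) ((tendsto_zero_iff_meromorphicOrderAt_pos hG).1 hlim).ne'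
    filter_upwards [this] with v hv using sub_eq_zero.1 hv
  · exact ⟨0, key F hF h h0⟩

variable [ChartedSpace ℂ M]

variable (M) in
/-- The meromorphic functions, as a subring of the ring of all functions modulo equality off
closed discrete sets. -/
def meroSubring : Subring (FunGerm M) where
  carrier := meroFun M
  mul_mem' := by
    rintro _ _ ⟨f, hf, rfl⟩ ⟨g, hg, rfl⟩
    exact ⟨f * g, fun x => (hf x).mul (hg x), rfl⟩
  one_mem' := ⟨fun _ => 1, isMeromorphic_const 1, rfl⟩
  add_mem' := by
    rintro _ _ ⟨f, hf, rfl⟩ ⟨g, hg, rfl⟩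
    exact ⟨f + g, fun x => (hf x).add (hg x), rfl⟩
  zero_mem' := ⟨fun _ => 0, isMeromorphic_const 0, rfl⟩
  neg_mem' := by
    rintro _ ⟨f, hf, rfl⟩
    exact ⟨-f, fun x => (hf x).neg, rfl⟩

lemma const_mem_meroSubring (c : ℂ) : ((fun _ : M => c : M → ℂ) : FunGerm M) ∈ meroSubring M :=
  ⟨_, isMeromorphic_const c, rfl⟩

section LocallyConstant

variable [IsManifold 𝓘(ℂ, ℂ) ω M]

lemma IsMeromorphic.eventually_coordDeriv {f : M → ℂ} (hf : IsMeromorphic f) (x : M) :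
    (∀ᶠ y in 𝓝[≠] x, coordDeriv f y = 0) ∨ ∀ᶠ y in 𝓝[≠] x, coordDeriv f y ≠ 0 := by
  set e := chartAt ℂ x
  have he : e ∈ atlas ℂ M := chart_mem_atlas ℂ x
  have hxs : x ∈ e.source := mem_chart_source ℂ x
  have key : ∀ᶠ y in 𝓝[≠] x, (coordDeriv f y = 0 ↔ deriv (f ∘ e.symm) (e y) = 0) := by
    filter_upwards [eventually_codiscrete_iff.1 hf.eventually_analyticAt x,
      nhdsWithin_le_nhds (e.open_source.mem_nhds hxs)] with y hy hys
    rw [coordDeriv_eq_mul he hys (hy e he hys)]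
    simp [deriv_transition_chartAt_ne_zero he hys]
  rcases (hf x).deriv.eventually_eq_zero_or_eventually_ne_zero with h | h
  · left
    filter_upwards [key, (tendsto_chart_nhdsNE e hxs).eventually h] with y h1 h2 using h1.2 h2
  · right
    filter_upwards [key, (tendsto_chart_nhdsNE e hxs).eventually h] with y h1 h2 h3
    exact h2 (h1.1 h3)

lemma IsMeromorphic.eventually_const_of_coordDeriv {f : M → ℂ} (hf : IsMeromorphic f) {x : M}
    (h : ∀ᶠ y in 𝓝[≠] x, coordDeriv f y = 0) : ∃ c, ∀ᶠ y in 𝓝[≠] x, f y = c := by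
  set e := chartAt ℂ x
  have he : e ∈ atlas ℂ M := chart_mem_atlas ℂ x
  have hxt : e x ∈ e.target := mem_chart_target ℂ x
  have hl : e.symm (e x) = x := e.left_inv (mem_chart_source ℂ x)
  have h' : ∀ᶠ v in 𝓝[≠] (e x), coordDeriv f (e.symm v) = 0 :=
    (eventually_chart_iff e hxt (p := fun y => coordDeriv f y = 0)).2 (by rwa [hl])
  obtain ⟨c, hc⟩ := eventually_const_of_deriv (hf x) (by
    filter_upwards [eventually_chart_of_codiscrete hf.eventually_analyticAt e hxt, h',
      nhdsWithin_le_nhds (e.open_target.mem_nhds hxt)] with v h1 h2 hv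
    have hs := e.map_target hv
    rw [coordDeriv_eq_mul he hs (h1 e he hs), e.right_inv hv] at h2
    exact (mul_eq_zero.1 h2).resolve_right (deriv_transition_chartAt_ne_zero he hs))
  refine ⟨c, ?_⟩
  have := (eventually_chart_iff e hxt (p := fun y => f y = c)).1 hc
  rwa [hl] at this

end LocallyConstant

variable [T1Space M]

lemma D_coe (f : M → ℂ) : D (f : FunGerm M) = (coordDeriv f : FunGerm M) := rfl

lemma D_const (c : ℂ) : D ((fun _ : M => c : M → ℂ) : FunGerm M) = 0 := by
  rw [D_coe]
  refine congrArg _ (funext fun x => ?_)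
  exact deriv_const _ c

lemma D_one : D (1 : FunGerm M) = 0 := D_const 1

lemma D_zero : D (0 : FunGerm M) = 0 := D_const 0

variable [IsManifold 𝓘(ℂ, ℂ) ω M]

lemma D_add {φ ψ : FunGerm M} (hφ : φ ∈ meroSubring M) (hψ : ψ ∈ meroSubring M) :
    D (φ + ψ) = D φ + D ψ := by
  obtain ⟨f, hf, rfl⟩ := hφ
  obtain ⟨g, hg, rfl⟩ := hψ
  rw [← Germ.coe_add, D_coe, D_coe, D_coe, ← Germ.coe_add]
  refine Germ.coe_eq.2 ?_
  filter_upwards [hf.eventually_analyticAt, hg.eventually_analyticAt] with x h1 h2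
  exact deriv_add (h1 _ (chart_mem_atlas ℂ x) (mem_chart_source ℂ x)).differentiableAt
    (h2 _ (chart_mem_atlas ℂ x) (mem_chart_source ℂ x)).differentiableAt

lemma D_mul {φ ψ : FunGerm M} (hφ : φ ∈ meroSubring M) (hψ : ψ ∈ meroSubring M) :
    D (φ * ψ) = D φ * ψ + φ * D ψ := by
  obtain ⟨f, hf, rfl⟩ := hφ
  obtain ⟨g, hg, rfl⟩ := hψ
  rw [← Germ.coe_mul, D_coe, D_coe, D_coe, ← Germ.coe_mul, ← Germ.coe_mul, ← Germ.coe_add]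
  refine Germ.coe_eq.2 ?_
  filter_upwards [hf.eventually_analyticAt, hg.eventually_analyticAt] with x h1 h2
  have := deriv_mul (h1 _ (chart_mem_atlas ℂ x) (mem_chart_source ℂ x)).differentiableAt
    (h2 _ (chart_mem_atlas ℂ x) (mem_chart_source ℂ x)).differentiableAt
  simp only [Function.comp_apply, (chartAt ℂ x).left_inv (mem_chart_source ℂ x)] at this
  exact this

/-- Quotients of derivatives are meromorphic: the factors from the changes of coordinates
cancel. -/
lemma D_div_D_mem {φ ψ : FunGerm M} (hφ : φ ∈ meroSubring M) (hψ : ψ ∈ meroSubring M) :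
    D φ / D ψ ∈ meroSubring M := by
  obtain ⟨f, hf, rfl⟩ := hφ
  obtain ⟨g, hg, rfl⟩ := hψ
  refine ⟨fun x => coordDeriv f x / coordDeriv g x, fun x => ?_, rfl⟩
  set e := chartAt ℂ x
  have he : e ∈ atlas ℂ M := chart_mem_atlas ℂ x
  have hx : e x ∈ e.target := mem_chart_target ℂ x
  refine ((hf x).deriv.div (hg x).deriv).congr ?_
  filter_upwards [eventually_chart_of_codiscrete hf.eventually_analyticAt e hx,
    eventually_chart_of_codiscrete hg.eventually_analyticAt e hx,
    nhdsWithin_le_nhds (e.open_target.mem_nhds hx)] with v h1 h2 hv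
  have hs := e.map_target hv
  simp only [Pi.div_apply, Function.comp_apply]
  rw [coordDeriv_eq_mul he hs (h1 e he hs), coordDeriv_eq_mul he hs (h2 e he hs),
    mul_div_mul_right _ _ (deriv_transition_chartAt_ne_zero he hs), e.right_inv hv]

/-- On a connected surface the derivative of a non-constant meromorphic function is invertible: near
each point it either vanishes or has no zeros off the point, and both conditions are open. -/
lemma D_mul_inv_of_isNonconst [ConnectedSpace M] {φ : FunGerm M} (hφ : φ ∈ meroSubring M)
    (hn : IsNonconst φ) : D φ * (D φ)⁻¹ = 1 := by
  obtain ⟨f, hf, rfl⟩ := hφ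
  have hopen : ∀ p : M → Prop, IsOpen {x : M | ∀ᶠ y in 𝓝[≠] x, p y} := by
    intro p
    rw [isOpen_iff_mem_nhds]
    intro x hx
    obtain ⟨U, hU, hUo, hxU⟩ := eventually_nhds_iff.1 (eventually_nhdsWithin_iff.1 hx)
    filter_upwards [hUo.mem_nhds hxU] with y hy
    by_cases hyx : y = x
    · rw [hyx]; exact hx
    · filter_upwards [nhdsWithin_le_nhds (hUo.mem_nhds hy),
        nhdsWithin_le_nhds (isOpen_compl_singleton.mem_nhds hyx)] with z hz hz'
      exact hU z hz hz'
  have hdisj : ∀ p q : M → Prop, (∀ y, p y → ¬ q y) → Disjoint {x : M | ∀ᶠ y in 𝓝[≠] x, p y}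
      {x : M | ∀ᶠ y in 𝓝[≠] x, q y} := by
    intro p q hpq
    rw [Set.disjoint_left]
    intro x h1 h2
    obtain ⟨y, hy⟩ := (Filter.Eventually.and (Set.mem_ofPred_eq.mp h1) h2).exists
    exact hpq y hy.1 hy.2
  -- by the identity theorem, the alternative to `f' = 0` near `x` is `f' ≠ 0` near `x`
  have hclopen : IsClopen {x : M | ∀ᶠ y in 𝓝[≠] x, coordDeriv f y = 0} := by
    refine ⟨⟨?_⟩, hopen _⟩
    convert hopen fun y => coordDeriv f y ≠ 0 using 1
    ext x
    refine ⟨fun h => (hf.eventually_coordDeriv x).resolve_left h, fun h h' => ?_⟩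
    exact Set.disjoint_left.1 (hdisj _ _ fun y h1 h2 => h2 h1) h' h
  rcases isClopen_iff.1 hclopen with h | h
  · have h2 : ∀ᶠ y in codiscrete M, coordDeriv f y ≠ 0 := by
      refine eventually_codiscrete_iff.2 fun x => (hf.eventually_coordDeriv x).resolve_left ?_
      intro hx
      have : x ∈ (∅ : Set M) := h ▸ hx
      exact this
    rw [D_coe]
    refine Germ.coe_eq.2 ?_
    filter_upwards [h2] with y hy
    exact mul_inv_cancel₀ hy
  · exfalso
    have h1 : ∀ x : M, ∃ c, ∀ᶠ y in 𝓝[≠] x, f y = c := fun x =>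
      hf.eventually_const_of_coordDeriv (Set.eq_univ_iff_forall.1 h x)
    choose c hc using h1
    have x₀ : M := Classical.arbitrary M
    -- the locally constant value is globally constant
    have hcl : IsClopen {x : M | ∀ᶠ y in 𝓝[≠] x, f y = c x₀} := by
      refine ⟨⟨?_⟩, hopen _⟩
      convert hopen fun y => f y ≠ c x₀ using 1
      ext x
      refine ⟨fun hx => ?_, fun hx hx' =>
        Set.disjoint_left.1 (hdisj _ _ fun y h1 h2 => h2 h1) hx' hx⟩
      have hne : c x ≠ c x₀ := fun heq => hx (by
        have := hc x
        rwa [heq] at this)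
      filter_upwards [hc x] with y hy
      rwa [hy]
    have huniv := hcl.eq_univ ⟨x₀, hc x₀⟩
    refine hn (c x₀) (Germ.coe_eq.2 (eventually_codiscrete_iff.2 fun x => ?_))
    have : x ∈ {x : M | ∀ᶠ y in 𝓝[≠] x, f y = c x₀} := huniv ▸ Set.mem_univ x
    exact this

end MeroFun

/-! ### Unitriangular matrices and the second transpose -/

section Unitriangular

variable {R : Type*} [CommRing R] {n : ℕ}

/-- `A` is upper triangular with diagonal entries `1`. -/
def IsUnitriangular (A : Matrix (Fin n) (Fin n) R) : Prop :=
  ∀ i j, j ≤ i → A i j = if i = j then 1 else 0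

lemma IsUnitriangular.diag {A : Matrix (Fin n) (Fin n) R} (hA : IsUnitriangular A) (i : Fin n) :
    A i i = 1 := by simp [hA i i le_rfl]

lemma IsUnitriangular.lower {A : Matrix (Fin n) (Fin n) R} (hA : IsUnitriangular A)
    {i j : Fin n} (h : j < i) : A i j = 0 := by simp [hA i j h.le, h.ne']

lemma secondTranspose_mul (A B : Matrix (Fin n) (Fin n) R) :
    secondTranspose (A * B) = secondTranspose B * secondTranspose A := by
  ext i j
  simp only [secondTranspose, Matrix.of_apply, Matrix.mul_apply]
  rw [← Equiv.sum_comp Fin.revPerm]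
  refine Finset.sum_congr rfl fun l _ => ?_
  simp [mul_comm]

lemma secondTranspose_secondTranspose {R : Type*} {n : ℕ} (A : Matrix (Fin n) (Fin n) R) :
    secondTranspose (secondTranspose A) = A := by
  ext i j
  simp [secondTranspose]

lemma secondTranspose_one : secondTranspose (1 : Matrix (Fin n) (Fin n) R) = 1 := by
  ext i j
  simp [secondTranspose, Matrix.one_apply, eq_comm]

lemma secondTranspose_mul_apply (A B : Matrix (Fin n) (Fin n) R) (i j : Fin n) :
    (secondTranspose A * B) i j = ∑ l, A l.rev i.rev * B l j := rfl

lemma IsUnitriangular.secondTranspose {A : Matrix (Fin n) (Fin n) R} (hA : IsUnitriangular A) :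
    IsUnitriangular (secondTranspose A) := by
  intro i j hij
  have := hA j.rev i.rev (Fin.rev_le_rev.2 hij)
  rw [HarmonicOn.secondTranspose, Matrix.of_apply, this]
  simp [eq_comm]

lemma IsUnitriangular.mul {A B : Matrix (Fin n) (Fin n) R} (hA : IsUnitriangular A)
    (hB : IsUnitriangular B) : IsUnitriangular (A * B) := by
  intro i j hij
  rw [Matrix.mul_apply, Finset.sum_eq_single i]
  · rw [hA.diag, one_mul, hB i j hij]
  · intro l _ hl
    rcases lt_or_gt_of_ne hl with h | h
    · rw [hA.lower h, zero_mul]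
    · rw [hB.lower (lt_of_le_of_lt hij h), mul_zero]
  · simp

/-- The entries of `Aᵀ A` above the diagonal, for the second transpose. -/
lemma IsUnitriangular.secondTranspose_mul_self {A : Matrix (Fin n) (Fin n) R}
    (hA : IsUnitriangular A) {i j : Fin n} (hij : i < j) :
    (HarmonicOn.secondTranspose A * A) i j =
      A i j + A j.rev i.rev + ∑ l ∈ Finset.Ioo i j, A l.rev i.rev * A l j := by
  rw [secondTranspose_mul_apply]
  have h1 : ∑ l, A l.rev i.rev * A l j = ∑ l ∈ Finset.Icc i j, A l.rev i.rev * A l j := by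
    symm
    refine Finset.sum_subset (Finset.subset_univ _) fun l _ hl => ?_
    rw [Finset.mem_Icc, not_and_or, not_le, not_le] at hl
    rcases hl with h | h
    · rw [hA.lower (Fin.rev_lt_rev.2 h), zero_mul]
    · rw [hA.lower h, mul_zero]
  rw [h1, ← Finset.Ioc_insert_left hij.le, Finset.sum_insert (by simp),
    ← Finset.Ioo_insert_right hij, Finset.sum_insert (by simp)]
  rw [hA.diag, hA.diag]
  ring

/-- A complex-orthogonal unitriangular matrix is determined by its entries above both
diagonals. -/
lemma IsUnitriangular.eq_of_orthogonal {c : R} (hc : c * 2 = 1) {A B : Matrix (Fin n) (Fin n) R}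
    (hA : IsUnitriangular A) (hB : IsUnitriangular B)
    (hAo : HarmonicOn.secondTranspose A * A = 1) (hBo : HarmonicOn.secondTranspose B * B = 1)
    (h : ∀ i j : Fin n, i < j → (i : ℕ) + j + 1 < n → A i j = B i j) : A = B := by
  have key : ∀ d : ℕ, ∀ i j : Fin n, (j : ℕ) = i + d → A i j = B i j := by
    intro d
    induction d using Nat.strong_induction_on with
    | _ d ih =>
    intro i j hd
    rcases Nat.eq_zero_or_pos d with rfl | hpos
    · have : i = j := Fin.ext (by omega)
      rw [this, hA.diag, hB.diag]
    have hij : i < j := Fin.lt_def.2 (by omega)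
    by_cases hlt : (i : ℕ) + j + 1 < n
    · exact h i j hij hlt
    have e1 := hA.secondTranspose_mul_self hij
    have e2 := hB.secondTranspose_mul_self hij
    rw [hAo] at e1
    rw [hBo, e1] at e2
    have hsum : ∑ l ∈ Finset.Ioo i j, A l.rev i.rev * A l j =
        ∑ l ∈ Finset.Ioo i j, B l.rev i.rev * B l j := by
      refine Finset.sum_congr rfl fun l hl => ?_
      rw [Finset.mem_Ioo, Fin.lt_def, Fin.lt_def] at hl
      rw [ih (l - i) (by omega) l.rev i.rev (by simp only [Fin.val_rev]; omega),
        ih (j - l) (by omega) l j (by omega)]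
    rw [hsum] at e2
    by_cases heq : (i : ℕ) + j + 1 = n
    · have hr : j.rev = i := Fin.ext (by rw [Fin.val_rev]; omega)
      have hr' : i.rev = j := by rw [← hr, Fin.rev_rev]
      rw [hr, hr'] at e2
      linear_combination c * e2 - (A i j - B i j) * hc
    · have hr := h j.rev i.rev (Fin.rev_lt_rev.2 hij) (by simp only [Fin.val_rev]; omega)
      rw [hr] at e2
      linear_combination e2
  ext i j
  rcases le_or_gt i j with hij | hij
  · exact key (j - i) i j (by rw [Fin.le_def] at hij; omega)
  · rw [hA.lower hij, hB.lower hij]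

/-- Entries above both diagonals can be prescribed for a complex-orthogonal unitriangular matrix.
The conditions on the product of the matrix and its second transpose are met on one superdiagonal
after the other. -/
lemma exists_orthogonal_unitriangular (S : Subring R) {c : R} (hcS : c ∈ S) (hc : c * 2 = 1)
    (f : Fin n → Fin n → R)
    (hf : ∀ i j : Fin n, i < j → (i : ℕ) + j + 1 < n → f i j ∈ S) :
    ∃ A : Matrix (Fin n) (Fin n) R, IsUnitriangular A ∧ secondTranspose A * A = 1 ∧
      (∀ i j, A i j ∈ S) ∧ ∀ i j : Fin n, i < j → (i : ℕ) + j + 1 < n → A i j = f i j := by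
  have key : ∀ d : ℕ, ∃ A : Matrix (Fin n) (Fin n) R, IsUnitriangular A ∧
      (∀ i j : Fin n, i < j → (j : ℕ) < i + d → (secondTranspose A * A) i j = 0) ∧
      (∀ i j, A i j ∈ S) ∧ ∀ i j : Fin n, i < j → (i : ℕ) + j + 1 < n → A i j = f i j := by
    intro d
    induction d with
    | zero =>
      refine ⟨Matrix.of fun i j => if i < j then (if (i : ℕ) + j + 1 < n then f i j else 0)
        else if i = j then 1 else 0, ?_, ?_, ?_, ?_⟩
      · intro i j hij
        simp [not_lt.2 hij]
      · intro i j hij h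
        rw [Fin.lt_def] at hij
        omega
      · intro i j
        simp only [Matrix.of_apply]
        split_ifs with h1 h2 h3
        exacts [hf i j h1 h2, S.zero_mem, S.one_mem, S.zero_mem]
      · intro i j hij h
        simp [hij, h]
    | succ d ih =>
      obtain ⟨A, hA, ho, hS, hAf⟩ := ih
      set T := secondTranspose A * A with hT
      have hTsym : ∀ i j : Fin n, T j.rev i.rev = T i j := by
        intro i j
        have : secondTranspose T = T := by
          rw [hT, secondTranspose_mul, secondTranspose_secondTranspose]
        exact congrFun (congrFun this i) j
      have hTS : ∀ i j, T i j ∈ S := fun i j => by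
        rw [hT, secondTranspose_mul_apply]
        exact Subring.sum_mem _ fun l _ => S.mul_mem (hS _ _) (hS _ _)
      -- The correction on the superdiagonal at distance `d`.  It changes the entry `T i j` there by
      -- `E i j + E j.rev i.rev`, so only entries below the antidiagonal are corrected, and entries
      -- on the antidiagonal, where both terms coincide, by half of the error.
      let E : Fin n → Fin n → R := fun i j =>
        if i < j ∧ (j : ℕ) = i + d then
          (if (i : ℕ) + j + 1 < n then 0 else if (i : ℕ) + j + 1 = n then -(c * T i j)
            else -T i j)
        else 0
      have hE0 : ∀ i j : Fin n, (j : ℕ) ≠ i + d → E i j = 0 := fun i j h => by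
        simp only [E]
        rw [if_neg (fun h' => h h'.2)]
      have hEle : ∀ i j : Fin n, j ≤ i → E i j = 0 := fun i j h => by
        simp only [E]
        rw [if_neg (fun h' => not_lt.2 h h'.1)]
      have hA' : IsUnitriangular (A + Matrix.of E) := fun i j hij => by
        rw [Matrix.add_apply, Matrix.of_apply, hEle i j hij, add_zero, hA i j hij]
      refine ⟨A + Matrix.of E, hA', ?_, ?_, ?_⟩
      · intro i j hij hd
        have hij' := Fin.lt_def.1 hij
        rw [hA'.secondTranspose_mul_self hij]
        have hsum : ∑ l ∈ Finset.Ioo i j, (A + Matrix.of E) l.rev i.rev * (A + Matrix.of E) l j =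
            ∑ l ∈ Finset.Ioo i j, A l.rev i.rev * A l j := by
          refine Finset.sum_congr rfl fun l hl => ?_
          rw [Finset.mem_Ioo, Fin.lt_def, Fin.lt_def] at hl
          simp only [Matrix.add_apply, Matrix.of_apply]
          rw [hE0 l.rev i.rev (by simp only [Fin.val_rev]; omega), hE0 l j (by omega), add_zero,
            add_zero]
        have hTij := hA.secondTranspose_mul_self hij
        rw [← hT] at hTij
        rw [hsum]
        simp only [Matrix.add_apply, Matrix.of_apply]
        suffices T i j + E i j + E j.rev i.rev = 0 by
          rw [← this, hTij]
          ring
        by_cases hd' : (j : ℕ) = i + d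
        · have hr : j.rev < i.rev ∧ ((i.rev : Fin n) : ℕ) = j.rev + d :=
            ⟨Fin.rev_lt_rev.2 hij, by simp only [Fin.val_rev]; omega⟩
          have hsm : ((j.rev : Fin n) : ℕ) + i.rev + 1 + (i + j + 1) = 2 * n := by
            simp only [Fin.val_rev]; omega
          simp only [E]
          rw [if_pos ⟨hij, hd'⟩, if_pos hr, hTsym]
          rcases lt_trichotomy ((i : ℕ) + j + 1) n with h | h | h
          · rw [if_pos h, if_neg (by omega), if_neg (by omega)]
            ring
          · rw [if_neg (by omega), if_pos h, if_neg (by omega), if_pos (by omega)]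
            linear_combination -(T i j) * hc
          · rw [if_neg (by omega), if_neg (by omega), if_pos (by omega)]
            ring
        · rw [hE0 i j hd', hE0 j.rev i.rev (by simp only [Fin.val_rev]; omega),
            ho i j hij (by omega)]
          ring
      · intro i j
        refine S.add_mem (hS i j) ?_
        simp only [Matrix.of_apply, E]
        split_ifs
        exacts [S.zero_mem, S.neg_mem (S.mul_mem hcS (hTS _ _)), S.neg_mem (hTS _ _), S.zero_mem]
      · intro i j hij h
        rw [Matrix.add_apply, hAf i j hij h]
        simp [E, h]
  obtain ⟨A, hA, ho, hS, hAf⟩ := key n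
  refine ⟨A, hA, ?_, hS, hAf⟩
  ext i j
  rcases le_or_gt j i with hij | hij
  · rw [(hA.secondTranspose.mul hA) i j hij, Matrix.one_apply]
  · rw [ho i j hij (by omega), Matrix.one_apply_ne hij.ne]

/-- Opposite superdiagonal entries of a complex-orthogonal unitriangular matrix. -/
lemma IsUnitriangular.superdiagonal_neg {A : Matrix (Fin n) (Fin n) R} (hA : IsUnitriangular A)
    (ho : HarmonicOn.secondTranspose A * A = 1) {i j : Fin n} (hij : (j : ℕ) = i + 1) :
    A j.rev i.rev = -A i j := by
  have hlt : i < j := Fin.lt_def.2 (by omega)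
  have h := hA.secondTranspose_mul_self hlt
  have hemp : Finset.Ioo i j = ∅ := by
    ext l
    simp only [Finset.mem_Ioo, Fin.lt_def, Finset.notMem_empty, iff_false]
    omega
  rw [ho, hemp, Finset.sum_empty, Matrix.one_apply_ne hlt.ne] at h
  linear_combination -h

end Unitriangular

/-! ### Derivations and the extended solution equation -/

section Derivation

variable {R : Type*} [CommRing R] {n : ℕ}

/-- `δ` is additive and satisfies the Leibniz rule on the subring `S`. -/
structure IsDerivationOn (S : Subring R) (δ : R → R) : Prop where
  add : ∀ a ∈ S, ∀ b ∈ S, δ (a + b) = δ a + δ b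
  mul : ∀ a ∈ S, ∀ b ∈ S, δ (a * b) = δ a * b + a * δ b

variable {S : Subring R} {δ : R → R}

lemma IsDerivationOn.zero (h : IsDerivationOn S δ) : δ 0 = 0 := by
  have := h.add 0 S.zero_mem 0 S.zero_mem
  simpa using this

lemma IsDerivationOn.one (h : IsDerivationOn S δ) : δ 1 = 0 := by
  have := h.mul 1 S.one_mem 1 S.one_mem
  simpa using this

lemma IsDerivationOn.sum (h : IsDerivationOn S δ) {ι : Type*} (s : Finset ι) {f : ι → R}
    (hf : ∀ i, f i ∈ S) : δ (∑ i ∈ s, f i) = ∑ i ∈ s, δ (f i) := by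
  classical
  induction s using Finset.induction_on with
  | empty => simp [h.zero]
  | insert a s ha ih =>
    rw [Finset.sum_insert ha, Finset.sum_insert ha,
      h.add _ (hf a) _ (Subring.sum_mem _ fun i _ => hf i), ih]

/-- If the columns of a complex-orthogonal unitriangular matrix satisfy
`c_k' = a_{k-1,k}' c_{k-1}` in the entries above both diagonals, then in all entries.  For
`X = Aᵀ A'` is skew for the second transpose, and the hypothesis says that the entries of `X` above
both diagonals vanish off the superdiagonal; the entries on the antidiagonal vanish by skewness. -/
lemma IsDerivationOn.solves_of_half (h : IsDerivationOn S δ) {c : R} (hc : c * 2 = 1)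
    {A : Matrix (Fin n) (Fin n) R} (hA : IsUnitriangular A)
    (ho : secondTranspose A * A = 1) (hS : ∀ i j, A i j ∈ S)
    (hyp : ∀ i j k : Fin n, (k : ℕ) = j + 1 → i < j → (i : ℕ) + k + 1 < n →
      δ (A i k) = A i j * δ (A j k)) :
    ∀ i j k : Fin n, (k : ℕ) = j + 1 → δ (A i k) = A i j * δ (A j k) := by
  set X := secondTranspose A * A.map δ with hX
  have hAX : A * X = A.map δ := by
    rw [hX, ← mul_assoc, mul_eq_one_comm.1 ho, one_mul]
  have hδ : ∀ i j : Fin n, j ≤ i → δ (A i j) = 0 := by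
    intro i j hij
    rw [hA i j hij]
    split_ifs
    exacts [h.one, h.zero]
  have hskew : ∀ i j : Fin n, X i j = -X j.rev i.rev := by
    intro i j
    have h1 : δ ((secondTranspose A * A) i j) = 0 := by
      rw [ho, Matrix.one_apply]
      split_ifs
      exacts [h.one, h.zero]
    rw [secondTranspose_mul_apply, h.sum _ (fun l => S.mul_mem (hS _ _) (hS _ _))] at h1
    simp only [h.mul _ (hS _ _) _ (hS _ _), Finset.sum_add_distrib] at h1
    have h2 : X j.rev i.rev = ∑ l : Fin n, δ (A l.rev i.rev) * A l j := by
      rw [hX, secondTranspose_mul_apply, ← Equiv.sum_comp Fin.revPerm]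
      refine Finset.sum_congr rfl fun l _ => ?_
      simp [mul_comm]
    have h3 : X i j = ∑ l : Fin n, A l.rev i.rev * δ (A l j) := rfl
    rw [h2, h3]
    linear_combination h1
  have hXlow : ∀ i j : Fin n, j ≤ i → X i j = 0 := by
    intro i j hij
    rw [hX, secondTranspose_mul_apply]
    refine Finset.sum_eq_zero fun l _ => ?_
    rcases lt_or_ge l i with hl | hl
    · rw [hA.lower (Fin.rev_lt_rev.2 hl), zero_mul]
    · rw [Matrix.map_apply, hδ l j (hij.trans hl), mul_zero]
  have hXsup : ∀ j k : Fin n, (k : ℕ) = j + 1 → X j k = δ (A j k) := by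
    intro j k hjk
    rw [hX, secondTranspose_mul_apply, Finset.sum_eq_single j]
    · rw [hA.diag, one_mul, Matrix.map_apply]
    · intro l _ hl
      rcases lt_or_gt_of_ne hl with hl | hl
      · rw [hA.lower (Fin.rev_lt_rev.2 hl), zero_mul]
      · rw [Matrix.map_apply, hδ l k (Fin.le_def.2 (by rw [Fin.lt_def] at hl; omega)), mul_zero]
    · simp
  -- induction on the distance `d` to the diagonal: `A' = A X`, and in row `i` and column `k` the
  -- product reduces to `X i k` and the term from the superdiagonal
  have hX0 : ∀ d : ℕ, ∀ i k : Fin n, (k : ℕ) = i + d → 2 ≤ d → X i k = 0 := by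
    intro d
    induction d using Nat.strong_induction_on with
    | _ d ih =>
    have h1 : ∀ i k : Fin n, (k : ℕ) = i + d → 2 ≤ d → (i : ℕ) + k + 1 < n → X i k = 0 := by
      intro i k hd h2 hlt
      let j : Fin n := ⟨k - 1, by omega⟩
      have hjk : (k : ℕ) = j + 1 := by simp only [j]; omega
      have hij : i < j := Fin.lt_def.2 (by omega)
      have e1 := congrFun (congrFun hAX i) k
      rw [Matrix.map_apply, hyp i j k hjk hij hlt, Matrix.mul_apply,
        Finset.sum_eq_add i j hij.ne ?_ (by simp) (by simp), hA.diag, hXsup j k hjk] at e1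
      · linear_combination e1
      · intro l _ hl
        rcases lt_trichotomy l i with h | h | h
        · rw [hA.lower h, zero_mul]
        · exact absurd h hl.1
        · rcases lt_trichotomy l j with h' | h' | h'
          · rw [Fin.lt_def] at h h'
            rw [ih (k - l) (by omega) l k (by omega) (by omega), mul_zero]
          · exact absurd h' hl.2
          · rw [hXlow l k (Fin.le_def.2 (by rw [Fin.lt_def] at h'; omega)), mul_zero]
    intro i k hd h2
    rcases lt_trichotomy ((i : ℕ) + k + 1) n with hlt | heq | hgt
    · exact h1 i k hd h2 hlt
    · have e := hskew i k
      have hr : k.rev = i := Fin.ext (by rw [Fin.val_rev]; omega)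
      have hr' : i.rev = k := by rw [← hr, Fin.rev_rev]
      rw [hr, hr'] at e
      linear_combination c * e - X i k * hc
    · rw [hskew, h1 k.rev i.rev (by simp only [Fin.val_rev]; omega) h2
        (by simp only [Fin.val_rev]; omega), neg_zero]
  intro i j k hjk
  have e1 := congrFun (congrFun hAX i) k
  rw [Matrix.map_apply, Matrix.mul_apply, Finset.sum_eq_single j ?_ (by simp), hXsup j k hjk] at e1
  · exact e1.symm
  · intro l _ hl
    rcases lt_or_gt_of_ne hl with h | h
    · rw [Fin.lt_def] at h
      rw [hX0 (k - l) l k (by omega) (by omega), mul_zero]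
    · rw [hXlow l k (Fin.le_def.2 (by rw [Fin.lt_def] at h; omega)), mul_zero]

end Derivation

/-! ### Solutions of the extended solution equation and their parameters -/

section Parameters

variable {M : Type*} [TopologicalSpace M]

lemma IsNonconst.neg {φ : FunGerm M} (h : IsNonconst φ) : IsNonconst (-φ) := fun c hc =>
  h (-c) (by rw [neg_eq_iff_eq_neg] at hc; exact hc)

lemma isNondegenerate_removeBorder_iff {m : ℕ}
    {A : Matrix (Fin (2 * m + 1)) (Fin (2 * m + 1)) (FunGerm M)} :
    IsNondegenerate (removeBorder A) ↔ ∀ i j : Fin (2 * m + 1), (j : ℕ) = i + 1 → 1 ≤ (i : ℕ) →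
      (i : ℕ) + 1 < 2 * m → IsNonconst (A i j) := by
  constructor
  · intro h i j hij h1 h2
    have := h (i - 1) (by omega)
    convert this using 2
    · exact congrArg₂ A (Fin.ext (by simp only; omega)) (Fin.ext (by simp only; omega))
  · intro h k hk
    exact h _ _ rfl (by simp only; omega) (by simp only; omega)

variable [ChartedSpace ℂ M]

lemma xiOne_le_iff {n : ℕ} (i j : Fin n) : xiOne n i ≤ xiOne n j ↔ j ≤ i := by
  rw [Fin.le_def]
  unfold xiOne
  omega

lemma mem_meroGroupR_iff {n : ℕ} {A : Matrix (Fin n) (Fin n) (FunGerm M)} :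
    A ∈ meroGroupR M (xiOne n) ↔
      (∀ i j, A i j ∈ meroSubring M) ∧ IsUnitriangular A ∧ secondTranspose A * A = 1 := by
  refine and_congr Iff.rfl (and_congr ?_ Iff.rfl)
  simp only [xiOne_le_iff]
  rfl

/-- A matrix with the prescribed entries in terms of the generalized derivatives of `μ`, the
complex-orthogonal one if there is one. -/
noncomputable def solutionMatrix [T1Space M] (m : ℕ) (μ : Fin m → FunGerm M) :
    Matrix (Fin (2 * m + 1)) (Fin (2 * m + 1)) (FunGerm M) :=
  Classical.epsilon fun A => A ∈ meroGroupR M (xiOne (2 * m + 1)) ∧ HasEntries m μ A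

section Entries

variable [T1Space M] {m : ℕ} {μ : Fin m → FunGerm M}
  {A : Matrix (Fin (2 * m + 1)) (Fin (2 * m + 1)) (FunGerm M)}

lemma HasEntries.apply (h : HasEntries m μ A) (t : Fin m) {q : ℕ} (hq : q ≤ 2 * t)
    {i j : Fin (2 * m + 1)} (hi : (i : ℕ) = m - 1 - t) (hj : (j : ℕ) = m + t - q) :
    A i j = muDer m μ t q := by
  have ht := t.2
  rw [h i j (Fin.lt_def.2 (by omega)) (by omega)]
  congr 1
  · exact Fin.ext (by simp only; omega)
  · omega

lemma hasEntries_of (h : ∀ (t : Fin m) (q : ℕ), q ≤ 2 * t → ∀ i j : Fin (2 * m + 1),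
    (i : ℕ) = m - 1 - t → (j : ℕ) = m + t - q → A i j = muDer m μ t q) : HasEntries m μ A := by
  intro i j hij hlt
  rw [Fin.lt_def] at hij
  exact h _ _ (by simp only; omega) i j (by simp only; omega) (by simp only; omega)

/-- Orthogonality makes the superdiagonal entries of `A` in rows `m - 1 - t` and `m + t` opposite,
as are the functions `ρ` with these indices; so only the first of them has to be known. -/
lemma superdiagonal_eq_rho_of (hA : IsUnitriangular A) (ho : secondTranspose A * A = 1) (t : Fin m)
    (h : ∀ i j : Fin (2 * m + 1), (i : ℕ) = m - 1 - t → (j : ℕ) = m - t →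
      A i j = muDer m μ t (2 * t)) {i j : Fin (2 * m + 1)} (hij : (j : ℕ) = i + 1)
    (hi : (i : ℕ) = m - 1 - t ∨ (i : ℕ) = m + t) : A i j = rho m μ i := by
  have ht := t.2
  obtain ⟨-, -, h1, h2⟩ := muDer_spec m μ t
  rcases hi with hi | hi
  · rw [hi, h1, h i j hi (by omega)]
  · rw [hi, h2, ← h j.rev i.rev (by rw [Fin.val_rev]; omega) (by rw [Fin.val_rev]; omega),
      hA.superdiagonal_neg ho hij, neg_neg]

lemma HasEntries.superdiagonal_eq_rho (h : HasEntries m μ A) (hA : IsUnitriangular A)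
    (ho : secondTranspose A * A = 1) {i j : Fin (2 * m + 1)} (hij : (j : ℕ) = i + 1) :
    A i j = rho m μ i := by
  have hj := j.2
  rcases lt_or_ge (i : ℕ) m with hi | hi
  · exact superdiagonal_eq_rho_of hA ho ⟨m - 1 - i, by omega⟩
      (fun a b ha hb => h.apply _ le_rfl ha (by simp only at hb ⊢; omega)) hij
      (Or.inl (by simp only; omega))
  · exact superdiagonal_eq_rho_of hA ho ⟨i - m, by omega⟩
      (fun a b ha hb => h.apply _ le_rfl ha (by simp only at hb ⊢; omega)) hij
      (Or.inr (by simp only; omega))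

lemma HasEntries.parameters_eq (h : HasEntries m μ A) : parameters m A = μ := by
  funext t
  exact h.apply t (Nat.zero_le _) rfl rfl

lemma isNonconst_rho (hμ : μ ∈ paramWeakND M m) {k : ℕ} (h1 : 1 ≤ k) (h2 : k + 1 < 2 * m) :
    IsNonconst (rho m μ k) := by
  rcases lt_or_ge k m with hk | hk
  · have h := hμ.2 ⟨m - 1 - k, by omega⟩ (by simp only; omega)
    rw [← (muDer_spec m μ _).2.2.1] at h
    convert h using 2
    simp only
    omega
  · have h := (hμ.2 ⟨k - m, by omega⟩ (by simp only; omega)).neg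
    rw [← (muDer_spec m μ _).2.2.2] at h
    convert h using 2
    simp only
    omega

lemma isNonconst_rho_of_mem_paramND (hμ : μ ∈ paramND M m) {k : ℕ} (h2 : k < 2 * m) :
    IsNonconst (rho m μ k) := by
  rcases lt_or_ge k m with hk | hk
  · have h := hμ.2 ⟨m - 1 - k, by omega⟩
    rw [← (muDer_spec m μ _).2.2.1] at h
    convert h using 2
    simp only
    omega
  · have h := (hμ.2 ⟨k - m, by omega⟩).neg
    rw [← (muDer_spec m μ _).2.2.2] at h
    convert h using 2
    simp only
    omega

lemma paramND_subset : paramND M m ⊆ paramWeakND M m := fun _ h => ⟨h.1, fun t _ => h.2 t⟩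

end Entries

variable [T1Space M]

lemma mem_solR_iff {n : ℕ} {A : Matrix (Fin n) (Fin n) (FunGerm M)} :
    A ∈ solR M (xiOne n) ↔ A ∈ meroGroupR M (xiOne n) ∧
      ∀ i j k : Fin n, (k : ℕ) = j + 1 → D (A i k) = A i j * D (A j k) := by
  refine and_congr_right fun hA => ?_
  have hsum : ∀ i j k : Fin n, (k : ℕ) = j + 1 →
      ∑ l with xiOne n l = xiOne n k + 1, D (A l k) * A i l = A i j * D (A j k) := by
    intro i j k hk
    have hf : (Finset.univ.filter fun l : Fin n => xiOne n l = xiOne n k + 1) = {j} := by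
      ext l
      rw [Finset.mem_filter, Finset.mem_singleton, Fin.ext_iff]
      simp only [Finset.mem_univ, true_and, xiOne]
      omega
    rw [hf, Finset.sum_singleton, mul_comm]
  refine ⟨fun h i j k hk => by rw [h i k, hsum i j k hk], fun h i k => ?_⟩
  rcases Nat.eq_zero_or_pos (k : ℕ) with hk | hk
  · have hf : (Finset.univ.filter fun l : Fin n => xiOne n l = xiOne n k + 1) = ∅ := by
      ext l
      rw [Finset.mem_filter]
      simp only [Finset.mem_univ, true_and, Finset.notMem_empty, iff_false, xiOne]
      omega
    rw [hf, Finset.sum_empty, (mem_meroGroupR_iff.1 hA).2.1 i k (Fin.le_def.2 (by omega))]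
    split_ifs
    exacts [D_one, D_zero]
  · rw [h i ⟨k - 1, by omega⟩ k (by simp only; omega),
      hsum i ⟨k - 1, by omega⟩ k (by simp only; omega)]

variable [IsManifold 𝓘(ℂ, ℂ) ω M]

lemma isDerivationOn_D : IsDerivationOn (meroSubring M) D :=
  ⟨fun _ ha _ hb => D_add ha hb, fun _ ha _ hb => D_mul ha hb⟩

lemma iterGenDeriv_mem {ρ : ℕ → FunGerm M} (hρ : ∀ k, ρ k ∈ meroSubring M) {ν : FunGerm M}
    (hν : ν ∈ meroSubring M) (c j : ℕ) : iterGenDeriv ρ ν c j ∈ meroSubring M := by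
  induction j with
  | zero => exact hν
  | succ j ih => exact D_div_D_mem ih (hρ _)

lemma rhoUpTo_mem {m : ℕ} {μ : Fin m → FunGerm M} (hμ : ∀ t, μ t ∈ meroSubring M) (t k : ℕ) :
    rhoUpTo m μ t k ∈ meroSubring M := by
  induction t generalizing k with
  | zero => exact (meroSubring M).zero_mem
  | succ t ih =>
    simp only [rhoUpTo]
    split_ifs <;> first
      | exact ih k
      | exact iterGenDeriv_mem ih (hμ _) _ _
      | exact neg_mem (iterGenDeriv_mem ih (hμ _) _ _)
      | exact zero_mem _
      | exact neg_mem (zero_mem _)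

lemma muDer_mem {m : ℕ} {μ : Fin m → FunGerm M} (hμ : ∀ t, μ t ∈ meroSubring M) (t : Fin m)
    (j : ℕ) : muDer m μ t j ∈ meroSubring M :=
  iterGenDeriv_mem (rhoUpTo_mem hμ m) (hμ t) _ _

/-- Existence and uniqueness of the complex-orthogonal unitriangular matrix with entries prescribed
by `μ`.  No condition of non-degeneracy is needed, since germs are divided pointwise, with
`0⁻¹ = 0`, and the quotients are still meromorphic. -/
lemma eq_solutionMatrix_iff {m : ℕ} {μ : Fin m → FunGerm M} (hμ : ∀ t, μ t ∈ meroSubring M)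
    (B : Matrix (Fin (2 * m + 1)) (Fin (2 * m + 1)) (FunGerm M)) :
    (B ∈ meroGroupR M (xiOne (2 * m + 1)) ∧ HasEntries m μ B) ↔ B = solutionMatrix m μ := by
  have hex : ∃ A, A ∈ meroGroupR M (xiOne (2 * m + 1)) ∧ HasEntries m μ A := by
    obtain ⟨A, hA, ho, hS, hf⟩ := exists_orthogonal_unitriangular (n := 2 * m + 1) (meroSubring M)
      (const_mem_meroSubring (1 / 2)) const_half_mul_two
      (fun i j => if h : i < j ∧ (i : ℕ) + j < 2 * m then
        muDer m μ ⟨m - 1 - i, by have := Fin.lt_def.1 h.1; omega⟩ (2 * m - 1 - i - j) else 0)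
      (fun i j hij h => by
        rw [dif_pos ⟨hij, by omega⟩]
        exact muDer_mem hμ _ _)
    refine ⟨A, mem_meroGroupR_iff.2 ⟨hS, hA, ho⟩, fun i j hij h => ?_⟩
    rw [hf i j hij (by omega), dif_pos ⟨hij, h⟩]
  have hspec : solutionMatrix m μ ∈ meroGroupR M (xiOne (2 * m + 1)) ∧
      HasEntries m μ (solutionMatrix m μ) := Classical.epsilon_spec hex
  refine ⟨fun hB => ?_, fun h => h ▸ hspec⟩
  obtain ⟨-, h1, h2⟩ := mem_meroGroupR_iff.1 hB.1
  obtain ⟨-, h3, h4⟩ := mem_meroGroupR_iff.1 hspec.1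
  refine h1.eq_of_orthogonal const_half_mul_two h3 h2 h4 fun i j hij h => ?_
  rw [hB.2 i j hij (by omega), hspec.2 i j hij (by omega)]

variable {m : ℕ} {μ : Fin m → FunGerm M}

lemma solutionMatrix_spec (hμ : μ ∈ paramWeakND M m) :
    solutionMatrix m μ ∈ meroGroupR M (xiOne (2 * m + 1)) ∧ HasEntries m μ (solutionMatrix m μ) :=
  (eq_solutionMatrix_iff hμ.1 _).2 rfl

lemma isNondegenerate_removeBorder_solutionMatrix (hμ : μ ∈ paramWeakND M m) :
    IsNondegenerate (removeBorder (solutionMatrix m μ)) := by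
  obtain ⟨hmem, hent⟩ := solutionMatrix_spec hμ
  obtain ⟨hS, hA, ho⟩ := mem_meroGroupR_iff.1 hmem
  refine isNondegenerate_removeBorder_iff.2 fun i j hij h1 h2 => ?_
  rw [hent.superdiagonal_eq_rho hA ho hij]
  exact isNonconst_rho hμ h1 h2

lemma isNondegenerate_solutionMatrix (hμ : μ ∈ paramND M m) :
    IsNondegenerate (solutionMatrix m μ) := by
  obtain ⟨hmem, hent⟩ := solutionMatrix_spec (paramND_subset hμ)
  obtain ⟨hS, hA, ho⟩ := mem_meroGroupR_iff.1 hmem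
  intro k hk
  rw [hent.superdiagonal_eq_rho hA ho rfl]
  exact isNonconst_rho_of_mem_paramND hμ (by simp only; omega)

variable [ConnectedSpace M]

/-- The recursion for `μ_t^(j)` is the extended solution equation in the entries above both
diagonals (the divisors being invertible), and these equations imply the others. -/
lemma solutionMatrix_mem_solR (hμ : μ ∈ paramWeakND M m) :
    solutionMatrix m μ ∈ solR M (xiOne (2 * m + 1)) := by
  obtain ⟨hmem, hent⟩ := solutionMatrix_spec hμ
  obtain ⟨hS, hA, ho⟩ := mem_meroGroupR_iff.1 hmem
  refine mem_solR_iff.2 ⟨hmem, ?_⟩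
  refine isDerivationOn_D.solves_of_half const_half_mul_two hA ho hS fun i j k hk hij hlt => ?_
  rw [Fin.lt_def] at hij
  have hρ := D_mul_inv_of_isNonconst (rhoUpTo_mem hμ.1 m j)
    (isNonconst_rho hμ (k := j) (by omega) (by omega))
  let t : Fin m := ⟨m - 1 - i, by omega⟩
  have e1 : solutionMatrix m μ i k = muDer m μ t (2 * m - 1 - i - k) :=
    hent.apply t (by simp only [t]; omega) (by simp only [t]; omega) (by simp only [t]; omega)
  have e2 : solutionMatrix m μ i j = muDer m μ t (2 * m - 1 - i - k + 1) :=
    hent.apply t (by simp only [t]; omega) (by simp only [t]; omega) (by simp only [t]; omega)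
  rw [hent.superdiagonal_eq_rho hA ho hk, e1, e2, (muDer_spec m μ t).2.1]
  have e3 : m + (t : ℕ) - (2 * m - 1 - i - k + 1) = j := by simp only [t]; omega
  rw [e3, div_eq_mul_inv, mul_assoc, mul_comm (D (rho m μ j))⁻¹]
  exact (by rw [show D (rho m μ j) * (D (rho m μ j))⁻¹ = 1 from hρ, mul_one])

/-- The parameters of a solution: dividing `a_{ik}' = a_{k-1,k}' a_{i,k-1}` by `a_{k-1,k}'`
computes its entries above both diagonals, row by row from the middle upwards. -/
lemma hasEntries_parameters {B : Matrix (Fin (2 * m + 1)) (Fin (2 * m + 1)) (FunGerm M)}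
    (hB : B ∈ solR M (xiOne (2 * m + 1))) (hnd : IsNondegenerate (removeBorder B)) :
    HasEntries m (parameters m B) B := by
  obtain ⟨hmem, hsol⟩ := mem_solR_iff.1 hB
  obtain ⟨hS, hA, ho⟩ := mem_meroGroupR_iff.1 hmem
  rw [isNondegenerate_removeBorder_iff] at hnd
  have key : ∀ T : ℕ, ∀ t : Fin m, (t : ℕ) = T → ∀ q : ℕ, q ≤ 2 * t → ∀ i j : Fin (2 * m + 1),
      (i : ℕ) = m - 1 - t → (j : ℕ) = m + t - q → B i j = muDer m (parameters m B) t q := by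
    intro T
    induction T using Nat.strong_induction_on with
    | _ T ih =>
    rintro t rfl q
    have ht := t.2
    have hrho : ∀ i j : Fin (2 * m + 1), (j : ℕ) = i + 1 → m - t ≤ (i : ℕ) → (i : ℕ) < m + t →
        B i j = rho m (parameters m B) i := by
      intro i j hij h1 h2
      rcases lt_or_ge (i : ℕ) m with hi | hi
      · refine superdiagonal_eq_rho_of hA ho ⟨m - 1 - i, by omega⟩
          (fun a b ha hb => ih _ ?_ _ rfl _ le_rfl a b ha ?_) hij (Or.inl ?_)
        · simp only; omega
        · simp only at hb ⊢; omega
        · simp only; omega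
      · refine superdiagonal_eq_rho_of hA ho ⟨i - m, by omega⟩
          (fun a b ha hb => ih _ ?_ _ rfl _ le_rfl a b ha ?_) hij (Or.inr ?_)
        · simp only; omega
        · simp only at hb ⊢; omega
        · simp only; omega
    induction q with
    | zero =>
      intro _ i j hi hj
      exact congrArg₂ B (Fin.ext hi) (Fin.ext hj)
    | succ q ihq =>
      intro hq i j hi hj
      let k : Fin (2 * m + 1) := ⟨m + t - q, by omega⟩
      have hk : (k : ℕ) = j + 1 := by simp only [k]; omega
      have hρ := D_mul_inv_of_isNonconst (hS j k) (hnd j k hk (by omega) (by omega))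
      have hs := hsol i j k hk
      rw [(muDer_spec m _ t).2.1, ← ihq (by omega) i k hi rfl, ← hj,
        ← hrho j k hk (by omega) (by omega), hs, div_eq_mul_inv, mul_assoc, hρ, mul_one]
  exact hasEntries_of fun t q hq i j hi hj => key t t rfl q hq i j hi hj

lemma parameters_mem_paramWeakND {B : Matrix (Fin (2 * m + 1)) (Fin (2 * m + 1)) (FunGerm M)}
    (hB : B ∈ solR M (xiOne (2 * m + 1))) (hnd : IsNondegenerate (removeBorder B)) :
    parameters m B ∈ paramWeakND M m := by
  obtain ⟨hS, hA, ho⟩ := mem_meroGroupR_iff.1 hB.1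
  refine ⟨fun t => hS _ _, fun t ht => ?_⟩
  have h := (hasEntries_parameters hB hnd).apply t (q := 2 * t) le_rfl
    (i := ⟨m - 1 - t, by omega⟩) (j := ⟨m - t, by omega⟩) rfl (by simp only; omega)
  rw [← h]
  exact isNondegenerate_removeBorder_iff.1 hnd _ _ (by simp only; omega) (by simp only; omega)
    (by simp only; omega)

lemma parameters_mem_paramND {B : Matrix (Fin (2 * m + 1)) (Fin (2 * m + 1)) (FunGerm M)}
    (hB : B ∈ solR M (xiOne (2 * m + 1))) (hnd : IsNondegenerate B) :
    parameters m B ∈ paramND M m := by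
  obtain ⟨hS, hA, ho⟩ := mem_meroGroupR_iff.1 hB.1
  have hnd' : IsNondegenerate (removeBorder B) := fun k hk => hnd (k + 1) (by omega)
  refine ⟨fun t => hS _ _, fun t => ?_⟩
  have h := (hasEntries_parameters hB hnd').apply t (q := 2 * t) le_rfl
    (i := ⟨m - 1 - t, by omega⟩) (j := ⟨m - 1 - t + 1, by omega⟩) rfl (by simp only; omega)
  rw [← h]
  exact hnd _ _

lemma solutionMatrix_parameters {B : Matrix (Fin (2 * m + 1)) (Fin (2 * m + 1)) (FunGerm M)}
    (hB : B ∈ solR M (xiOne (2 * m + 1))) (hnd : IsNondegenerate (removeBorder B)) :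
    solutionMatrix m (parameters m B) = B :=
  ((eq_solutionMatrix_iff (parameters_mem_paramWeakND hB hnd).1 B).1
    ⟨hB.1, hasEntries_parameters hB hnd⟩).symm

variable (M m) in
lemma invOn_parameters_solutionMatrix :
    Set.InvOn (parameters m) (solutionMatrix m) (paramWeakND M m)
      {B | B ∈ solR M (xiOne (2 * m + 1)) ∧ IsNondegenerate (removeBorder B)} :=
  ⟨fun _ hμ => (solutionMatrix_spec hμ).2.parameters_eq,
    fun _ hB => solutionMatrix_parameters hB.1 hB.2⟩

variable (M m) in
lemma bijOn_solutionMatrix_weak :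
    Set.BijOn (solutionMatrix m) (paramWeakND M m)
      {B | B ∈ solR M (xiOne (2 * m + 1)) ∧ IsNondegenerate (removeBorder B)} :=
  (invOn_parameters_solutionMatrix M m).bijOn
    (fun _ hμ => ⟨solutionMatrix_mem_solR hμ, isNondegenerate_removeBorder_solutionMatrix hμ⟩)
    (fun _ hB => parameters_mem_paramWeakND hB.1 hB.2)

variable (M m) in
lemma bijOn_solutionMatrix :
    Set.BijOn (solutionMatrix m) (paramND M m)
      {B | B ∈ solR M (xiOne (2 * m + 1)) ∧ IsNondegenerate B} :=
  Set.InvOn.bijOn (f' := parameters m)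
    ⟨fun _ hμ => (solutionMatrix_spec (paramND_subset hμ)).2.parameters_eq,
      fun _ hB => solutionMatrix_parameters hB.1 fun k hk => hB.2 (k + 1) (by omega)⟩
    (fun _ hμ => ⟨solutionMatrix_mem_solR (paramND_subset hμ), isNondegenerate_solutionMatrix hμ⟩)
    (fun _ hB => parameters_mem_paramND hB.1 hB.2)

end Parameters

/-! ### Loops extending holomorphically to the disc -/

section Disc

variable {n : ℕ}

lemma diffContOnCl_mul {s : Set ℂ} {f g : ℂ → ℂ} (hf : DiffContOnCl ℂ f s)
    (hg : DiffContOnCl ℂ g s) : DiffContOnCl ℂ (fun w => f w * g w) s :=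
  ⟨hf.1.mul hg.1, hf.2.mul hg.2⟩

lemma diffContOnCl_sum {s : Set ℂ} {ι : Type*} (t : Finset ι) {f : ι → ℂ → ℂ}
    (hf : ∀ i, DiffContOnCl ℂ (f i) s) : DiffContOnCl ℂ (fun w => ∑ i ∈ t, f i w) s :=
  ⟨DifferentiableOn.fun_sum fun i _ => (hf i).1, continuousOn_finsetSum _ fun i _ => (hf i).2⟩

lemma diffContOnCl_prod {s : Set ℂ} {ι : Type*} (t : Finset ι) {f : ι → ℂ → ℂ}
    (hf : ∀ i, DiffContOnCl ℂ (f i) s) : DiffContOnCl ℂ (fun w => ∏ i ∈ t, f i w) s :=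
  ⟨DifferentiableOn.fun_finsetProd fun i _ => (hf i).1,
    continuousOn_finsetProd _ fun i _ => (hf i).2⟩

/-- The entries of `g` are continuous on the closed unit disc and holomorphic inside. -/
def IsDiscMatrix (g : ℂ → Matrix (Fin n) (Fin n) ℂ) : Prop :=
  ∀ i j, DiffContOnCl ℂ (fun w => g w i j) (Metric.ball 0 1)

lemma IsDiscMatrix.const (A : Matrix (Fin n) (Fin n) ℂ) : IsDiscMatrix fun _ => A :=
  fun _ _ => diffContOnCl_const

lemma IsDiscMatrix.mul {g h : ℂ → Matrix (Fin n) (Fin n) ℂ} (hg : IsDiscMatrix g)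
    (hh : IsDiscMatrix h) : IsDiscMatrix fun w => g w * h w := fun i j => by
  simp only [Matrix.mul_apply]
  exact diffContOnCl_sum _ fun l => diffContOnCl_mul (hg i l) (hh l j)

lemma IsDiscMatrix.secondTranspose {g : ℂ → Matrix (Fin n) (Fin n) ℂ} (hg : IsDiscMatrix g) :
    IsDiscMatrix fun w => secondTranspose (g w) := fun i j => hg j.rev i.rev

lemma IsDiscMatrix.det {g : ℂ → Matrix (Fin n) (Fin n) ℂ} (hg : IsDiscMatrix g) :
    DiffContOnCl ℂ (fun w => (g w).det) (Metric.ball 0 1) := by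
  simp only [Matrix.det_apply']
  exact diffContOnCl_sum _ fun σ =>
    diffContOnCl_mul diffContOnCl_const (diffContOnCl_prod _ fun i => hg _ _)

lemma IsDiscMatrix.inv {g : ℂ → Matrix (Fin n) (Fin n) ℂ} (hg : IsDiscMatrix g)
    (hu : ∀ w ∈ Metric.closedBall (0 : ℂ) 1, IsUnit (g w)) : IsDiscMatrix fun w => (g w)⁻¹ := by
  intro i j
  have hdet : ∀ w ∈ closure (Metric.ball (0 : ℂ) 1), (g w).det ≠ 0 := fun w hw => by
    rw [closure_ball (0 : ℂ) one_ne_zero] at hw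
    exact ((Matrix.isUnit_iff_isUnit_det _).1 (hu w hw)).ne_zero
  have hadj : DiffContOnCl ℂ (fun w => (g w).adjugate i j) (Metric.ball 0 1) := by
    simp only [Matrix.adjugate_apply]
    refine IsDiscMatrix.det (g := fun w => (g w).updateRow j (Pi.single i 1)) fun k l => ?_
    by_cases hk : k = j
    · subst hk
      simpa using diffContOnCl_const
    · simpa [Matrix.updateRow_ne hk] using hg k l
  simp only [Matrix.inv_def, Matrix.smul_apply, smul_eq_mul, Ring.inverse_eq_inv']
  exact diffContOnCl_mul (hg.det.inv hdet) hadj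

lemma IsDiscMatrix.comp_mul {g : ℂ → Matrix (Fin n) (Fin n) ℂ} (hg : IsDiscMatrix g)
    (k : Circle) : IsDiscMatrix fun w => g (k * w) := fun i j => by
  have hmaps : Set.MapsTo (fun w : ℂ => (k : ℂ) * w) (Metric.ball 0 1) (Metric.ball 0 1) := by
    intro w hw
    simpa [Circle.norm_coe] using hw
  have h := (hg i j).comp (g := fun w : ℂ => (k : ℂ) * w)
    ((differentiable_id.const_mul (k : ℂ)).diffContOnCl) hmaps
  exact h

lemma infinite_unitCircle : (Metric.sphere (0 : ℂ) 1).Infinite :=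
  (isPreconnected_sphere (by rw [Complex.rank_real_complex]; exact Cardinal.one_lt_two)
    (0 : ℂ) 1).infinite_of_nontrivial ⟨1, by simp, -1, by simp, by norm_num⟩

lemma circle_mem_closedBall (l : Circle) : (l : ℂ) ∈ Metric.closedBall (0 : ℂ) 1 := by
  simp [Circle.norm_coe]

lemma norm_toLp_mulVec_of_unitary {U : Matrix (Fin n) (Fin n) ℂ}
    (hU : U ∈ Matrix.unitaryGroup (Fin n) ℂ) (v : Fin n → ℂ) :
    ‖(WithLp.toLp 2 (U *ᵥ v) : EuclideanSpace ℂ (Fin n))‖ =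
      ‖(WithLp.toLp 2 v : EuclideanSpace ℂ (Fin n))‖ := by
  have h : ∀ x : Fin n → ℂ, ((‖(WithLp.toLp 2 x : EuclideanSpace ℂ (Fin n))‖ ^ 2 : ℝ) : ℂ) =
      star x ⬝ᵥ x := by
    intro x
    have := inner_self_eq_norm_sq_to_K (𝕜 := ℂ) (WithLp.toLp 2 x : EuclideanSpace ℂ (Fin n))
    rw [EuclideanSpace.inner_eq_star_dotProduct] at this
    simp only at this
    rw [dotProduct_comm] at this
    rw [this]
    push_cast
    rfl
  have h2 : star (U *ᵥ v) ⬝ᵥ (U *ᵥ v) = star v ⬝ᵥ v := by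
    rw [Matrix.star_mulVec, ← Matrix.dotProduct_mulVec, Matrix.mulVec_mulVec,
      ← Matrix.star_eq_conjTranspose, (Matrix.mem_unitaryGroup_iff').1 hU, Matrix.one_mulVec]
  have h3 := h (U *ᵥ v)
  rw [h2, ← h v] at h3
  have h4 := Complex.ofReal_injective h3
  exact (pow_left_inj₀ (norm_nonneg _) (norm_nonneg _) two_ne_zero).1 h4

/-- A holomorphic map from the disc to the invertible matrices with unitary boundary values is
constant, by the maximum principle. -/
lemma IsDiscMatrix.eq_one_of_unitary {g : ℂ → Matrix (Fin n) (Fin n) ℂ} (hg : IsDiscMatrix g)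
    (hu : ∀ w ∈ Metric.closedBall (0 : ℂ) 1, IsUnit (g w))
    (hU : ∀ l : Circle, g l ∈ Matrix.unitaryGroup (Fin n) ℂ) (h1 : g 1 = 1) (l : Circle) :
    g l = 1 := by
  have hvec : ∀ h : ℂ → Matrix (Fin n) (Fin n) ℂ, IsDiscMatrix h → ∀ v : Fin n → ℂ,
      DiffContOnCl ℂ (fun w => (WithLp.toLp 2 (h w *ᵥ v) : EuclideanSpace ℂ (Fin n)))
        (Metric.ball 0 1) := by
    intro h hh v
    have key : ∀ i, DiffContOnCl ℂ (fun w => (h w *ᵥ v) i) (Metric.ball 0 1) := fun i => by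
      simp only [Matrix.mulVec, dotProduct]
      exact diffContOnCl_sum _ fun j => diffContOnCl_mul (hh i j) diffContOnCl_const
    exact ⟨differentiableOn_euclidean.2 fun i => (key i).1,
      (PiLp.continuous_toLp 2 _).comp_continuousOn (continuousOn_pi.2 fun i => (key i).2)⟩
  have hbound : ∀ h : ℂ → Matrix (Fin n) (Fin n) ℂ, IsDiscMatrix h →
      (∀ l : Circle, h l ∈ Matrix.unitaryGroup (Fin n) ℂ) → ∀ v : Fin n → ℂ,
      ∀ w ∈ Metric.closedBall (0 : ℂ) 1,
      ‖(WithLp.toLp 2 (h w *ᵥ v) : EuclideanSpace ℂ (Fin n))‖ ≤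
        ‖(WithLp.toLp 2 v : EuclideanSpace ℂ (Fin n))‖ := by
    intro h hh hhU v w hw
    refine Complex.norm_le_of_forall_mem_frontier_norm_le Metric.isBounded_ball (hvec h hh v)
      (fun z hz => ?_) (by rwa [closure_ball (0 : ℂ) one_ne_zero])
    rw [frontier_ball (0 : ℂ) one_ne_zero, mem_sphere_zero_iff_norm] at hz
    exact (norm_toLp_mulVec_of_unitary (hhU ⟨z, mem_sphere_zero_iff_norm.2 hz⟩) v).le
  have h0 : (0 : ℂ) ∈ Metric.closedBall (0 : ℂ) 1 := by simp
  have hmax : ∀ v : Fin n → ℂ, g l *ᵥ v = v := by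
    intro v
    have hle : ‖(WithLp.toLp 2 v : EuclideanSpace ℂ (Fin n))‖ ≤
        ‖(WithLp.toLp 2 (g 0 *ᵥ v) : EuclideanSpace ℂ (Fin n))‖ := by
      have := hbound _ (hg.inv hu) (fun l => by
        have hl := hU l
        have : (g l)⁻¹ = star (g l) :=
          Matrix.inv_eq_right_inv (Matrix.mem_unitaryGroup_iff.1 hl)
        rw [this]
        exact Unitary.star_mem hl) (g 0 *ᵥ v) 0 h0
      rwa [Matrix.mulVec_mulVec, Matrix.nonsing_inv_mul _
        ((Matrix.isUnit_iff_isUnit_det _).1 (hu 0 h0)), Matrix.one_mulVec] at this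
    have hM : IsMaxOn (norm ∘ fun w => (WithLp.toLp 2 (g w *ᵥ v) : EuclideanSpace ℂ (Fin n)))
        (Metric.ball 0 1) 0 := fun w hw =>
      (hbound g hg hU v w (Metric.ball_subset_closedBall hw)).trans hle
    have heq := Complex.eqOn_closedBall_of_isMaxOn_norm (hvec g hg v) hM
    have e1 := heq (circle_mem_closedBall l)
    have e2 := heq (circle_mem_closedBall 1)
    have e3 := e1.trans e2.symm
    simp only [Circle.coe_one, h1, Matrix.one_mulVec] at e3
    exact congrArg WithLp.ofLp e3
  exact Matrix.ext_of_mulVec_single fun i => by rw [hmax, Matrix.one_mulVec]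

/-- A polynomial of degree less than `d` that equals `λ^d g(λ)` on the circle, with `g` holomorphic
in the disc, vanishes. -/
lemma eq_zero_of_eval_eq_pow_mul {d : ℕ} {p : ℂ[X]} (hd : p.degree < d) {g : ℂ → ℂ}
    (hg : DiffContOnCl ℂ g (Metric.ball 0 1))
    (h : ∀ l : Circle, p.eval (l : ℂ) = (l : ℂ) ^ d * g l) : p = 0 := by
  have hball : Set.EqOn (fun w => p.eval w) (fun w => w ^ d * g w) (Metric.ball 0 1) := by
    refine Complex.eqOn_of_eqOn_frontier Metric.isBounded_ball p.differentiable.diffContOnCl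
      (diffContOnCl_mul (differentiable_pow d).diffContOnCl hg) fun z hz => ?_
    rw [frontier_ball (0 : ℂ) one_ne_zero, mem_sphere_zero_iff_norm] at hz
    exact h ⟨z, mem_sphere_zero_iff_norm.2 hz⟩
  have hev : ∀ᶠ w in 𝓝[≠] (0 : ℂ), p.eval w = w ^ d * g w :=
    nhdsWithin_le_nhds (Filter.eventually_of_mem (Metric.ball_mem_nhds 0 one_pos) hball)
  have hcont : Tendsto g (𝓝[≠] 0) (𝓝 (g 0)) :=
    ((hg.1.differentiableAt (Metric.ball_mem_nhds 0 one_pos)).continuousAt.tendsto).mono_left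
      nhdsWithin_le_nhds
  clear h hball
  induction d generalizing p with
  | zero => simpa [Polynomial.degree_eq_bot] using hd
  | succ d ih =>
    have hid : Tendsto (fun w : ℂ => w) (𝓝[≠] 0) (𝓝 0) := tendsto_id.mono_left nhdsWithin_le_nhds
    have h0 : p.eval 0 = 0 := by
      have h1 : Tendsto (fun w => p.eval w) (𝓝[≠] 0) (𝓝 (p.eval 0)) :=
        p.continuous.continuousAt.tendsto.mono_left nhdsWithin_le_nhds
      have h2 : Tendsto (fun w : ℂ => w ^ (d + 1) * g w) (𝓝[≠] 0) (𝓝 (0 ^ (d + 1) * g 0)) :=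
        (hid.pow _).mul hcont
      have := tendsto_nhds_unique_of_eventuallyEq h1 h2 hev
      simpa using this
    have hX : (X : ℂ[X]) ∣ p := Polynomial.X_dvd_iff.2 (by rwa [Polynomial.coeff_zero_eq_eval_zero])
    obtain ⟨q, rfl⟩ := hX
    by_cases hq : q = 0
    · simp [hq]
    refine absurd (ih (p := q) ?_ ?_) hq
    · rw [Polynomial.degree_eq_natDegree hq]
      rw [Polynomial.degree_mul, Polynomial.degree_X, Polynomial.degree_eq_natDegree hq] at hd
      have : 1 + q.natDegree < d + 1 := by exact_mod_cast hd
      exact_mod_cast (by omega : q.natDegree < d)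
    · filter_upwards [hev, self_mem_nhdsWithin] with w hw hw0
      rw [Polynomial.eval_mul, Polynomial.eval_X, pow_succ'] at hw
      rw [mul_assoc] at hw
      exact mul_left_cancel₀ hw0 hw

end Disc

/-! ### The Iwasawa factor of `a γ` for a polynomial unitriangular loop `a` -/

section Iwasawa

variable {n : ℕ}

lemma geodesic_mul (ξ : Fin n → ℕ) (l k : Circle) :
    geodesic ξ (l * k) = geodesic ξ l * geodesic ξ k := by
  simp [geodesic, Matrix.diagonal_mul_diagonal, mul_pow]

lemma geodesic_one (ξ : Fin n → ℕ) : geodesic ξ 1 = 1 := by simp [geodesic]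

lemma mul_geodesic_apply (ξ : Fin n → ℕ) (A : Matrix (Fin n) (Fin n) ℂ) (l : Circle)
    (i j : Fin n) : (A * geodesic ξ l) i j = A i j * (l : ℂ) ^ ξ j := by
  rw [geodesic, Matrix.mul_diagonal]

lemma geodesic_mul_secondTranspose (l : Circle) :
    geodesic (xiOne n) l * secondTranspose (geodesic (xiOne n) l) = (l : ℂ) ^ (n - 1) • 1 := by
  ext i j
  have hi := i.2
  rw [geodesic, Matrix.diagonal_mul, secondTranspose, Matrix.of_apply]
  by_cases h : i = j
  · subst h
    have : xiOne n i + xiOne n i.rev = n - 1 := by simp only [xiOne, Fin.val_rev]; omega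
    simp [← pow_add, this]
  · have : j.rev ≠ i.rev := fun h' => h (Fin.rev_injective h').symm
    simp [h, this]

/-- An element of the group of `ξ_0` is determined by the class of `a γ` modulo loops extending
holomorphically to the disc: in `C = γ⁻¹ a⁻¹ a' γ` all powers of `λ` above the diagonal are
negative. -/
lemma groupC_eq_of_mul_geodesic {a a' : Matrix (Fin n) (Fin n) ℂ[X]} (ha : a ∈ groupC (xiOne n))
    (ha' : a' ∈ groupC (xiOne n)) {g : ℂ → Matrix (Fin n) (Fin n) ℂ} (hg : IsDiscMatrix g)
    (h : ∀ l : Circle, a'.map (eval (l : ℂ)) * geodesic (xiOne n) l =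
      a.map (eval (l : ℂ)) * geodesic (xiOne n) l * g l) : a' = a := by
  have hlow : ∀ b ∈ groupC (xiOne n), ∀ i j : Fin n, j ≤ i → b i j = if i = j then 1 else 0 :=
    fun b hb i j hij => (hb i j).1 ((xiOne_le_iff i j).2 hij)
  -- row by row from the bottom: once `g` is known to be the identity in the rows below, row `i` of
  -- the equation reads `a' i j - a i j = λ^(j-i) g i j`, with a left side of degree less than
  -- `j - i`
  have key : ∀ d : ℕ, ∀ i : Fin n, (i : ℕ) + d + 1 = n → ∀ j,
      a' i j = a i j ∧ ∀ l : Circle, g l i j = if i = j then 1 else 0 := by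
    intro d
    induction d using Nat.strong_induction_on with
    | _ d ih =>
    intro i hi j
    have hrow : ∀ p : Fin n, i < p → ∀ l : Circle, g l p j = if p = j then 1 else 0 := by
      intro p hp l
      rw [Fin.lt_def] at hp
      exact (ih (n - 1 - p) (by omega) p (by omega) j).2 l
    have hentry : ∀ l : Circle, (a' i j).eval (l : ℂ) * (l : ℂ) ^ xiOne n j =
        (l : ℂ) ^ xiOne n i * g l i j +
          if i < j then (a i j).eval (l : ℂ) * (l : ℂ) ^ xiOne n j else 0 := by
      intro l
      have e := congrFun (congrFun (h l) i) j
      rw [mul_geodesic_apply, Matrix.mul_apply] at e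
      simp only [mul_geodesic_apply, Matrix.map_apply] at e
      rw [e]
      by_cases hij : i < j
      · rw [if_pos hij, Finset.sum_eq_add i j hij.ne ?_ (by simp) (by simp)]
        · rw [hlow a ha i i le_rfl, hrow j hij l]
          simp
        · intro p _ hp
          rcases lt_trichotomy p i with hpi | hpi | hpi
          · rw [hlow a ha i p hpi.le, if_neg hpi.ne']
            simp
          · exact absurd hpi hp.1
          · rw [hrow p hpi l, if_neg hp.2, mul_zero]
      · rw [if_neg hij, add_zero, Finset.sum_eq_single i ?_ (by simp)]
        · rw [hlow a ha i i le_rfl]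
          simp
        · intro p _ hp
          rcases lt_or_gt_of_ne hp with hpi | hpi
          · rw [hlow a ha i p hpi.le, if_neg hpi.ne']
            simp
          · rw [hrow p hpi l, if_neg (fun h' : p = j => hij (h' ▸ hpi)), mul_zero]
    have hl0 : ∀ l : Circle, (l : ℂ) ≠ 0 := fun l => l.coe_ne_zero
    rcases lt_or_ge i j with hij | hij
    · have hij' := Fin.lt_def.1 hij
      have hξ : xiOne n i = xiOne n j + (j - i) := by simp only [xiOne]; omega
      have hp : ∀ l : Circle, (a' i j - a i j).eval (l : ℂ) =
          (l : ℂ) ^ ((j : ℕ) - i) * g l i j := by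
        intro l
        have e := hentry l
        rw [if_pos hij, hξ, pow_add] at e
        rw [Polynomial.eval_sub]
        refine mul_left_cancel₀ (pow_ne_zero (xiOne n j) (hl0 l)) ?_
        linear_combination e
      have hξlt : xiOne n j < xiOne n i := by omega
      have hdeg : (a' i j - a i j).degree < ((j : ℕ) - i : ℕ) := by
        refine lt_of_le_of_lt (Polynomial.degree_sub_le _ _) (max_lt ?_ ?_)
        · refine lt_of_le_of_lt Polynomial.degree_le_natDegree ?_
          have := (ha' i j).2 hξlt
          exact_mod_cast (by omega : (a' i j).natDegree < (j : ℕ) - i)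
        · refine lt_of_le_of_lt Polynomial.degree_le_natDegree ?_
          have := (ha i j).2 hξlt
          exact_mod_cast (by omega : (a i j).natDegree < (j : ℕ) - i)
      have hz := eq_zero_of_eval_eq_pow_mul hdeg (hg i j) hp
      refine ⟨sub_eq_zero.1 hz, fun l => ?_⟩
      have e := hp l
      rw [hz, Polynomial.eval_zero] at e
      rw [if_neg hij.ne]
      exact (mul_eq_zero.1 e.symm).resolve_left (pow_ne_zero _ (hl0 l))
    · refine ⟨by rw [hlow a ha i j hij, hlow a' ha' i j hij], fun l => ?_⟩
      have e := hentry l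
      rw [if_neg (not_lt.2 hij), add_zero, hlow a' ha' i j hij] at e
      refine mul_left_cancel₀ (pow_ne_zero (xiOne n i) (hl0 l)) ?_
      rw [← e]
      split_ifs with h'
      · subst h'; simp
      · simp
  ext1 i j
  exact (key (n - 1 - i) i (by omega) j).1

/-- Constant unitriangular matrices belong to the group of `ξ_0`. -/
lemma IsUnitriangular.map_C_mem_groupC {b : Matrix (Fin n) (Fin n) ℂ} (hb : IsUnitriangular b) :
    b.map C ∈ groupC (xiOne n) := by
  intro i j
  refine ⟨fun h => ?_, fun _ => by simp⟩
  rw [Matrix.map_apply, hb i j ((xiOne_le_iff i j).1 h)]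
  split_ifs <;> simp

lemma map_C_map_eval (b : Matrix (Fin n) (Fin n) ℂ) (w : ℂ) : (b.map C).map (eval w) = b := by
  ext i j
  simp

/-- For unitriangular `b`, the equation `b' γ = b γ C` forces `b' = b`. -/
lemma IsUnitriangular.eq_of_mul_geodesic {b b' : Matrix (Fin n) (Fin n) ℂ} (hb : IsUnitriangular b)
    (hb' : IsUnitriangular b') {g : ℂ → Matrix (Fin n) (Fin n) ℂ} (hg : IsDiscMatrix g)
    (h : ∀ l : Circle, b' * geodesic (xiOne n) l = b * geodesic (xiOne n) l * g l) : b' = b := by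
  have := groupC_eq_of_mul_geodesic hb.map_C_mem_groupC hb'.map_C_mem_groupC hg
    (fun l => by rw [map_C_map_eval, map_C_map_eval, h l])
  ext i j
  exact Polynomial.C_injective (congrFun (congrFun this i) j)

lemma unitary_inv {U : Matrix (Fin n) (Fin n) ℂ} (h : U ∈ Matrix.unitaryGroup (Fin n) ℂ) :
    U⁻¹ = star U := Matrix.inv_eq_right_inv (Matrix.mem_unitaryGroup_iff.1 h)

lemma inv_mul_of_unitary {U : Matrix (Fin n) (Fin n) ℂ} (h : U ∈ Matrix.unitaryGroup (Fin n) ℂ) :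
    U⁻¹ * U = 1 := by rw [unitary_inv h]; exact Matrix.mem_unitaryGroup_iff'.1 h

lemma secondTranspose_mem_unitaryGroup {U : Matrix (Fin n) (Fin n) ℂ}
    (h : U ∈ Matrix.unitaryGroup (Fin n) ℂ) :
    secondTranspose U ∈ Matrix.unitaryGroup (Fin n) ℂ := by
  rw [Matrix.mem_unitaryGroup_iff]
  have : star (secondTranspose U) = secondTranspose (star U) := by
    ext i j
    simp [secondTranspose, Matrix.star_apply]
  rw [this, ← secondTranspose_mul, Matrix.mem_unitaryGroup_iff'.1 h, secondTranspose_one]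

lemma IsIwasawaFactor.exists_disc {ψ γ : Circle → Matrix (Fin n) (Fin n) ℂ}
    (h : IsIwasawaFactor ψ γ) : ∃ g : ℂ → Matrix (Fin n) (Fin n) ℂ, IsDiscMatrix g ∧
      (∀ w ∈ Metric.closedBall (0 : ℂ) 1, IsUnit (g w)) ∧ ∀ l : Circle, ψ l = γ l * g l := by
  obtain ⟨-, B, ⟨-, g, hg, hu, hB⟩, h⟩ := h
  exact ⟨g, hg, hu, fun l => by rw [hB l, h l]⟩

/-- The factor in `ΩU(n)` of the Iwasawa decomposition is unique. -/
lemma IsIwasawaFactor.unique {ψ γ₁ γ₂ : Circle → Matrix (Fin n) (Fin n) ℂ}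
    (h₁ : IsIwasawaFactor ψ γ₁) (h₂ : IsIwasawaFactor ψ γ₂) : γ₁ = γ₂ := by
  obtain ⟨g₁, hg₁, hu₁, e₁⟩ := h₁.exists_disc
  obtain ⟨g₂, hg₂, hu₂, e₂⟩ := h₂.exists_disc
  have hW : ∀ l : Circle, g₂ l * (g₁ l)⁻¹ = (γ₂ l)⁻¹ * γ₁ l := by
    intro l
    have h1 := (Matrix.isUnit_iff_isUnit_det _).1 (hu₁ l (circle_mem_closedBall l))
    have e : γ₁ l * g₁ l = γ₂ l * g₂ l := by rw [← e₁, ← e₂]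
    calc g₂ l * (g₁ l)⁻¹ = (γ₂ l)⁻¹ * γ₂ l * g₂ l * (g₁ l)⁻¹ := by
          rw [inv_mul_of_unitary (h₂.1.1 l), one_mul]
      _ = (γ₂ l)⁻¹ * (γ₁ l * g₁ l) * (g₁ l)⁻¹ := by rw [e]; simp only [mul_assoc]
      _ = (γ₂ l)⁻¹ * γ₁ l := by
          rw [mul_assoc, mul_assoc, Matrix.mul_nonsing_inv _ h1, mul_one]
  funext l
  have hone := IsDiscMatrix.eq_one_of_unitary (g := fun w => g₂ w * (g₁ w)⁻¹)
    (hg₂.mul (hg₁.inv hu₁))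
    (fun w hw => (hu₂ w hw).mul (Matrix.isUnit_nonsing_inv_iff.2 (hu₁ w hw)))
    (fun l => by
      rw [hW l, unitary_inv (h₂.1.1 l)]
      exact mul_mem (Unitary.star_mem (h₂.1.1 l)) (h₁.1.1 l))
    (by
      have := hW 1
      rw [h₁.1.2.1, h₂.1.2.1] at this
      simpa using this) l
  rw [hW l] at hone
  calc γ₁ l = γ₂ l * ((γ₂ l)⁻¹ * γ₁ l) := by
        rw [← mul_assoc, unitary_inv (h₂.1.1 l), Matrix.mem_unitaryGroup_iff.1 (h₂.1.1 l), one_mul]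
    _ = γ₂ l := by rw [hone, mul_one]

/-- A constant unitriangular `b` is determined by `[b γ]`. -/
lemma IsUnitriangular.eq_of_isIwasawaFactor {b b' : Matrix (Fin n) (Fin n) ℂ}
    (hb : IsUnitriangular b) (hb' : IsUnitriangular b')
    {φ : Circle → Matrix (Fin n) (Fin n) ℂ}
    (h : IsIwasawaFactor (fun l => b * geodesic (xiOne n) l) φ)
    (h' : IsIwasawaFactor (fun l => b' * geodesic (xiOne n) l) φ) : b' = b := by
  obtain ⟨g, hg, hu, e⟩ := h.exists_disc
  obtain ⟨g', hg', hu', e'⟩ := h'.exists_disc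
  refine hb.eq_of_mul_geodesic hb' (g := fun w => (g w)⁻¹ * g' w) ((hg.inv hu).mul hg') fun l => ?_
  rw [e' l, e l, mul_assoc, ← mul_assoc (g l), Matrix.mul_nonsing_inv _
    ((Matrix.isUnit_iff_isUnit_det _).1 (hu l (circle_mem_closedBall l))), one_mul]

/-- If `[a γ]` is a homomorphism from the circle, then `a` does not depend on `λ`: the loops
`a(κλ) γ(λ)` all have the same Iwasawa factor. -/
lemma exists_const_of_s1Invariant {a : Matrix (Fin n) (Fin n) ℂ[X]} (ha : a ∈ groupC (xiOne n))
    {φ : Circle → Matrix (Fin n) (Fin n) ℂ} (hφ : ∀ l k, φ (l * k) = φ l * φ k)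
    (h : IsIwasawaFactor (fun l => a.map (eval (l : ℂ)) * geodesic (xiOne n) l) φ) :
    a = (a.map fun p => p.coeff 0).map C := by
  obtain ⟨g, hg, hu, e⟩ := h.exists_disc
  -- invariance: `a(κλ) γ(λ) = φ(λ) φ(κ) g(κλ) γ(κ)⁻¹`, a loop with factor `φ`
  have hcomp : ∀ k : Circle, a.map (fun p => p.comp (C (k : ℂ) * X)) = a := by
    intro k
    refine groupC_eq_of_mul_geodesic ha ?_
      (g := fun w => (g w)⁻¹ * φ k * g (k * w) * geodesic (xiOne n) k⁻¹)
      ((((hg.inv hu).mul (IsDiscMatrix.const _)).mul (hg.comp_mul k)).mul (IsDiscMatrix.const _)) ?_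
    · intro i j
      refine ⟨fun hij => ?_, fun hij => ?_⟩
      · rw [Matrix.map_apply, (ha i j).1 hij]
        split_ifs <;> simp
      · rw [Matrix.map_apply]
        refine le_trans ?_ ((ha i j).2 hij)
        refine Polynomial.natDegree_comp_le.trans ?_
        have : (C (k : ℂ) * X).natDegree ≤ 1 :=
          (Polynomial.natDegree_C_mul_le _ _).trans Polynomial.natDegree_X_le
        calc _ ≤ (a i j).natDegree * 1 := Nat.mul_le_mul_left _ this
          _ = _ := mul_one _
    · intro l
      have hlk := e (k * l)
      rw [geodesic_mul, mul_comm k l, hφ] at hlk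
      have h1 : (a.map fun p => p.comp (C (k : ℂ) * X)).map (eval (l : ℂ)) =
          a.map (eval ((l * k : Circle) : ℂ)) := by
        ext i j
        simp only [Matrix.map_apply, eval_comp, eval_mul, eval_C, eval_X, Circle.coe_mul]
        rw [mul_comm]
      have h2 : geodesic (xiOne n) k * geodesic (xiOne n) k⁻¹ = 1 := by
        rw [← geodesic_mul, mul_inv_cancel, geodesic_one]
      have hcom : geodesic (xiOne n) k * geodesic (xiOne n) l =
          geodesic (xiOne n) l * geodesic (xiOne n) k := by
        rw [← geodesic_mul, mul_comm, geodesic_mul]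
      rw [hcom, ← mul_assoc] at hlk
      rw [h1]
      have hgl := Matrix.mul_nonsing_inv _
        ((Matrix.isUnit_iff_isUnit_det _).1 (hu l (circle_mem_closedBall l)))
      calc a.map (eval ((l * k : Circle) : ℂ)) * geodesic (xiOne n) l
          = a.map (eval ((l * k : Circle) : ℂ)) * geodesic (xiOne n) l * geodesic (xiOne n) k *
              geodesic (xiOne n) k⁻¹ := by rw [mul_assoc _ (geodesic _ k), h2, mul_one]
        _ = φ l * φ k * g ((l * k : Circle) : ℂ) * geodesic (xiOne n) k⁻¹ := by rw [hlk]
        _ = φ l * (g l * (g l)⁻¹) * φ k * g ((l * k : Circle) : ℂ) * geodesic (xiOne n) k⁻¹ := by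
            rw [hgl, mul_one]
        _ = φ l * g l * ((g l)⁻¹ * φ k * g (k * l) * geodesic (xiOne n) k⁻¹) := by
            rw [Circle.coe_mul, mul_comm (l : ℂ) (k : ℂ)]
            simp only [mul_assoc]
        _ = _ := by rw [← e l]
  ext1 i j
  have heval : ∀ k : Circle, (a i j).eval (k : ℂ) = (a i j).eval 1 := by
    intro k
    have := congrFun (congrFun (hcomp k) i) j
    rw [Matrix.map_apply] at this
    have h1 := congrArg (eval (1 : ℂ)) this
    rw [Polynomial.eval_comp] at h1
    simpa using h1
  have hconst : a i j = C ((a i j).eval 1) := by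
    refine Polynomial.eq_of_infinite_eval_eq _ _ ?_
    refine infinite_unitCircle.mono fun k hk => ?_
    have := heval ⟨k, mem_sphere_zero_iff_norm.2 (mem_sphere_zero_iff_norm.1 hk)⟩
    simpa using this
  rw [Matrix.map_apply, Matrix.map_apply, hconst]
  simp

/-- The second transpose of an Iwasawa decomposition of `b γ`, multiplied by the decomposition; by
`γ γᵀ = λ^{n-1}` the factor `γᵀ` is traded for `γ`. -/
lemma secondTranspose_mul_of_isIwasawa {b : Matrix (Fin n) (Fin n) ℂ}
    {φ : Matrix (Fin n) (Fin n) ℂ} {B : Matrix (Fin n) (Fin n) ℂ} {l : Circle}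
    (h : b * geodesic (xiOne n) l = φ * B) :
    (l : ℂ) ^ (n - 1) • (secondTranspose b * b * geodesic (xiOne n) l) =
      geodesic (xiOne n) l * (secondTranspose B * (secondTranspose φ * φ) * B) := by
  have h1 : secondTranspose B * (secondTranspose φ * φ) * B =
      secondTranspose (geodesic (xiOne n) l) * (secondTranspose b * b * geodesic (xiOne n) l) := by
    calc secondTranspose B * (secondTranspose φ * φ) * B
        = secondTranspose (φ * B) * (φ * B) := by
          rw [secondTranspose_mul]; simp only [mul_assoc]
      _ = _ := by rw [← h, secondTranspose_mul]; simp only [mul_assoc]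
  rw [h1, ← mul_assoc, geodesic_mul_secondTranspose, smul_mul_assoc, one_mul]

lemma secondTranspose_inv {B : Matrix (Fin n) (Fin n) ℂ} (hB : IsUnit B) :
    secondTranspose B⁻¹ * secondTranspose B = 1 ∧ IsUnit (secondTranspose B) := by
  have h := Matrix.mul_nonsing_inv _ ((Matrix.isUnit_iff_isUnit_det _).1 hB)
  have h1 : secondTranspose B⁻¹ * secondTranspose B = 1 := by
    rw [← secondTranspose_mul, h, secondTranspose_one]
  exact ⟨h1, IsUnit.of_mul_eq_one_right _ h1⟩

/-- If `[b γ]` is real then `b` is complex-orthogonal. -/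
lemma IsUnitriangular.orthogonal_of_real {b : Matrix (Fin n) (Fin n) ℂ} (hb : IsUnitriangular b)
    {φ : Circle → Matrix (Fin n) (Fin n) ℂ}
    (h : IsIwasawaFactor (fun l => b * geodesic (xiOne n) l) φ)
    (hr : ∀ l : Circle, HarmonicOn.secondTranspose (φ l) * φ l = (l : ℂ) ^ (n - 1) • 1) :
    HarmonicOn.secondTranspose b * b = 1 := by
  obtain ⟨g, hg, hu, e⟩ := h.exists_disc
  have h1 : IsUnitriangular (1 : Matrix (Fin n) (Fin n) ℂ) := fun i j _ => Matrix.one_apply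
  refine h1.eq_of_mul_geodesic (hb.secondTranspose.mul hb)
    (g := fun w => HarmonicOn.secondTranspose (g w) * g w) (hg.secondTranspose.mul hg) fun l => ?_
  have := secondTranspose_mul_of_isIwasawa (e l)
  rw [hr l, mul_smul_comm, smul_mul_assoc, mul_smul_comm, mul_one] at this
  have hl : (l : ℂ) ^ (n - 1) ≠ 0 := pow_ne_zero _ l.coe_ne_zero
  rw [one_mul]
  exact smul_right_injective _ hl this

/-- If `b` is complex-orthogonal then `[b γ]` is real: `λ^{1-n} Φᵀ Φ` is a unitary loop extending
holomorphically to the disc. -/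
lemma real_of_orthogonal {b : Matrix (Fin n) (Fin n) ℂ} (hb : secondTranspose b * b = 1)
    {φ : Circle → Matrix (Fin n) (Fin n) ℂ}
    (h : IsIwasawaFactor (fun l => b * geodesic (xiOne n) l) φ) (l : Circle) :
    secondTranspose (φ l) * φ l = (l : ℂ) ^ (n - 1) • 1 := by
  obtain ⟨g, hg, hu, e⟩ := h.exists_disc
  have hunit : ∀ w ∈ Metric.closedBall (0 : ℂ) 1, IsUnit (g w)⁻¹ := fun w hw =>
    Matrix.isUnit_nonsing_inv_iff.2 (hu w hw)
  have key : ∀ l : Circle, (l : ℂ) ^ (n - 1) • (secondTranspose (g l)⁻¹ * (g l)⁻¹) =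
      secondTranspose (φ l) * φ l := by
    intro l
    have hgl := hu l (circle_mem_closedBall l)
    have h1 := secondTranspose_mul_of_isIwasawa (e l)
    rw [hb, one_mul] at h1
    have hγ : geodesic (xiOne n) l⁻¹ * geodesic (xiOne n) l = 1 := by
      rw [← geodesic_mul, inv_mul_cancel, geodesic_one]
    have h2 : (l : ℂ) ^ (n - 1) • (1 : Matrix (Fin n) (Fin n) ℂ) =
        secondTranspose (g l) * (secondTranspose (φ l) * φ l) * g l := by
      have := congrArg (geodesic (xiOne n) l⁻¹ * ·) h1
      beta_reduce at this
      rwa [mul_smul_comm, hγ, ← mul_assoc, hγ, one_mul] at this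
    have hi := (secondTranspose_inv hgl).1
    have hj := Matrix.mul_nonsing_inv _ ((Matrix.isUnit_iff_isUnit_det _).1 hgl)
    calc (l : ℂ) ^ (n - 1) • (secondTranspose (g l)⁻¹ * (g l)⁻¹)
        = secondTranspose (g l)⁻¹ * ((l : ℂ) ^ (n - 1) • 1) * (g l)⁻¹ := by
          rw [mul_smul_comm, mul_one, smul_mul_assoc]
      _ = (secondTranspose (g l)⁻¹ * secondTranspose (g l)) * (secondTranspose (φ l) * φ l) *
            (g l * (g l)⁻¹) := by rw [h2]; simp only [mul_assoc]
      _ = _ := by rw [hi, hj, one_mul, mul_one]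
  have hnorm : ∀ l : Circle, (l : ℂ) ^ (n - 1) ≠ 0 := fun l => pow_ne_zero _ l.coe_ne_zero
  have hW : ∀ l : Circle, secondTranspose (g l)⁻¹ * (g l)⁻¹ =
      ((l⁻¹ ^ (n - 1) : Circle) : ℂ) • (secondTranspose (φ l) * φ l) := by
    intro l
    rw [← key l, smul_smul]
    simp [Circle.coe_pow, Circle.coe_inv, l.coe_ne_zero]
  have hone := IsDiscMatrix.eq_one_of_unitary (g := fun w => secondTranspose (g w)⁻¹ * (g w)⁻¹)
    ((hg.inv hu).secondTranspose.mul (hg.inv hu))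
    (fun w hw => (secondTranspose_inv (hunit w hw)).2.mul (hunit w hw))
    (fun l => by
      rw [hW l]
      have hm := mul_mem (secondTranspose_mem_unitaryGroup (h.1.1 l)) (h.1.1 l)
      rw [Matrix.mem_unitaryGroup_iff] at hm ⊢
      rw [star_smul, smul_mul_smul_comm, hm]
      rw [show ((l⁻¹ ^ (n - 1) : Circle) : ℂ) * star ((l⁻¹ ^ (n - 1) : Circle) : ℂ) = 1 from ?_,
        one_smul]
      rw [Complex.star_def, Complex.mul_conj, Circle.normSq_coe, Complex.ofReal_one])
    (by
      have := hW 1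
      rw [h.1.2.1, secondTranspose_one] at this
      simpa using this) l
  rw [← key l, hone]

end Iwasawa

/-! ### Matrices of orthogonal projections -/

section Proj

variable {n : ℕ}

lemma proj_mulVec (V : Submodule ℂ (EuclideanSpace ℂ (Fin n))) (v : EuclideanSpace ℂ (Fin n)) :
    WithLp.toLp 2 (proj V *ᵥ v.ofLp) = V.starProjection v := by
  have h : Matrix.toEuclideanLin (proj V) v = V.starProjection v := by
    rw [proj, LinearEquiv.apply_symm_apply]
    rfl
  rw [← h]
  exact (Matrix.toLpLin_apply 2 2 (proj V) v).symm

lemma mem_iff_proj_mulVec {V : Submodule ℂ (EuclideanSpace ℂ (Fin n))}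
    {v : EuclideanSpace ℂ (Fin n)} : v ∈ V ↔ proj V *ᵥ v.ofLp = v.ofLp := by
  rw [← Submodule.starProjection_eq_self_iff, ← proj_mulVec]
  exact ⟨fun h => congrArg WithLp.ofLp h, fun h => congrArg (WithLp.toLp 2) h⟩

lemma proj_mulVec_mem (V : Submodule ℂ (EuclideanSpace ℂ (Fin n))) (v : Fin n → ℂ) :
    WithLp.toLp 2 (proj V *ᵥ v) ∈ V := by
  have := proj_mulVec V (WithLp.toLp 2 v)
  rw [this]
  exact V.starProjection_apply_mem _

lemma matrix_ext_mulVec {k : ℕ} {A B : Matrix (Fin n) (Fin k) ℂ} (h : ∀ v, A *ᵥ v = B *ᵥ v) :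
    A = B := Matrix.ext_of_mulVec_single fun _ => h _

/-- An Hermitian matrix that fixes `V` and maps into `V` is the projection onto `V`. -/
lemma proj_eq_of {V : Submodule ℂ (EuclideanSpace ℂ (Fin n))} {P : Matrix (Fin n) (Fin n) ℂ}
    (hP : Pᴴ = P) (h1 : ∀ v ∈ V, P *ᵥ v.ofLp = v.ofLp) (h2 : ∀ v, WithLp.toLp 2 (P *ᵥ v) ∈ V) :
    proj V = P := by
  refine matrix_ext_mulVec fun v => ?_
  have key : V.starProjection (WithLp.toLp 2 v) = WithLp.toLp 2 (P *ᵥ v) := by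
    refine Submodule.eq_starProjection_of_mem_of_inner_eq_zero (h2 v) fun w hw => ?_
    have e : P *ᵥ (v - P *ᵥ v) = 0 := by
      rw [Matrix.mulVec_sub, h1 _ (h2 v), sub_self]
    rw [EuclideanSpace.inner_eq_star_dotProduct, ← h1 w hw]
    have : (WithLp.toLp 2 v - WithLp.toLp 2 (P *ᵥ v) : EuclideanSpace ℂ (Fin n)).ofLp =
      v - P *ᵥ v := rfl
    have e' := congrArg star e
    rw [Matrix.star_mulVec, hP, star_zero] at e'
    rw [this, dotProduct_comm, Matrix.dotProduct_mulVec, e', zero_dotProduct]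
  have := proj_mulVec V (WithLp.toLp 2 v)
  rw [key] at this
  exact congrArg WithLp.ofLp this

lemma proj_mul_self (V : Submodule ℂ (EuclideanSpace ℂ (Fin n))) : proj V * proj V = proj V := by
  refine matrix_ext_mulVec fun v => ?_
  rw [← Matrix.mulVec_mulVec]
  exact mem_iff_proj_mulVec.1 (proj_mulVec_mem V v)

lemma proj_conjTranspose (V : Submodule ℂ (EuclideanSpace ℂ (Fin n))) : (proj V)ᴴ = proj V := by
  apply Matrix.toEuclideanLin.injective
  rw [Matrix.toEuclideanLin_conjTranspose_eq_adjoint, proj, LinearEquiv.apply_symm_apply]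
  refine ((LinearMap.eq_adjoint_iff _ _).2 fun x y => ?_).symm
  exact V.inner_starProjection_left_eq_right x y

lemma proj_injective : Function.Injective (proj : Submodule ℂ (EuclideanSpace ℂ (Fin n)) → _) := by
  intro V W h
  ext v
  rw [mem_iff_proj_mulVec, mem_iff_proj_mulVec, h]

lemma proj_orthogonal (V : Submodule ℂ (EuclideanSpace ℂ (Fin n))) : proj Vᗮ = 1 - proj V := by
  refine matrix_ext_mulVec fun v => ?_
  have h1 := proj_mulVec Vᗮ (WithLp.toLp 2 v)
  have h2 := proj_mulVec V (WithLp.toLp 2 v)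
  rw [Submodule.starProjection_orthogonal, _root_.sub_apply, ← h2] at h1
  rw [Matrix.sub_mulVec, Matrix.one_mulVec]
  exact congrArg WithLp.ofLp h1

lemma proj_mul_proj_of_le {V W : Submodule ℂ (EuclideanSpace ℂ (Fin n))} (h : V ≤ W) :
    proj W * proj V = proj V := by
  refine matrix_ext_mulVec fun v => ?_
  rw [← Matrix.mulVec_mulVec]
  exact mem_iff_proj_mulVec.1 (h (proj_mulVec_mem V v))

lemma proj_mul_proj_of_le' {V W : Submodule ℂ (EuclideanSpace ℂ (Fin n))} (h : V ≤ W) :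
    proj V * proj W = proj V := by
  have := congrArg Matrix.conjTranspose (proj_mul_proj_of_le h)
  rwa [Matrix.conjTranspose_mul, proj_conjTranspose, proj_conjTranspose] at this

lemma le_of_proj_mul_proj {V W : Submodule ℂ (EuclideanSpace ℂ (Fin n))}
    (h : proj W * proj V = proj V) : V ≤ W := by
  intro v hv
  rw [mem_iff_proj_mulVec] at hv ⊢
  rw [← hv, Matrix.mulVec_mulVec, h]

lemma proj_bot : proj (⊥ : Submodule ℂ (EuclideanSpace ℂ (Fin n))) = 0 :=
  proj_eq_of (by simp) (fun v hv => by rw [(Submodule.mem_bot ℂ).1 hv]; simp) fun v => by simp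

lemma proj_top : proj (⊤ : Submodule ℂ (EuclideanSpace ℂ (Fin n))) = 1 :=
  proj_eq_of (by simp) (fun v _ => by simp) fun v => Submodule.mem_top

end Proj

/-! ### Flags and the loops `Σ λ^k Q_k` -/

section Flag

variable {n : ℕ}

/-- `α` is an increasing sequence of subspaces from `0` to the whole space, reached at index
`N`. -/
structure IsFlag (α : ℕ → Submodule ℂ (EuclideanSpace ℂ (Fin n))) (N : ℕ) : Prop where
  mono : Monotone α
  zero : α 0 = ⊥
  top : α N = ⊤

/-- The orthogonal projection onto `ψ_k = α_k^⊥ ∩ α_{k+1}`, written as the difference of the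
projections onto `α_{k+1}` and `α_k`. -/
noncomputable def flagStep (α : ℕ → Submodule ℂ (EuclideanSpace ℂ (Fin n))) (k : ℕ) :
    Matrix (Fin n) (Fin n) ℂ := proj (α (k + 1)) - proj (α k)

/-- The loop `Σ_{k < N} λ^k Q_k`, with `Q_k` the projection onto `ψ_k`. -/
noncomputable def flagLoop (α : ℕ → Submodule ℂ (EuclideanSpace ℂ (Fin n))) (N : ℕ) (w : ℂ) :
    Matrix (Fin n) (Fin n) ℂ := ∑ k ∈ Finset.range N, w ^ k • flagStep α k

variable {α : ℕ → Submodule ℂ (EuclideanSpace ℂ (Fin n))} {N : ℕ}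

lemma flagStep_conjTranspose (α : ℕ → Submodule ℂ (EuclideanSpace ℂ (Fin n))) (k : ℕ) :
    (flagStep α k)ᴴ = flagStep α k := by
  rw [flagStep, Matrix.conjTranspose_sub, proj_conjTranspose, proj_conjTranspose]

lemma IsFlag.step_mul_proj (h : IsFlag α N) {k j : ℕ} (hkj : k < j) :
    flagStep α k * proj (α j) = flagStep α k := by
  rw [flagStep, sub_mul, proj_mul_proj_of_le' (h.mono (by omega)),
    proj_mul_proj_of_le' (h.mono (by omega))]

lemma IsFlag.step_mul_proj_of_le (h : IsFlag α N) {k j : ℕ} (hkj : j ≤ k) :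
    flagStep α k * proj (α j) = 0 := by
  rw [flagStep, sub_mul, proj_mul_proj_of_le (h.mono (by omega)),
    proj_mul_proj_of_le (h.mono hkj), sub_self]

lemma IsFlag.step_mul_step (h : IsFlag α N) (k j : ℕ) :
    flagStep α k * flagStep α j = if k = j then flagStep α k else 0 := by
  rw [flagStep.eq_def α j, mul_sub]
  rcases lt_trichotomy k j with hkj | rfl | hkj
  · rw [h.step_mul_proj (by omega), h.step_mul_proj hkj, sub_self, if_neg hkj.ne]
  · rw [h.step_mul_proj (by omega), h.step_mul_proj_of_le le_rfl, sub_zero, if_pos rfl]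
  · rw [h.step_mul_proj_of_le (by omega), h.step_mul_proj_of_le hkj.le, sub_self, if_neg hkj.ne']

lemma IsFlag.sum_step (h : IsFlag α N) (k : ℕ) :
    ∑ j ∈ Finset.range k, flagStep α j = proj (α k) := by
  simp only [flagStep]
  rw [Finset.sum_range_sub (fun j => proj (α j)), h.zero, proj_bot, sub_zero]

lemma IsFlag.sum_step_top (h : IsFlag α N) : ∑ j ∈ Finset.range N, flagStep α j = 1 := by
  rw [h.sum_step, h.top, proj_top]

lemma IsFlag.step_mul_loop (h : IsFlag α N) {k : ℕ} (hk : k < N) (w : ℂ) :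
    flagStep α k * flagLoop α N w = w ^ k • flagStep α k := by
  rw [flagLoop, Finset.mul_sum, Finset.sum_eq_single k]
  · rw [mul_smul_comm, h.step_mul_step, if_pos rfl]
  · intro j _ hj
    rw [mul_smul_comm, h.step_mul_step, if_neg hj.symm, smul_zero]
  · intro hk'
    exact absurd (Finset.mem_range.2 hk) hk'

lemma IsFlag.loop_mul (h : IsFlag α N) (w z : ℂ) :
    flagLoop α N (w * z) = flagLoop α N w * flagLoop α N z := by
  conv_rhs => rw [flagLoop, Finset.sum_mul]
  rw [flagLoop]
  refine Finset.sum_congr rfl fun k hk => ?_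
  rw [smul_mul_assoc, h.step_mul_loop (Finset.mem_range.1 hk), smul_smul, mul_pow]

lemma IsFlag.loop_one (h : IsFlag α N) : flagLoop α N 1 = 1 := by
  simp only [flagLoop, one_pow, one_smul]
  exact h.sum_step_top

lemma flagLoop_conjTranspose (α : ℕ → Submodule ℂ (EuclideanSpace ℂ (Fin n))) (N : ℕ)
    (l : Circle) : (flagLoop α N l)ᴴ = flagLoop α N (l⁻¹ : Circle) := by
  rw [flagLoop, Matrix.conjTranspose_sum, flagLoop]
  refine Finset.sum_congr rfl fun k _ => ?_
  rw [Matrix.conjTranspose_smul, flagStep_conjTranspose, star_pow, Circle.coe_inv_eq_conj]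
  rfl

lemma IsFlag.loop_inv (h : IsFlag α N) (l : Circle) :
    flagLoop α N (l⁻¹ : Circle) * flagLoop α N l = 1 := by
  rw [← h.loop_mul, ← Circle.coe_mul, inv_mul_cancel, Circle.coe_one, h.loop_one]

lemma IsFlag.loop_mem_unitaryGroup (h : IsFlag α N) (l : Circle) :
    flagLoop α N l ∈ Matrix.unitaryGroup (Fin n) ℂ := by
  rw [Matrix.mem_unitaryGroup_iff', Matrix.star_eq_conjTranspose, flagLoop_conjTranspose,
    h.loop_inv]

attribute [local instance] finrank_real_complex_fact'

lemma contMDiff_coe_circle : ContMDiff (𝓡 1) 𝓘(ℝ, ℂ) ∞ fun l : Circle => (l : ℂ) :=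
  contMDiff_coe_sphere

lemma flagLoop_apply (α : ℕ → Submodule ℂ (EuclideanSpace ℂ (Fin n))) (N : ℕ) (w : ℂ)
    (i j : Fin n) : flagLoop α N w i j = ∑ k ∈ Finset.range N, w ^ k * flagStep α k i j := by
  simp [flagLoop, Matrix.sum_apply]

lemma contMDiff_comp_coe_circle {f : ℂ → ℂ} (hf : ContDiff ℝ ∞ f) :
    ContMDiff (𝓡 1) 𝓘(ℝ, ℂ) ∞ fun l : Circle => f l :=
  hf.contMDiff.comp contMDiff_coe_circle

lemma IsFlag.isBasedLoop (h : IsFlag α N) : IsBasedLoop fun l : Circle => flagLoop α N l := by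
  refine ⟨h.loop_mem_unitaryGroup, by simpa using h.loop_one, fun i j => ?_⟩
  refine contMDiff_comp_coe_circle (f := fun w => flagLoop α N w i j) ?_
  simp only [flagLoop_apply]
  exact ContDiff.sum fun k _ => (contDiff_id.pow k).mul contDiff_const

/-- The product of the factors `π_{α_i} + λ π_{α_i}^⊥` is `Σ λ^k Q_k`. -/
lemma IsFlag.unitonProduct_eq {r : ℕ} (h : IsFlag α (r + 1)) (w : ℂ) :
    unitonProduct r α w = flagLoop α (r + 1) w := by
  have key : ∀ s : ℕ, unitonProduct s α w =
      ∑ k ∈ Finset.range s, w ^ k • flagStep α k + w ^ s • (1 - proj (α s)) := by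
    intro s
    induction s with
    | zero => simp [unitonProduct, h.zero, proj_bot]
    | succ s ih =>
      rw [unitonProduct, List.ofFn_succ', List.concat_eq_append, List.prod_append,
        List.prod_singleton]
      have e : (List.ofFn fun i : Fin s => proj (α ((Fin.castSucc i : Fin (s + 1)) + 1)) +
          w • proj (α ((Fin.castSucc i : Fin (s + 1)) + 1))ᗮ).prod = unitonProduct s α w := rfl
      rw [e, ih, Finset.sum_range_succ, Fin.val_last, proj_orthogonal, add_mul]
      have e1 : (∑ k ∈ Finset.range s, w ^ k • flagStep α k) *
          (proj (α (s + 1)) + w • (1 - proj (α (s + 1)))) =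
          ∑ k ∈ Finset.range s, w ^ k • flagStep α k := by
        rw [Finset.sum_mul]
        refine Finset.sum_congr rfl fun k hk => ?_
        have hk' := Finset.mem_range.1 hk
        rw [smul_mul_assoc, mul_add, mul_smul_comm, mul_sub, mul_one,
          h.step_mul_proj (by omega), sub_self, smul_zero, add_zero]
      have e2 : (1 - proj (α s)) * (proj (α (s + 1)) + w • (1 - proj (α (s + 1)))) =
          flagStep α s + w • (1 - proj (α (s + 1))) := by
        rw [mul_add, mul_smul_comm, sub_mul, sub_mul, one_mul, one_mul, mul_sub, mul_one,
          proj_mul_proj_of_le' (h.mono (Nat.le_succ s)), sub_self, sub_zero, flagStep]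
      rw [e1, smul_mul_assoc, e2, smul_add, smul_smul, pow_succ, add_assoc]
  rw [key, flagLoop, Finset.sum_range_succ, flagStep, h.top, proj_top]

/-- `π_V - π_V^⊥` for the sum `V` of the `ψ_{2i}`. -/
lemma IsFlag.cartan_evenSum {m : ℕ} (h : IsFlag α (2 * m + 1)) :
    cartan (evenSum (2 * m) α) = flagLoop α (2 * m + 1) (-1) := by
  -- the projection onto `ψ_k`
  have hψ : ∀ k, proj ((α k)ᗮ ⊓ α (k + 1)) = flagStep α k := by
    intro k
    refine proj_eq_of (flagStep_conjTranspose α k) (fun v hv => ?_) fun v => ⟨?_, ?_⟩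
    · have h1 := mem_iff_proj_mulVec.1 hv.1
      have h2 := mem_iff_proj_mulVec.1 hv.2
      rw [proj_orthogonal, Matrix.sub_mulVec, Matrix.one_mulVec] at h1
      rw [flagStep, Matrix.sub_mulVec, h2]
      exact h1
    · rw [SetLike.mem_coe, mem_iff_proj_mulVec, proj_orthogonal, Matrix.mulVec_mulVec, sub_mul,
        one_mul]
      have : proj (α k) * flagStep α k = 0 := by
        rw [flagStep, mul_sub, proj_mul_proj_of_le' (h.mono (Nat.le_succ k)), proj_mul_self,
          sub_self]
      rw [this, sub_zero]
    · rw [SetLike.mem_coe, mem_iff_proj_mulVec, Matrix.mulVec_mulVec]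
      have : proj (α (k + 1)) * flagStep α k = flagStep α k := by
        rw [flagStep, mul_sub, proj_mul_proj_of_le (h.mono (Nat.le_succ k)), proj_mul_self]
      rw [this]
  have hsum : proj (evenSum (2 * m) α) = ∑ i ∈ Finset.range (m + 1), flagStep α (2 * i) := by
    have hm : 2 * m / 2 + 1 = m + 1 := by omega
    refine proj_eq_of ?_ (fun v hv => ?_) fun v => ?_
    · rw [Matrix.conjTranspose_sum]
      exact Finset.sum_congr rfl fun i _ => flagStep_conjTranspose α _
    · let K : Submodule ℂ (EuclideanSpace ℂ (Fin n)) :=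
        { carrier := {v | (∑ i ∈ Finset.range (m + 1), flagStep α (2 * i)) *ᵥ v.ofLp = v.ofLp}
          add_mem' := fun {a b} ha hb => by
            change _ *ᵥ (a.ofLp + b.ofLp) = a.ofLp + b.ofLp
            rw [Matrix.mulVec_add, ha, hb]
          zero_mem' := Matrix.mulVec_zero _
          smul_mem' := fun c a ha => by
            change _ *ᵥ (c • a.ofLp) = c • a.ofLp
            rw [Matrix.mulVec_smul, ha] }
      have hle : evenSum (2 * m) α ≤ K := by
        rw [evenSum, hm]
        refine iSup₂_le fun i hi u hu => ?_
        change _ *ᵥ u.ofLp = u.ofLp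
        rw [← mem_iff_proj_mulVec.1 hu, hψ, Matrix.mulVec_mulVec, Finset.sum_mul]
        congr 1
        rw [Finset.sum_eq_single i]
        · rw [h.step_mul_step, if_pos rfl]
        · intro j _ hj
          rw [h.step_mul_step, if_neg (by omega)]
        · intro hi'
          exact absurd hi hi'
      exact hle hv
    · rw [Matrix.sum_mulVec, WithLp.toLp_sum, evenSum, hm]
      refine Submodule.sum_mem _ fun i hi => ?_
      refine Submodule.mem_iSup_of_mem i (Submodule.mem_iSup_of_mem hi ?_)
      rw [← hψ]
      exact proj_mulVec_mem _ _
  -- `2 Σ Q_{2i} = Σ Q_k + Σ (-1)^k Q_k`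
  have hparity : ∀ s : ℕ, (2 : ℂ) • ∑ i ∈ Finset.range (s + 1), flagStep α (2 * i) =
      ∑ k ∈ Finset.range (2 * s + 1), flagStep α k + flagLoop α (2 * s + 1) (-1) := by
    intro s
    induction s with
    | zero => simp [flagLoop, two_smul]
    | succ s ih =>
      rw [Finset.sum_range_succ, smul_add, ih, show 2 * (s + 1) + 1 = 2 * s + 1 + 1 + 1 by ring,
        flagLoop, flagLoop, Finset.sum_range_succ _ (2 * s + 1 + 1),
        Finset.sum_range_succ _ (2 * s + 1), Finset.sum_range_succ _ (2 * s + 1 + 1),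
        Finset.sum_range_succ _ (2 * s + 1)]
      have e1 : (-1 : ℂ) ^ (2 * s + 1) = -1 := by rw [pow_succ, pow_mul]; simp
      have e2 : (-1 : ℂ) ^ (2 * s + 1 + 1) = 1 := by rw [pow_succ, e1]; simp
      rw [e1, e2, show 2 * (s + 1) = 2 * s + 1 + 1 by ring, two_smul, one_smul, neg_one_smul]
      abel
  have hp := hparity m
  rw [h.sum_step_top, ← hsum, two_smul] at hp
  rw [cartan, proj_orthogonal, sub_sub_eq_add_sub, hp, add_sub_cancel_left]

end Flag

/-! ### The Iwasawa factor of `b γ` for constant `b` -/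

section ConstIwasawa

variable {n : ℕ}

lemma IsUnitriangular.det_eq_one {b : Matrix (Fin n) (Fin n) ℂ} (hb : IsUnitriangular b) :
    b.det = 1 := by
  have h : b.IsUpperTriangular := fun i j hij => hb.lower hij
  rw [Matrix.det_of_isUpperTriangular h]
  exact Finset.prod_eq_one fun i _ => hb.diag i

lemma IsUnitriangular.inv_mul {b : Matrix (Fin n) (Fin n) ℂ} (hb : IsUnitriangular b) :
    b⁻¹ * b = 1 := Matrix.nonsing_inv_mul _ (by rw [hb.det_eq_one]; exact isUnit_one)

lemma IsUnitriangular.mul_inv {b : Matrix (Fin n) (Fin n) ℂ} (hb : IsUnitriangular b) :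
    b * b⁻¹ = 1 := Matrix.mul_nonsing_inv _ (by rw [hb.det_eq_one]; exact isUnit_one)

lemma lastColumns_mono (b : Matrix (Fin n) (Fin n) ℂ) : Monotone (lastColumns b) :=
  fun _ _ hkl => Submodule.span_mono fun _ ⟨j, hj, hv⟩ => ⟨j, by omega, hv⟩

lemma column_mem_lastColumns (b : Matrix (Fin n) (Fin n) ℂ) {k : ℕ} {j : Fin n} (h : n ≤ j + k) :
    (WithLp.toLp 2 fun i => b i j : EuclideanSpace ℂ (Fin n)) ∈ lastColumns b k :=
  Submodule.subset_span ⟨j, h, rfl⟩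

/-- The span of the last `k` columns of `b` in terms of coordinates with respect to all
columns. -/
lemma IsUnitriangular.mem_lastColumns_iff {b : Matrix (Fin n) (Fin n) ℂ} (hb : IsUnitriangular b)
    {k : ℕ} {v : EuclideanSpace ℂ (Fin n)} :
    v ∈ lastColumns b k ↔ ∀ j : Fin n, (j : ℕ) + k < n → (b⁻¹ *ᵥ v.ofLp) j = 0 := by
  constructor
  · intro hv j hj
    induction hv using Submodule.span_induction with
    | mem x hx =>
      obtain ⟨p, hp, rfl⟩ := hx
      have e : (b⁻¹ *ᵥ fun i => b i p) j = (b⁻¹ * b) j p := rfl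
      have hne : j ≠ p := fun h => by subst h; omega
      change (b⁻¹ *ᵥ fun i => b i p) j = 0
      rw [e, hb.inv_mul, Matrix.one_apply_ne hne]
    | zero => simp
    | add x y _ _ hx hy => rw [WithLp.ofLp_add, Matrix.mulVec_add, Pi.add_apply, hx, hy, add_zero]
    | smul c x _ hx => rw [WithLp.ofLp_smul, Matrix.mulVec_smul, Pi.smul_apply, hx, smul_zero]
  · intro h
    have hv : v = ∑ j : Fin n, (b⁻¹ *ᵥ v.ofLp) j •
        (WithLp.toLp 2 fun i => b i j : EuclideanSpace ℂ (Fin n)) := by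
      have e : v.ofLp = b *ᵥ (b⁻¹ *ᵥ v.ofLp) := by
        rw [Matrix.mulVec_mulVec, hb.mul_inv, Matrix.one_mulVec]
      ext i
      rw [WithLp.ofLp_sum, Finset.sum_apply]
      conv_lhs => rw [e]
      simp only [Matrix.mulVec, dotProduct, WithLp.ofLp_smul, Pi.smul_apply, smul_eq_mul]
      exact Finset.sum_congr rfl fun j _ => mul_comm _ _
    rw [hv]
    refine Submodule.sum_mem _ fun j _ => ?_
    by_cases hj : (j : ℕ) + k < n
    · rw [h j hj, zero_smul]
      exact Submodule.zero_mem _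
    · exact Submodule.smul_mem _ _ (column_mem_lastColumns b (by omega))

lemma IsUnitriangular.isFlag {b : Matrix (Fin n) (Fin n) ℂ} (hb : IsUnitriangular b) {N : ℕ}
    (hN : n ≤ N) : IsFlag (lastColumns b) N := by
  refine ⟨lastColumns_mono b, ?_, ?_⟩
  · refine (Submodule.eq_bot_iff _).2 fun v hv => ?_
    rw [hb.mem_lastColumns_iff] at hv
    have h0 : b⁻¹ *ᵥ v.ofLp = 0 := funext fun j => hv j j.2
    have e : v.ofLp = b *ᵥ (b⁻¹ *ᵥ v.ofLp) := by
      rw [Matrix.mulVec_mulVec, hb.mul_inv, Matrix.one_mulVec]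
    rw [h0, Matrix.mulVec_zero] at e
    exact WithLp.ofLp_injective 2 e
  · refine (Submodule.eq_top_iff').2 fun v => hb.mem_lastColumns_iff.2 fun j hj => ?_
    omega

/-- The holomorphic factor in the Iwasawa decomposition of `b γ`: column `j` is
`Σ_k λ^{n-1-j-k} Q_k b_j`, where `Q_k b_j = 0` for `k > n - 1 - j`. -/
noncomputable def plusFactor (b : Matrix (Fin n) (Fin n) ℂ) (w : ℂ) : Matrix (Fin n) (Fin n) ℂ :=
  ∑ k ∈ Finset.range n, flagStep (lastColumns b) k * b *
    Matrix.diagonal fun j : Fin n => if k + j < n then w ^ (n - 1 - j - k) else 0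

lemma plusFactor_apply (b : Matrix (Fin n) (Fin n) ℂ) (w : ℂ) (i j : Fin n) :
    plusFactor b w i j = ∑ k ∈ Finset.range n, (flagStep (lastColumns b) k * b) i j *
      if k + j < n then w ^ (n - 1 - j - k) else 0 := by
  simp only [plusFactor, Matrix.sum_apply, Matrix.mul_diagonal]

lemma IsUnitriangular.step_mul_plusFactor {b : Matrix (Fin n) (Fin n) ℂ} (hb : IsUnitriangular b)
    {k : ℕ} (hk : k < n) (w : ℂ) : flagStep (lastColumns b) k * plusFactor b w =
      flagStep (lastColumns b) k * b *
        Matrix.diagonal fun j : Fin n => if k + j < n then w ^ (n - 1 - j - k) else 0 := by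
  have hf := hb.isFlag le_rfl
  rw [plusFactor, Finset.mul_sum, Finset.sum_eq_single k]
  · rw [← mul_assoc, ← mul_assoc, hf.step_mul_step, if_pos rfl]
  · intro p _ hp
    rw [← mul_assoc, ← mul_assoc, hf.step_mul_step, if_neg hp.symm, zero_mul, zero_mul]
  · intro h
    exact absurd (Finset.mem_range.2 hk) h

lemma proj_lastColumns_mul_apply (b : Matrix (Fin n) (Fin n) ℂ) {k : ℕ} (i : Fin n) {j : Fin n}
    (h : n ≤ j + k) : (proj (lastColumns b k) * b) i j = b i j :=
  congrFun (mem_iff_proj_mulVec.1 (column_mem_lastColumns b h)) i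

/-- The factor is injective at every point of the plane: if `v_j` is the first non-zero entry of
`v`, then `Q_{n-1-j}` maps the image of `v` to `v_j Q_{n-1-j} b_j`, and `Q_{n-1-j} b_j ≠ 0`. -/
lemma isUnit_plusFactor {b : Matrix (Fin n) (Fin n) ℂ} (hb : IsUnitriangular b) (w : ℂ) :
    IsUnit (plusFactor b w) := by
  rw [← Matrix.mulVec_injective_iff_isUnit]
  refine (injective_iff_map_eq_zero (Matrix.mulVecLin (plusFactor b w))).2 fun v hv => ?_
  rw [Matrix.mulVecLin_apply] at hv
  have key : ∀ d : ℕ, ∀ j : Fin n, (j : ℕ) = d → v j = 0 := by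
    intro d
    induction d using Nat.strong_induction_on with
    | _ d ih =>
    rintro j rfl
    have hj := j.2
    -- applying `Q_{n-1-j}` leaves only the term with `b_j`
    have h1 : (flagStep (lastColumns b) (n - 1 - j) * b) *ᵥ Pi.single j (v j) = 0 := by
      have h2 : flagStep (lastColumns b) (n - 1 - j) *ᵥ (plusFactor b w *ᵥ v) = 0 := by
        rw [hv, Matrix.mulVec_zero]
      rw [Matrix.mulVec_mulVec, hb.step_mul_plusFactor (by omega), ← Matrix.mulVec_mulVec] at h2
      rw [← h2]
      refine congrArg _ (funext fun i => ?_)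
      rw [Matrix.mulVec_diagonal]
      rcases lt_trichotomy i j with hij | hij | hij
      · rw [ih i (Fin.lt_def.1 hij) i rfl, mul_zero, Pi.single_eq_of_ne hij.ne]
      · subst hij
        rw [Pi.single_eq_same, if_pos (by omega), Nat.sub_self, pow_zero, one_mul]
      · rw [Pi.single_eq_of_ne hij.ne', if_neg (by rw [Fin.lt_def] at hij; omega), zero_mul]
    by_contra hne
    have h3 : ∀ i, (flagStep (lastColumns b) (n - 1 - j) * b) i j = 0 := by
      intro i
      have := congrFun h1 i
      rw [Matrix.mulVec_single] at this
      simpa [hne] using this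
    have hmem : (WithLp.toLp 2 fun i => b i j : EuclideanSpace ℂ (Fin n)) ∈
        lastColumns b (n - 1 - j) := by
      refine mem_iff_proj_mulVec.2 (funext fun i => ?_)
      have h4 := h3 i
      rw [flagStep, sub_mul, Matrix.sub_apply, proj_lastColumns_mul_apply b i (by omega)] at h4
      exact (sub_eq_zero.1 h4).symm
    have h5 := hb.mem_lastColumns_iff.1 hmem j (by omega)
    have e : (b⁻¹ *ᵥ fun i => b i j) j = (b⁻¹ * b) j j := rfl
    change (b⁻¹ *ᵥ fun i => b i j) j = 0 at h5
    rw [e, hb.inv_mul, Matrix.one_apply_eq] at h5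
    exact one_ne_zero h5
  funext j
  exact key j j rfl

/-- The Iwasawa factor of `b γ`, for constant unitriangular `b`, is the loop of the flag of the
spans of the last columns of `b`. -/
lemma IsUnitriangular.isIwasawaFactor {b : Matrix (Fin n) (Fin n) ℂ} (hb : IsUnitriangular b) :
    IsIwasawaFactor (fun l => b * geodesic (xiOne n) l)
      fun l => flagLoop (lastColumns b) n l := by
  have hf := hb.isFlag le_rfl
  have hsmooth : ∀ i j, ContDiff ℂ ∞ fun w => plusFactor b w i j := by
    intro i j
    simp only [plusFactor_apply]
    refine ContDiff.sum fun k _ => contDiff_const.mul ?_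
    split_ifs
    exacts [contDiff_id.pow _, contDiff_const]
  refine ⟨hf.isBasedLoop, fun l => plusFactor b l, ⟨fun i j => ?_, plusFactor b, fun i j => ?_,
    fun w _ => isUnit_plusFactor hb w, fun l => rfl⟩, fun l => ?_⟩
  · exact contMDiff_comp_coe_circle (f := fun w => plusFactor b w i j)
      ((hsmooth i j).restrict_scalars ℝ)
  · exact ((hsmooth i j).differentiable (by simp)).diffContOnCl
  · change b * geodesic (xiOne n) l = flagLoop (lastColumns b) n l * plusFactor b l
    rw [flagLoop, Finset.sum_mul]
    calc b * geodesic (xiOne n) l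
        = ∑ k ∈ Finset.range n, flagStep (lastColumns b) k * b * geodesic (xiOne n) l := by
          rw [← Finset.sum_mul, ← Finset.sum_mul, hf.sum_step_top, one_mul]
      _ = _ := by
          refine Finset.sum_congr rfl fun k hk => ?_
          rw [smul_mul_assoc, hb.step_mul_plusFactor (Finset.mem_range.1 hk)]
          ext i j
          have hj := j.2
          rw [mul_geodesic_apply, Matrix.smul_apply, Matrix.mul_diagonal, smul_eq_mul]
          by_cases hkj : k + j < n
          · rw [if_pos hkj, show xiOne n j = k + (n - 1 - j - k) by simp only [xiOne]; omega,
              pow_add]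
            ring
          · have : (flagStep (lastColumns b) k * b) i j = 0 := by
              rw [flagStep, sub_mul, Matrix.sub_apply, proj_lastColumns_mul_apply b i (by omega),
                proj_lastColumns_mul_apply b i (by omega), sub_self]
            rw [this]
            ring

end ConstIwasawa

/-! ### Holomorphic frames and their orthogonal projections -/

section Frames

variable {n k : ℕ}

/-- The matrix with columns `s_a`. -/
def frameMatrix (s : Fin k → EuclideanSpace ℂ (Fin n)) : Matrix (Fin n) (Fin k) ℂ :=
  Matrix.of fun i a => s a i

lemma frameMatrix_mulVec_mem (s : Fin k → EuclideanSpace ℂ (Fin n)) (u : Fin k → ℂ) :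
    WithLp.toLp 2 (frameMatrix s *ᵥ u) ∈ Submodule.span ℂ (Set.range s) := by
  have : (WithLp.toLp 2 (frameMatrix s *ᵥ u) : EuclideanSpace ℂ (Fin n)) = ∑ a, u a • s a := by
    ext i
    simp only [frameMatrix, Matrix.mulVec, dotProduct, Matrix.of_apply, WithLp.ofLp_sum,
      Finset.sum_apply, WithLp.ofLp_smul, Pi.smul_apply, smul_eq_mul]
    exact Finset.sum_congr rfl fun a _ => mul_comm _ _
  rw [this]
  exact Submodule.sum_mem _ fun a _ => Submodule.smul_mem _ _ (Submodule.subset_span ⟨a, rfl⟩)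

open scoped ComplexOrder in
lemma isUnit_gram {s : Fin k → EuclideanSpace ℂ (Fin n)} (hs : LinearIndependent ℂ s) :
    IsUnit ((frameMatrix s)ᴴ * frameMatrix s).det := by
  rw [← Matrix.isUnit_iff_isUnit_det]
  refine Matrix.PosDef.isUnit ?_
  refine Matrix.PosDef.conjTranspose_mul_self _ ?_
  rw [Matrix.mulVec_injective_iff]
  exact hs.map' (WithLp.linearEquiv 2 ℂ (Fin n → ℂ)).toLinearMap (LinearEquiv.ker _)

/-- The orthogonal projection onto the span of the linearly independent columns of `S` is
`S (Sᴴ S)⁻¹ Sᴴ`. -/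
lemma proj_span_eq {s : Fin k → EuclideanSpace ℂ (Fin n)} (hs : LinearIndependent ℂ s) :
    proj (Submodule.span ℂ (Set.range s)) =
      frameMatrix s * (((frameMatrix s)ᴴ * frameMatrix s)⁻¹ * (frameMatrix s)ᴴ) := by
  set S := frameMatrix s with hS
  have hu := isUnit_gram hs
  refine proj_eq_of ?_ (fun v hv => ?_) fun v => ?_
  · rw [Matrix.conjTranspose_mul, Matrix.conjTranspose_mul, Matrix.conjTranspose_conjTranspose,
      Matrix.conjTranspose_nonsing_inv, Matrix.conjTranspose_mul,
      Matrix.conjTranspose_conjTranspose, Matrix.mul_assoc]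
  · induction hv using Submodule.span_induction with
    | mem x hx =>
      obtain ⟨a, rfl⟩ := hx
      have e : (s a).ofLp = S *ᵥ Pi.single a 1 := by
        rw [Matrix.mulVec_single_one]
        rfl
      rw [e, Matrix.mulVec_mulVec, Matrix.mul_assoc, Matrix.mul_assoc, Matrix.nonsing_inv_mul _ hu,
        Matrix.mul_one]
    | zero => simp
    | add x y _ _ hx hy => rw [WithLp.ofLp_add, Matrix.mulVec_add, hx, hy]
    | smul c x _ hx => rw [WithLp.ofLp_smul, Matrix.mulVec_smul, hx]
  · rw [← Matrix.mulVec_mulVec]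
    exact frameMatrix_mulVec_mem s _

/-- The entries of `g` are smooth, in the real sense, at `w`. -/
def IsSmoothAt {ι κ : Type*} (g : ℂ → Matrix ι κ ℂ) (w : ℂ) : Prop :=
  ∀ i j, ContDiffAt ℝ ∞ (fun v => g v i j) w

section Smooth

variable {ι κ θ : Type*} {w : ℂ}

lemma IsSmoothAt.mul [Fintype κ] {g : ℂ → Matrix ι κ ℂ} {h : ℂ → Matrix κ θ ℂ} (hg : IsSmoothAt g w)
    (hh : IsSmoothAt h w) : IsSmoothAt (fun v => g v * h v) w := fun i j => by
  simp only [Matrix.mul_apply]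
  exact ContDiffAt.sum fun l _ => (hg i l).mul (hh l j)

lemma IsSmoothAt.conjTranspose {g : ℂ → Matrix ι κ ℂ} (hg : IsSmoothAt g w) :
    IsSmoothAt (fun v => (g v)ᴴ) w := fun i j => by
  change ContDiffAt ℝ ∞ (fun v => Complex.conjCLE (g v j i)) w
  exact ContDiffAt.comp w (Complex.conjCLE : ℂ →L[ℝ] ℂ).contDiff.contDiffAt (hg j i)

variable [Fintype κ] [DecidableEq κ]

lemma IsSmoothAt.det {g : ℂ → Matrix κ κ ℂ} (hg : IsSmoothAt g w) :
    ContDiffAt ℝ ∞ (fun v => (g v).det) w := by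
  simp only [Matrix.det_apply']
  exact ContDiffAt.sum fun σ _ => contDiffAt_const.mul (contDiffAt_prod fun i _ => hg _ _)

/-- Cramer's rule. -/
lemma IsSmoothAt.inv {g : ℂ → Matrix κ κ ℂ} (hg : IsSmoothAt g w) (hu : IsUnit (g w).det) :
    IsSmoothAt (fun v => (g v)⁻¹) w := by
  intro i j
  have hadj : ContDiffAt ℝ ∞ (fun v => (g v).adjugate i j) w := by
    simp only [Matrix.adjugate_apply]
    refine IsSmoothAt.det (g := fun v => (g v).updateRow j (Pi.single i 1)) fun k l => ?_
    by_cases hk : k = j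
    · subst hk
      simpa using contDiffAt_const
    · simpa [Matrix.updateRow_ne hk] using hg k l
  simp only [Matrix.inv_def, Matrix.smul_apply, smul_eq_mul, Ring.inverse_eq_inv']
  exact (hg.det.inv hu.ne_zero).mul hadj

end Smooth

lemma analyticAt_apply {s : ℂ → EuclideanSpace ℂ (Fin n)} {w : ℂ} (hs : AnalyticAt ℂ s w)
    (i : Fin n) : AnalyticAt ℂ (fun v => s v i) w :=
  ((EuclideanSpace.proj i : EuclideanSpace ℂ (Fin n) →L[ℂ] ℂ).analyticAt (s w)).comp hs

/-- The orthogonal projection onto the span of a holomorphic frame is smooth. -/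
lemma isSmoothAt_proj_span {s : Fin k → ℂ → EuclideanSpace ℂ (Fin n)} {w : ℂ}
    (hs : ∀ a, AnalyticAt ℂ (s a) w)
    (hi : ∀ᶠ v in 𝓝 w, LinearIndependent ℂ fun a => s a v) :
    IsSmoothAt (fun v => proj (Submodule.span ℂ (Set.range fun a => s a v))) w := by
  have hS : IsSmoothAt (fun v => frameMatrix fun a => s a v) w := fun i a =>
    ((analyticAt_apply (hs a) i).contDiffAt (n := ∞)).restrict_scalars ℝ
  have h := hS.mul (((hS.conjTranspose.mul hS).inv (isUnit_gram hi.self_of_nhds)).mul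
    hS.conjTranspose)
  intro i j
  refine (h i j).congr_of_eventuallyEq ?_
  filter_upwards [hi] with v hv
  exact congrFun (congrFun (proj_span_eq hv) i) j

lemma IsSmoothAt.continuousAt {g : ℂ → Matrix (Fin n) (Fin n) ℂ} {w : ℂ} (hg : IsSmoothAt g w) :
    ContinuousAt g w :=
  continuousAt_pi.2 fun i => continuousAt_pi.2 fun j => (hg i j).continuousAt

/-- Cramer's rule for `C C_f⁻¹`, where `C_f` consists of the rows of `C` with indices `f`. -/
lemma mul_inv_submatrix_apply (A : Matrix (Fin n) (Fin k) ℂ) (f : Fin k → Fin n) (i : Fin n)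
    (a : Fin k) : (A * (A.submatrix f id)⁻¹) i a =
      (A.submatrix (Function.update f a i) id).det / (A.submatrix f id).det := by
  have h1 : A.submatrix (Function.update f a i) id = (A.submatrix f id).updateRow a (A i) := by
    ext c d
    by_cases hc : c = a
    · subst hc
      simp
    · simp [Matrix.updateRow_ne hc, Function.update_of_ne hc]
  have h2 := Matrix.det_eq_sum_mul_adjugate_row ((A.submatrix f id).updateRow a (A i)) a
  simp only [Matrix.adjugate_apply, Matrix.updateRow_idem, Matrix.updateRow_self] at h2
  rw [h1, h2, Matrix.mul_apply, Finset.sum_div]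
  refine Finset.sum_congr rfl fun c _ => ?_
  rw [Matrix.inv_def, Matrix.smul_apply, smul_eq_mul, Ring.inverse_eq_inv', Matrix.adjugate_apply]
  ring

/-- The span of the columns of a meromorphic matrix of full rank extends holomorphically across
every point: multiplication by the inverse of a maximal minor of least order makes all entries
holomorphic and a block of rows the identity. -/
lemma exists_holomorphic_frame {A : ℂ → Matrix (Fin n) (Fin k) ℂ} {w : ℂ}
    (hA : ∀ i a, MeromorphicAt (fun v => A v i a) w) (f₀ : Fin k → Fin n)
    (hf₀ : ∀ᶠ v in 𝓝[≠] w, ((A v).submatrix f₀ id).det ≠ 0) :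
    ∃ s : Fin k → ℂ → EuclideanSpace ℂ (Fin n),
      (∀ a, AnalyticAt ℂ (s a) w) ∧
      (∀ᶠ v in 𝓝 w, LinearIndependent ℂ fun a => s a v) ∧
      ∀ᶠ v in 𝓝[≠] w, Submodule.span ℂ (Set.range fun a => s a v) =
        Submodule.span ℂ (Set.range fun a => (WithLp.toLp 2 fun i => A v i a :
          EuclideanSpace ℂ (Fin n))) := by
  have hdet : ∀ f : Fin k → Fin n, MeromorphicAt (fun v => ((A v).submatrix f id).det) w := by
    intro f
    simp only [Matrix.det_apply']
    exact MeromorphicAt.fun_sum fun σ _ =>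
      (MeromorphicAt.const _ _).mul (MeromorphicAt.fun_prod fun i _ => hA _ _)
  have : Nonempty (Fin k → Fin n) := ⟨f₀⟩
  -- `f` selects the rows of a minor of least order at `w`
  obtain ⟨f, hf⟩ := Finite.exists_min
    fun f : Fin k → Fin n => meromorphicOrderAt (fun v => ((A v).submatrix f id).det) w
  have hne₀ := (meromorphicOrderAt_ne_top_iff_eventually_ne_zero (hdet f₀)).2 hf₀
  have hne : meromorphicOrderAt (fun v => ((A v).submatrix f id).det) w ≠ ⊤ :=
    ne_top_of_le_ne_top hne₀ (hf f₀)
  have hfne := (meromorphicOrderAt_ne_top_iff_eventually_ne_zero (hdet f)).1 hne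
  let t : Fin n → Fin k → ℂ → ℂ := fun i a v =>
    ((A v).submatrix (Function.update f a i) id).det / ((A v).submatrix f id).det
  have ht : ∀ i a, MeromorphicAt (t i a) w := fun i a => (hdet _).div (hdet _)
  -- the entries of `A A_f⁻¹` are quotients of minors by the minor of least order
  have hord : ∀ i a, 0 ≤ meromorphicOrderAt (t i a) w := by
    intro i a
    have e : t i a = (fun v => ((A v).submatrix (Function.update f a i) id).det) /
      fun v => ((A v).submatrix f id).det := rfl
    rw [e, meromorphicOrderAt_div (hdet _) (hdet _)]
    have hle := hf (Function.update f a i)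
    obtain ⟨p, hp⟩ := WithTop.ne_top_iff_exists.1 hne
    rw [← hp] at hle ⊢
    generalize meromorphicOrderAt (fun v => ((A v).submatrix (Function.update f a i) id).det) w = o
      at hle ⊢
    induction o with
    | top => simp
    | coe q => exact_mod_cast sub_nonneg.2 (WithTop.coe_le_coe.1 hle)
  let T : Fin n → Fin k → ℂ → ℂ := fun i a => toMeromorphicNFAt (t i a) w
  have hT : ∀ i a, AnalyticAt ℂ (T i a) w := fun i a =>
    (ht i a).meromorphicOrderAt_nonneg_iff_analyticAt_toMeromorphicNFAt.1 (hord i a)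
  have hTt : ∀ᶠ v in 𝓝[≠] w, ∀ i a, T i a v = t i a v := by
    refine eventually_all.2 fun i => eventually_all.2 fun a => ?_
    filter_upwards [(ht i a).eq_nhdsNE_toMeromorphicNFAt] with v hv using hv.symm
  have hTA : ∀ᶠ v in 𝓝[≠] w, (Matrix.of fun i a => T i a v) = A v * ((A v).submatrix f id)⁻¹ := by
    filter_upwards [hTt] with v hv
    ext i a
    rw [Matrix.of_apply, hv, mul_inv_submatrix_apply]
  -- the rows selected by `f` form the identity matrix, at `w` as well, so that the columns stay
  -- independent at `w`
  have hblock : ∀ᶠ v in 𝓝[≠] w, ∀ c a, T (f c) a v = if c = a then 1 else 0 := by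
    filter_upwards [hTA, hfne] with v hv hv' c a
    have e1 : T (f c) a v = (A v * ((A v).submatrix f id)⁻¹) (f c) a := by rw [← hv]; rfl
    have e2 : (A v * ((A v).submatrix f id)⁻¹) (f c) a =
      ((A v).submatrix f id * ((A v).submatrix f id)⁻¹) c a := rfl
    rw [e1, e2, Matrix.mul_nonsing_inv _ (Ne.isUnit hv'), Matrix.one_apply]
  have hblock' : ∀ᶠ v in 𝓝 w, ∀ c a, T (f c) a v = if c = a then 1 else 0 := by
    have hw : ∀ c a, T (f c) a w = if c = a then 1 else 0 := fun c a =>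
      tendsto_nhds_unique_of_eventuallyEq
        ((hT (f c) a).continuousAt.tendsto.mono_left nhdsWithin_le_nhds) tendsto_const_nhds
        (hblock.mono fun v hv => hv c a)
    rw [eventually_nhdsWithin_iff] at hblock
    filter_upwards [hblock] with v hv
    by_cases h : v = w
    · rw [h]; exact hw
    · exact hv h
  refine ⟨fun a v => WithLp.toLp 2 fun i => T i a v, fun a => ?_, ?_, ?_⟩
  · have h1 : AnalyticAt ℂ (fun v => fun i => T i a v) w := AnalyticAt.pi fun i => hT i a
    exact ((PiLp.continuousLinearEquiv 2 ℂ fun _ : Fin n => ℂ).symm.toContinuousLinearMap.analyticAt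
      _).comp h1
  · filter_upwards [hblock'] with v hv
    rw [Fintype.linearIndependent_iff]
    intro g hg c
    have h1 := congrArg (fun x : EuclideanSpace ℂ (Fin n) => x (f c)) hg
    simpa [hv] using h1
  · filter_upwards [hTA, hfne] with v hv hv'
    set F : Fin k → EuclideanSpace ℂ (Fin n) := fun a => WithLp.toLp 2 fun i => T i a v
    set G : Fin k → EuclideanSpace ℂ (Fin n) := fun a => WithLp.toLp 2 fun i => A v i a
    have hF : frameMatrix F = frameMatrix G * ((A v).submatrix f id)⁻¹ := hv
    have hG : frameMatrix G = frameMatrix F * (A v).submatrix f id := by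
      rw [hF, Matrix.mul_assoc, Matrix.nonsing_inv_mul _ (Ne.isUnit hv'), Matrix.mul_one]
    have hle : ∀ (F G : Fin k → EuclideanSpace ℂ (Fin n)) (K : Matrix (Fin k) (Fin k) ℂ),
        frameMatrix F = frameMatrix G * K →
        Submodule.span ℂ (Set.range F) ≤ Submodule.span ℂ (Set.range G) := by
      intro F G K h
      refine Submodule.span_le.2 ?_
      rintro _ ⟨a, rfl⟩
      have e : F a = WithLp.toLp 2 (frameMatrix G *ᵥ (K *ᵥ Pi.single a 1)) := by
        rw [Matrix.mulVec_mulVec, ← h, Matrix.mulVec_single_one]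
        rfl
      rw [e]
      exact frameMatrix_mulVec_mem G _
    exact le_antisymm (hle F G _ hF) (hle G F _ hG)

end Frames

/-! ### The flag of subbundles defined by a meromorphic unitriangular matrix -/

lemma contMDiff_mul_complex {E H N : Type*} [NormedAddCommGroup E] [NormedSpace ℝ E]
    [TopologicalSpace H] {I : ModelWithCorners ℝ E H} [TopologicalSpace N] [ChartedSpace H N]
    {f g : N → ℂ} (hf : ContMDiff I 𝓘(ℝ, ℂ) ∞ f) (hg : ContMDiff I 𝓘(ℝ, ℂ) ∞ g) :
    ContMDiff I 𝓘(ℝ, ℂ) ∞ fun x => f x * g x :=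
  (contDiff_mul (𝕜 := ℝ) (𝔸 := ℂ)).contMDiff.comp (hf.prodMk_space hg)

section LimitFlag

variable {M : Type*} [TopologicalSpace M] {n k : ℕ}

lemma lastColumns_eq_span_range (b : Matrix (Fin n) (Fin n) ℂ) (hk : k ≤ n) :
    lastColumns b k = Submodule.span ℂ (Set.range fun a : Fin k =>
      (WithLp.toLp 2 fun i => b i ⟨n - k + a, by omega⟩ : EuclideanSpace ℂ (Fin n))) := by
  rw [lastColumns]
  congr 1
  ext v
  constructor
  · rintro ⟨j, hj, rfl⟩
    refine ⟨⟨j - (n - k), by omega⟩, ?_⟩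
    have : (⟨n - k + (j - (n - k)), by omega⟩ : Fin n) = j := Fin.ext (by simp; omega)
    simp only [this]
  · rintro ⟨a, rfl⟩
    exact ⟨⟨n - k + a, by omega⟩, by simp only; omega, rfl⟩

/-- The subspaces spanned by the last `k` columns of `b`, extended across the points where `b` has
poles or is not continuous: the value at `x` is the subspace whose orthogonal projection is the
limit at `x` of those onto the spans of the last columns, if the limit exists. -/
noncomputable def limitFlag (b : M → Matrix (Fin n) (Fin n) ℂ) (k : ℕ) (x : M) :
    Submodule ℂ (EuclideanSpace ℂ (Fin n)) :=
  Classical.epsilon fun V =>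
    Tendsto (fun y => proj (lastColumns (b y) k)) (𝓝[≠] x) (𝓝 (proj V))

variable {b : M → Matrix (Fin n) (Fin n) ℂ}

lemma tendsto_limitFlag_of {V : Submodule ℂ (EuclideanSpace ℂ (Fin n))} {x : M}
    (h : Tendsto (fun y => proj (lastColumns (b y) k)) (𝓝[≠] x) (𝓝 (proj V))) :
    Tendsto (fun y => proj (lastColumns (b y) k)) (𝓝[≠] x) (𝓝 (proj (limitFlag b k x))) :=
  Classical.epsilon_spec (p := fun V => Tendsto (fun y => proj (lastColumns (b y) k)) (𝓝[≠] x)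
    (𝓝 (proj V))) ⟨V, h⟩

/-- The extension depends only on the values of `b` off a closed discrete set. -/
lemma limitFlag_congr {b' : M → Matrix (Fin n) (Fin n) ℂ} (h : b =ᶠ[codiscrete M] b') :
    limitFlag b = limitFlag b' := by
  funext k x
  have h1 : ∀ V : Submodule ℂ (EuclideanSpace ℂ (Fin n)),
      Tendsto (fun y => proj (lastColumns (b y) k)) (𝓝[≠] x) (𝓝 (proj V)) ↔
      Tendsto (fun y => proj (lastColumns (b' y) k)) (𝓝[≠] x) (𝓝 (proj V)) := fun V => by
    refine tendsto_congr' ?_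
    filter_upwards [eventually_codiscrete_iff.1 h x] with y hy
    rw [hy]
  simp only [limitFlag, h1]

variable [ChartedSpace ℂ M]

lemma limitFlag_eq {V : Submodule ℂ (EuclideanSpace ℂ (Fin n))} {x : M}
    (h : Tendsto (fun y => proj (lastColumns (b y) k)) (𝓝[≠] x) (𝓝 (proj V))) :
    limitFlag b k x = V :=
  proj_injective (tendsto_nhds_unique (tendsto_limitFlag_of h) h)

/-- A function that is smooth in all charts of the complex atlas is smooth. -/
lemma contMDiff_of_charts {f : M → ℂ}
    (h : ∀ e ∈ atlas ℂ M, ∀ w ∈ e.target, ContDiffAt ℝ ∞ (fun v => f (e.symm v)) w) :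
    ContMDiff 𝓘(ℝ, ℂ) 𝓘(ℝ, ℂ) ∞ f := by
  intro x
  rw [contMDiffAt_iff_source]
  have h1 := h _ (chart_mem_atlas ℂ x) _ (mem_chart_target ℂ x)
  have h2 : ContMDiffAt 𝓘(ℝ, ℂ) 𝓘(ℝ, ℂ) ∞ (fun v => f ((chartAt ℂ x).symm v)) (chartAt ℂ x x) :=
    h1.contMDiffAt
  simpa [Function.comp_def] using h2.contMDiffWithinAt (s := Set.univ)

variable [IsManifold 𝓘(ℂ, ℂ) ω M] {e : OpenPartialHomeomorph M ℂ} {w : ℂ}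

/-- In a chart, the extended spans of the last columns have a holomorphic frame near each point. -/
lemma exists_frame_limitFlag (hb : ∀ i j, IsMeromorphic fun x => b x i j)
    (hu : ∀ x, IsUnitriangular (b x)) (hk : k ≤ n) (he : e ∈ atlas ℂ M) (hw : w ∈ e.target) :
    ∃ s : Fin k → ℂ → EuclideanSpace ℂ (Fin n),
      (∀ a, AnalyticAt ℂ (s a) w) ∧
      (∀ᶠ v in 𝓝 w, LinearIndependent ℂ (fun a => s a v) ∧
        limitFlag b k (e.symm v) = Submodule.span ℂ (Set.range fun a => s a v)) ∧
      ∀ᶠ v in 𝓝[≠] w, limitFlag b k (e.symm v) = lastColumns (b (e.symm v)) k := by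
  obtain ⟨s, hs, hi, hspan⟩ := exists_holomorphic_frame (w := w)
    (A := fun v => Matrix.of fun i (a : Fin k) => b (e.symm v) i ⟨n - k + a, by omega⟩)
    (fun i a => (hb i ⟨n - k + a, by omega⟩).meromorphicAt he hw)
    (fun a => ⟨n - k + a, by omega⟩) (Eventually.of_forall fun v => by
      have h1 : IsUnitriangular ((Matrix.of fun i (a : Fin k) =>
          b (e.symm v) i ⟨n - k + a, by omega⟩).submatrix
          (fun a : Fin k => (⟨n - k + a, by omega⟩ : Fin n)) id) := by
        intro i j hij
        have h2 := hu (e.symm v) ⟨n - k + i, by omega⟩ ⟨n - k + j, by omega⟩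
          (Fin.mk_le_mk.2 (Nat.add_le_add_left hij _))
        refine h2.trans ?_
        simp [Fin.ext_iff]
      rw [h1.det_eq_one]
      exact one_ne_zero)
  have hspan' : ∀ᶠ v in 𝓝[≠] w, lastColumns (b (e.symm v)) k =
      Submodule.span ℂ (Set.range fun a => s a v) := by
    filter_upwards [hspan] with v hv
    rw [hv, lastColumns_eq_span_range _ hk]
    rfl
  -- the limit is taken at all points near `w`, not only at `w`
  have hnear : ∀ᶠ v in 𝓝 w, ∀ᶠ u in 𝓝[≠] v, lastColumns (b (e.symm u)) k =
      Submodule.span ℂ (Set.range fun a => s a u) := by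
    have h1 := eventually_eventually_nhdsWithin.2 hspan'
    rw [eventually_nhdsWithin_iff] at h1
    filter_upwards [h1] with v hv
    by_cases hvw : v = w
    · rwa [hvw]
    · have := hv hvw
      rw [isOpen_compl_singleton.nhdsWithin_eq (show v ∈ ({w}ᶜ : Set ℂ) from hvw)] at this
      exact nhdsWithin_le_nhds this
  have hlim : ∀ᶠ v in 𝓝 w,
      limitFlag b k (e.symm v) = Submodule.span ℂ (Set.range fun a => s a v) := by
    filter_upwards [hnear, eventually_all.2 fun a => (hs a).eventually_analyticAt,
      eventually_eventually_nhds.2 hi, e.open_target.mem_nhds hw] with v h1 h2 h3 h4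
    refine limitFlag_eq ?_
    have h5 : Tendsto (fun u => proj (Submodule.span ℂ (Set.range fun a => s a u))) (𝓝[≠] v)
        (𝓝 (proj (Submodule.span ℂ (Set.range fun a => s a v)))) :=
      (isSmoothAt_proj_span h2 h3).continuousAt.tendsto.mono_left nhdsWithin_le_nhds
    have h6 : Tendsto (fun u => proj (lastColumns (b (e.symm u)) k)) (𝓝[≠] v)
        (𝓝 (proj (Submodule.span ℂ (Set.range fun a => s a v)))) := by
      refine h5.congr' ?_
      filter_upwards [h1] with u hu
      rw [hu]
    have h7 := tendsto_chart_nhdsNE e (e.map_target h4)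
    rw [e.right_inv h4] at h7
    refine (h6.comp h7).congr' ?_
    filter_upwards [nhdsWithin_le_nhds (e.open_source.mem_nhds (e.map_target h4))] with y hy
    simp [e.left_inv hy]
  refine ⟨s, hs, hi.and hlim, ?_⟩
  filter_upwards [nhdsWithin_le_nhds hlim, hspan'] with v h1 h2
  rw [h1, h2]

lemma tendsto_limitFlag (hb : ∀ i j, IsMeromorphic fun x => b x i j)
    (hu : ∀ x, IsUnitriangular (b x)) (k : ℕ) (x : M) :
    Tendsto (fun y => proj (lastColumns (b y) k)) (𝓝[≠] x) (𝓝 (proj (limitFlag b k x))) := by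
  rcases le_or_gt k n with hk | hk
  · have hx := mem_chart_source ℂ x
    have hw := mem_chart_target ℂ x
    obtain ⟨s, hs, h1, h2⟩ := exists_frame_limitFlag hb hu hk (chart_mem_atlas ℂ x) hw
    have h3 : Tendsto (fun v => proj (Submodule.span ℂ (Set.range fun a => s a v)))
        (𝓝[≠] (chartAt ℂ x x)) (𝓝 (proj (Submodule.span ℂ (Set.range fun a =>
          s a (chartAt ℂ x x))))) :=
      (isSmoothAt_proj_span hs (h1.mono fun _ h => h.1)).continuousAt.tendsto.mono_left
        nhdsWithin_le_nhds
    have h4 : Tendsto (fun v => proj (lastColumns (b ((chartAt ℂ x).symm v)) k))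
        (𝓝[≠] (chartAt ℂ x x)) (𝓝 (proj (Submodule.span ℂ (Set.range fun a =>
          s a (chartAt ℂ x x))))) := by
      refine h3.congr' ?_
      filter_upwards [nhdsWithin_le_nhds h1, h2] with v hv hv'
      rw [← hv', hv.2]
    refine tendsto_limitFlag_of ((h4.comp (tendsto_chart_nhdsNE _ hx)).congr' ?_)
    filter_upwards [nhdsWithin_le_nhds ((chartAt ℂ x).open_source.mem_nhds hx)] with y hy
    simp [(chartAt ℂ x).left_inv hy]
  · refine tendsto_limitFlag_of (V := ⊤) ?_
    have : ∀ y, lastColumns (b y) k = ⊤ := fun y => ((hu y).isFlag hk.le).top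
    simp only [this]
    exact tendsto_const_nhds

/-- Inclusions are identities between projections and pass to the limit. -/
lemma isFlag_limitFlag (hb : ∀ i j, IsMeromorphic fun x => b x i j)
    (hu : ∀ x, IsUnitriangular (b x)) (x : M) : IsFlag (fun k => limitFlag b k x) n where
  mono k l hkl := by
    refine le_of_proj_mul_proj (tendsto_nhds_unique
      ((tendsto_limitFlag hb hu l x).mul (tendsto_limitFlag hb hu k x)) ?_)
    refine (tendsto_limitFlag hb hu k x).congr fun y => ?_
    rw [proj_mul_proj_of_le (lastColumns_mono _ hkl)]
  zero := by
    refine limitFlag_eq ?_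
    have : ∀ y, lastColumns (b y) 0 = ⊥ := fun y => ((hu y).isFlag le_rfl).zero
    simp only [this]
    exact tendsto_const_nhds
  top := by
    refine limitFlag_eq ?_
    have : ∀ y, lastColumns (b y) n = ⊤ := fun y => ((hu y).isFlag le_rfl).top
    simp only [this]
    exact tendsto_const_nhds

lemma eventually_limitFlag_eq (hb : ∀ i j, IsMeromorphic fun x => b x i j)
    (hu : ∀ x, IsUnitriangular (b x)) (k : ℕ) :
    ∀ᶠ x in codiscrete M, limitFlag b k x = lastColumns (b x) k := by
  refine eventually_codiscrete_iff.2 fun x => ?_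
  rcases le_or_gt k n with hk | hk
  · obtain ⟨s, -, -, h2⟩ := exists_frame_limitFlag hb hu hk (chart_mem_atlas ℂ x)
      (mem_chart_target ℂ x)
    have := (eventually_chart_iff (p := fun y => limitFlag b k y = lastColumns (b y) k) _
      (mem_chart_target ℂ x)).1 h2
    rwa [(chartAt ℂ x).left_inv (mem_chart_source ℂ x)] at this
  · refine Eventually.of_forall fun y => ?_
    rw [((hu y).isFlag hk.le).top, ← top_le_iff, ← (isFlag_limitFlag hb hu y).top]
    exact (isFlag_limitFlag hb hu y).mono hk.le

/-- Only finitely many of the spans differ from the whole space, so the exceptional sets have a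
closed discrete union. -/
lemma eventually_forall_limitFlag_eq (hb : ∀ i j, IsMeromorphic fun x => b x i j)
    (hu : ∀ x, IsUnitriangular (b x)) :
    ∀ᶠ x in codiscrete M, ∀ k, limitFlag b k x = lastColumns (b x) k := by
  have h : ∀ᶠ x in codiscrete M, ∀ k : Fin (n + 1), limitFlag b k x = lastColumns (b x) k :=
    eventually_all.2 fun k => eventually_limitFlag_eq hb hu k
  filter_upwards [h] with x hx k
  rcases le_or_gt k n with hk | hk
  · exact hx ⟨k, by omega⟩
  · rw [((hu x).isFlag hk.le).top, ← top_le_iff, ← (isFlag_limitFlag hb hu x).top]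
    exact (isFlag_limitFlag hb hu x).mono hk.le

/-- The extended spans of the last columns form a holomorphic subbundle. -/
lemma isHolSubbundle_limitFlag (hb : ∀ i j, IsMeromorphic fun x => b x i j)
    (hu : ∀ x, IsUnitriangular (b x)) (hk : k ≤ n) : IsHolSubbundle k (limitFlag b k) := by
  intro x
  set e := chartAt ℂ x with he
  have hea := chart_mem_atlas ℂ x
  have hx : x ∈ e.source := mem_chart_source ℂ x
  obtain ⟨s, hs, h1, -⟩ := exists_frame_limitFlag hb hu hk hea (mem_chart_target ℂ x)
  have h2 : ∀ᶠ v in 𝓝 (e x), (∀ a, AnalyticAt ℂ (s a) v) ∧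
      LinearIndependent ℂ (fun a => s a v) ∧
      limitFlag b k (e.symm v) = Submodule.span ℂ (Set.range fun a => s a v) := by
    filter_upwards [eventually_all.2 fun a => (hs a).eventually_analyticAt, h1] with v h h'
    exact ⟨h, h'⟩
  obtain ⟨V, hV, hVo, hxV⟩ := eventually_nhds_iff.1 h2
  refine ⟨e.source ∩ e ⁻¹' V, e.isOpen_inter_preimage hVo, ⟨hx, hxV⟩, fun a y => s a (e y),
    fun a y hy => ?_, fun y hy => ?_⟩
  · have hd : MDifferentiableAt 𝓘(ℂ, ℂ) 𝓘(ℂ, EuclideanSpace ℂ (Fin n)) (s a) (e y) :=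
      ((hV _ hy.2).1 a).differentiableAt.mdifferentiableAt
    have h1 : IsManifold 𝓘(ℂ, ℂ) 1 M := IsManifold.of_le (n := ω) le_top
    have hm : MDifferentiableAt 𝓘(ℂ, ℂ) 𝓘(ℂ, ℂ) e y := mdifferentiableAt_atlas hea hy.1
    exact (hd.comp y hm).mdifferentiableWithinAt
  · have := (hV _ hy.2).2
    rwa [e.left_inv hy.1] at this

/-- In charts, the projections onto the subspaces of the flag are smooth. -/
lemma isSmoothAt_proj_limitFlag (hb : ∀ i j, IsMeromorphic fun x => b x i j)
    (hu : ∀ x, IsUnitriangular (b x)) (k : ℕ) (he : e ∈ atlas ℂ M) (hw : w ∈ e.target) :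
    IsSmoothAt (fun v => proj (limitFlag b k (e.symm v))) w := by
  rcases le_or_gt k n with hk | hk
  · obtain ⟨s, hs, h1, -⟩ := exists_frame_limitFlag hb hu hk he hw
    have h := isSmoothAt_proj_span hs (h1.mono fun _ h => h.1)
    intro i j
    refine (h i j).congr_of_eventuallyEq ?_
    filter_upwards [h1] with v hv
    simp only [hv.2]
  · have : ∀ y, limitFlag b k y = ⊤ := fun y => by
      rw [← top_le_iff, ← (isFlag_limitFlag hb hu y).top]
      exact (isFlag_limitFlag hb hu y).mono hk.le
    simp only [this]
    exact fun i j => contDiffAt_const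

lemma contMDiff_flagStep (hb : ∀ i j, IsMeromorphic fun x => b x i j)
    (hu : ∀ x, IsUnitriangular (b x)) (k : ℕ) (i j : Fin n) :
    ContMDiff 𝓘(ℝ, ℂ) 𝓘(ℝ, ℂ) ∞ fun x => flagStep (fun k => limitFlag b k x) k i j :=
  contMDiff_of_charts fun _ he _ hw =>
    (isSmoothAt_proj_limitFlag hb hu (k + 1) he hw i j).sub
      (isSmoothAt_proj_limitFlag hb hu k he hw i j)

lemma contMDiff_flagLoop_apply (hb : ∀ i j, IsMeromorphic fun x => b x i j)
    (hu : ∀ x, IsUnitriangular (b x)) (N : ℕ) (z : ℂ) (i j : Fin n) :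
    ContMDiff 𝓘(ℝ, ℂ) 𝓘(ℝ, ℂ) ∞ fun x => flagLoop (fun k => limitFlag b k x) N z i j := by
  simp only [flagLoop_apply]
  refine ContMDiff.sum fun k _ => ?_
  exact contMDiff_mul_complex (contMDiff_const (c := z ^ k)) (contMDiff_flagStep hb hu k i j)

/-- The loops of the flag depend smoothly on the point and the loop parameter together. -/
lemma contMDiff_flagLoop (hb : ∀ i j, IsMeromorphic fun x => b x i j)
    (hu : ∀ x, IsUnitriangular (b x)) (N : ℕ) (i j : Fin n) :
    ContMDiff (𝓘(ℝ, ℂ).prod (𝓡 1)) 𝓘(ℝ, ℂ) ∞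
      fun p : M × Circle => flagLoop (fun k => limitFlag b k p.1) N p.2 i j := by
  simp only [flagLoop_apply]
  refine ContMDiff.sum fun k _ => ?_
  have h1 : ContMDiff (𝓘(ℝ, ℂ).prod (𝓡 1)) 𝓘(ℝ, ℂ) ∞ fun p : M × Circle => (p.2 : ℂ) ^ k :=
    (contMDiff_comp_coe_circle (f := fun z => z ^ k) (contDiff_id.pow k)).comp contMDiff_snd
  exact contMDiff_mul_complex h1 ((contMDiff_flagStep hb hu k i j).comp contMDiff_fst)

end LimitFlag

/-! ### Wirtinger derivatives -/

section Wirtinger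

/-- `(1/2) (∂/∂x + c ∂/∂y)`: this is `∂/∂z` for `c = -i` and `∂/∂z̄` for `c = i`. -/
noncomputable def wirtinger (c : ℂ) (f : ℂ → ℂ) (w : ℂ) : ℂ :=
  (1 / 2 : ℂ) * (fderiv ℝ f w 1 + c * fderiv ℝ f w Complex.I)

/-- The operator `wirtinger`, entry by entry. -/
noncomputable def wirtingerMatrix {ι κ : Type*} (c : ℂ) (g : ℂ → Matrix ι κ ℂ) (w : ℂ) :
    Matrix ι κ ℂ := Matrix.of fun i j => wirtinger c (fun v => g v i j) w

lemma dz_eq {n : ℕ} (g : ℂ → Matrix (Fin n) (Fin n) ℂ) :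
    dz g = wirtingerMatrix (-Complex.I) g := by
  funext w
  ext i j
  simp only [dz, wirtingerMatrix, wirtinger, Matrix.of_apply]
  ring

lemma dzbar_eq {n : ℕ} (g : ℂ → Matrix (Fin n) (Fin n) ℂ) :
    dzbar g = wirtingerMatrix Complex.I g := rfl

variable {c : ℂ} {f g : ℂ → ℂ} {w : ℂ}

lemma wirtinger_congr (h : f =ᶠ[𝓝 w] g) : wirtinger c f w = wirtinger c g w := by
  rw [wirtinger, wirtinger, h.fderiv_eq]

lemma wirtinger_const (a : ℂ) : wirtinger c (fun _ => a) w = 0 := by simp [wirtinger]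

lemma wirtinger_mul (hf : DifferentiableAt ℝ f w) (hg : DifferentiableAt ℝ g w) :
    wirtinger c (fun v => f v * g v) w = wirtinger c f w * g w + f w * wirtinger c g w := by
  simp only [wirtinger, fderiv_fun_mul hf hg, add_apply,
    smul_apply, smul_eq_mul]
  ring

lemma wirtinger_sum {ι : Type*} {s : Finset ι} {F : ι → ℂ → ℂ}
    (h : ∀ i ∈ s, DifferentiableAt ℝ (F i) w) :
    wirtinger c (fun v => ∑ i ∈ s, F i v) w = ∑ i ∈ s, wirtinger c (F i) w := by
  simp only [wirtinger, fderiv_fun_sum h, sum_apply, Finset.mul_sum,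
    ← Finset.sum_add_distrib]

/-- For holomorphic `f` this gives `f'` if `c = -i`, and the Cauchy–Riemann equation if `c = i`. -/
lemma wirtinger_holomorphic (hf : DifferentiableAt ℂ f w) :
    wirtinger c f w = (1 / 2 : ℂ) * (1 + c * Complex.I) * deriv f w := by
  have h : ∀ a, fderiv ℝ f w a = a * deriv f w := fun a => by
    rw [hf.fderiv_restrictScalars ℝ]
    simp
  rw [wirtinger, h, h]
  ring

lemma wirtinger_conj (hf : DifferentiableAt ℝ f w) :
    wirtinger c (fun v => star (f v)) w = star (wirtinger (star c) f w) := by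
  have h : ∀ a, fderiv ℝ (fun v => star (f v)) w a = star (fderiv ℝ f w a) := fun a => by
    have := ((Complex.conjCLE : ℂ →L[ℝ] ℂ).hasFDerivAt.comp w hf.hasFDerivAt).fderiv
    exact congrArg (fun L : ℂ →L[ℝ] ℂ => L a) this
  simp only [wirtinger, h, star_mul', star_add, star_star]
  simp

lemma fderiv_fderiv_apply (hf : ContDiffAt ℝ ∞ f w) (a u : ℂ) :
    fderiv ℝ (fun v => fderiv ℝ f v a) w u = fderiv ℝ (fderiv ℝ f) w u a := by
  have hd : DifferentiableAt ℝ (fderiv ℝ f) w :=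
    (hf.fderiv_right (m := 1) (by norm_cast)).differentiableAt one_ne_zero
  rw [(hd.hasFDerivAt.clm_apply (hasFDerivAt_const a w)).fderiv]
  simp

lemma contDiffAt_wirtinger (hf : ContDiffAt ℝ ∞ f w) : ContDiffAt ℝ ∞ (wirtinger c f) w := by
  have h : ContDiffAt ℝ ∞ (fderiv ℝ f) w := hf.fderiv_right (by norm_cast)
  exact contDiffAt_const.mul ((h.clm_apply contDiffAt_const).add
    (contDiffAt_const.mul (h.clm_apply contDiffAt_const)))

/-- Symmetry of second derivatives. -/
lemma wirtinger_comm (hf : ContDiffAt ℝ ∞ f w) (d : ℂ) :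
    wirtinger c (wirtinger d f) w = wirtinger d (wirtinger c f) w := by
  have hsym : IsSymmSndFDerivAt ℝ f w := hf.isSymmSndFDerivAt (by simp; norm_cast)
  have hd : ∀ a, DifferentiableAt ℝ (fun v => fderiv ℝ f v a) w := fun a =>
    ((hf.fderiv_right (m := 1) (by norm_cast)).differentiableAt one_ne_zero).clm_apply
      (differentiableAt_const a)
  have h : ∀ d u, fderiv ℝ (wirtinger d f) w u =
      (1 / 2 : ℂ) * (fderiv ℝ (fderiv ℝ f) w u 1 + d * fderiv ℝ (fderiv ℝ f) w u Complex.I) := by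
    intro d u
    have e : wirtinger d f =
      fun v => (1 / 2 : ℂ) * (fderiv ℝ f v 1 + d * fderiv ℝ f v Complex.I) := rfl
    rw [e, fderiv_const_mul ((hd _).fun_add ((hd _).const_mul d)), fderiv_fun_add (hd _)
      ((hd _).const_mul d), fderiv_const_mul (hd _)]
    simp only [smul_apply, add_apply, smul_eq_mul,
      fderiv_fderiv_apply hf]
  rw [wirtinger.eq_def c, wirtinger.eq_def d, h, h, h, h, hsym.eq 1 Complex.I]
  ring

variable {ι κ θ : Type*} {G H : ℂ → Matrix ι κ ℂ}

lemma wirtingerMatrix_congr (h : G =ᶠ[𝓝 w] H) :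
    wirtingerMatrix c G w = wirtingerMatrix c H w := by
  ext i j
  exact wirtinger_congr (h.mono fun v hv => congrFun (congrFun hv i) j)

lemma IsSmoothAt.differentiableAt (hG : IsSmoothAt G w) (i : ι) (j : κ) :
    DifferentiableAt ℝ (fun v => G v i j) w := (hG i j).differentiableAt (by simp)

lemma IsSmoothAt.wirtingerMatrix (hG : IsSmoothAt G w) :
    IsSmoothAt (HarmonicOn.wirtingerMatrix c G) w := fun i j => contDiffAt_wirtinger (hG i j)

lemma wirtingerMatrix_mul [Fintype κ] {K : ℂ → Matrix κ θ ℂ} (hG : IsSmoothAt G w)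
    (hK : IsSmoothAt K w) : wirtingerMatrix c (fun v => G v * K v) w =
      wirtingerMatrix c G w * K w + G w * wirtingerMatrix c K w := by
  ext i j
  simp only [wirtingerMatrix, Matrix.of_apply, Matrix.mul_apply, Matrix.add_apply]
  rw [wirtinger_sum fun l _ => (hG.differentiableAt i l).fun_mul (hK.differentiableAt l j),
    ← Finset.sum_add_distrib]
  exact Finset.sum_congr rfl fun l _ =>
    wirtinger_mul (hG.differentiableAt i l) (hK.differentiableAt l j)

lemma wirtingerMatrix_const (A : Matrix ι κ ℂ) : wirtingerMatrix c (fun _ => A) w = 0 := by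
  ext i j
  exact wirtinger_const _

lemma wirtingerMatrix_smul (a : ℂ) (hG : IsSmoothAt G w) :
    wirtingerMatrix c (fun v => a • G v) w = a • wirtingerMatrix c G w := by
  ext i j
  simp only [wirtingerMatrix, Matrix.of_apply, Matrix.smul_apply, smul_eq_mul]
  rw [wirtinger_mul (differentiableAt_const a) (hG.differentiableAt i j), wirtinger_const,
    zero_mul, zero_add]

lemma wirtingerMatrix_sum {s : Finset θ} {F : θ → ℂ → Matrix ι κ ℂ}
    (h : ∀ k ∈ s, IsSmoothAt (F k) w) :
    wirtingerMatrix c (fun v => ∑ k ∈ s, F k v) w = ∑ k ∈ s, wirtingerMatrix c (F k) w := by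
  ext i j
  simp only [wirtingerMatrix, Matrix.of_apply, Matrix.sum_apply]
  exact wirtinger_sum fun k hk => (h k hk).differentiableAt i j

lemma wirtingerMatrix_const_add (A : Matrix ι κ ℂ) :
    wirtingerMatrix c (fun v => A + G v) w = wirtingerMatrix c G w := by
  ext i j
  simp [wirtingerMatrix, wirtinger]

lemma wirtingerMatrix_conjTranspose (hG : IsSmoothAt G w) :
    wirtingerMatrix c (fun v => (G v)ᴴ) w = (wirtingerMatrix (star c) G w)ᴴ := by
  ext i j
  exact wirtinger_conj (hG.differentiableAt j i)

lemma wirtingerMatrix_comm (hG : IsSmoothAt G w) (d : ℂ) :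
    wirtingerMatrix c (wirtingerMatrix d G) w = wirtingerMatrix d (wirtingerMatrix c G) w := by
  ext i j
  exact wirtinger_comm (hG i j) d

lemma IsSmoothAt.sum {s : Finset θ} {F : θ → ℂ → Matrix ι κ ℂ}
    (h : ∀ k ∈ s, IsSmoothAt (F k) w) : IsSmoothAt (fun v => ∑ k ∈ s, F k v) w := fun i j => by
  simp only [Matrix.sum_apply]
  exact ContDiffAt.sum fun k hk => h k hk i j

lemma IsSmoothAt.const_smul (a : ℂ) (hG : IsSmoothAt G w) : IsSmoothAt (fun v => a • G v) w :=
  fun i j => contDiffAt_const.mul (hG i j)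

end Wirtinger

/-! ### Flags of holomorphic subbundles and the extended solution equation -/

section FlagDerivative

variable {n : ℕ} {w : ℂ}

/-- Cauchy–Riemann equations for the span of a holomorphic frame, in terms of its orthogonal
projection `P`: `P_z̄ P = 0`. -/
lemma dzbar_proj_span_mul {k : ℕ} {s : Fin k → ℂ → EuclideanSpace ℂ (Fin n)}
    (hs : ∀ a, AnalyticAt ℂ (s a) w)
    (hi : ∀ᶠ v in 𝓝 w, LinearIndependent ℂ fun a => s a v) :
    dzbar (fun v => proj (Submodule.span ℂ (Set.range fun a => s a v))) w *
      proj (Submodule.span ℂ (Set.range fun a => s a w)) = 0 := by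
  set P := fun v => proj (Submodule.span ℂ (Set.range fun a => s a v)) with hP
  have hsm : IsSmoothAt P w := isSmoothAt_proj_span hs hi
  have hcol : ∀ a, dzbar P w *ᵥ (s a w).ofLp = 0 := by
    intro a
    funext i
    have h1 : (fun v => ∑ j, P v i j * s a v j) =ᶠ[𝓝 w] fun v => s a v i :=
      Eventually.of_forall fun v =>
        congrFun (mem_iff_proj_mulVec.1
          (Submodule.subset_span (Set.mem_range_self (f := fun a => s a v) a))) i
    have hd : ∀ j, DifferentiableAt ℂ (fun v => s a v j) w := fun j =>
      (analyticAt_apply (hs a) j).differentiableAt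
    have h0 : ∀ j, wirtinger Complex.I (fun v => s a v j) w = 0 := fun j => by
      rw [wirtinger_holomorphic (hd j), Complex.I_mul_I]
      ring
    have h2 := wirtinger_congr (c := Complex.I) h1
    rw [h0, wirtinger_sum fun j _ => (hsm.differentiableAt i j).fun_mul
      ((hd j).restrictScalars ℝ)] at h2
    rw [Pi.zero_apply, ← h2]
    change ∑ j, dzbar P w i j * s a w j = _
    refine Finset.sum_congr rfl fun j _ => ?_
    rw [wirtinger_mul (hsm.differentiableAt i j) ((hd j).restrictScalars ℝ), h0, mul_zero, add_zero]
    rfl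
  have hker : ∀ x ∈ Submodule.span ℂ (Set.range fun a => s a w), dzbar P w *ᵥ x.ofLp = 0 := by
    intro x hx
    induction hx using Submodule.span_induction with
    | mem x hx =>
      obtain ⟨a, rfl⟩ := hx
      exact hcol a
    | zero => simp
    | add x y _ _ hx hy => rw [WithLp.ofLp_add, Matrix.mulVec_add, hx, hy, add_zero]
    | smul c x _ hx => rw [WithLp.ofLp_smul, Matrix.mulVec_smul, hx, smul_zero]
  refine matrix_ext_mulVec fun v => ?_
  rw [← Matrix.mulVec_mulVec, Matrix.zero_mulVec]
  exact hker _ (proj_mulVec_mem _ v)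

variable {α : ℕ → ℂ → Submodule ℂ (EuclideanSpace ℂ (Fin n))} {k N : ℕ}

lemma dz_conjTranspose {g : ℂ → Matrix (Fin n) (Fin n) ℂ} (hg : IsSmoothAt g w) :
    (dzbar g w)ᴴ = dz (fun v => (g v)ᴴ) w := by
  rw [dz_eq, wirtingerMatrix_conjTranspose hg, dzbar_eq]
  simp

lemma dz_proj_conjTranspose (hs : IsSmoothAt (fun v => proj (α k v)) w) :
    (dz (fun v => proj (α k v)) w)ᴴ = dzbar (fun v => proj (α k v)) w := by
  have h := dz_conjTranspose hs
  simp only [proj_conjTranspose] at h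
  rw [← h, Matrix.conjTranspose_conjTranspose]

/-- The adjoint of `P_z̄ P = 0`. -/
lemma proj_mul_dz_proj (hs : IsSmoothAt (fun v => proj (α k v)) w)
    (hol : dzbar (fun v => proj (α k v)) w * proj (α k w) = 0) :
    proj (α k w) * dz (fun v => proj (α k v)) w = 0 := by
  have h := congrArg Matrix.conjTranspose hol
  rwa [Matrix.conjTranspose_mul, proj_conjTranspose, ← dz_proj_conjTranspose hs,
    Matrix.conjTranspose_conjTranspose, Matrix.conjTranspose_zero] at h

/-- The derivative of `P² = P`, given that `P P_z = 0`. -/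
lemma dz_proj_mul_proj (hs : IsSmoothAt (fun v => proj (α k v)) w)
    (hol : dzbar (fun v => proj (α k v)) w * proj (α k w) = 0) :
    dz (fun v => proj (α k v)) w * proj (α k w) = dz (fun v => proj (α k v)) w := by
  have h := wirtingerMatrix_mul (c := -Complex.I) hs hs
  simp only [proj_mul_self] at h
  rw [← dz_eq, proj_mul_dz_proj hs hol, add_zero] at h
  exact h.symm

/-- Summation by parts. -/
lemma IsFlag.loop_eq {α : ℕ → Submodule ℂ (EuclideanSpace ℂ (Fin n))} (h : IsFlag α N) {z : ℂ}
    (hz : z ≠ 0) : flagLoop α N z = (z⁻¹ * z ^ N) • (1 : Matrix (Fin n) (Fin n) ℂ) +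
      (z⁻¹ - 1) • ∑ k ∈ Finset.range N, z ^ k • proj (α k) := by
  have key : ∀ s, z • flagLoop α s z = z ^ s • proj (α s) +
      (1 - z) • ∑ k ∈ Finset.range s, z ^ k • proj (α k) := by
    intro s
    induction s with
    | zero => simp [flagLoop, h.zero, proj_bot]
    | succ s ih =>
      have e : flagLoop α (s + 1) z = flagLoop α s z + z ^ s • flagStep α s :=
        Finset.sum_range_succ _ _
      rw [e, smul_add, ih, Finset.sum_range_succ, flagStep, pow_succ]
      module
  have h2 : flagLoop α N z = z⁻¹ • (z • flagLoop α N z) := by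
    rw [smul_smul, inv_mul_cancel₀ hz, one_smul]
  rw [h2, key, h.top, proj_top, smul_add, smul_smul, smul_smul, mul_sub, mul_one,
    inv_mul_cancel₀ hz]

lemma wirtingerMatrix_flagLoop (hf : ∀ v, IsFlag (fun k => α k v) N)
    (hs : ∀ k, IsSmoothAt (fun v => proj (α k v)) w) {z : ℂ} (hz : z ≠ 0) (c : ℂ) :
    wirtingerMatrix c (fun v => flagLoop (fun k => α k v) N z) w =
      (z⁻¹ - 1) • ∑ k ∈ Finset.range N,
        z ^ k • wirtingerMatrix c (fun v => proj (α k v)) w := by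
  have e : (fun v => flagLoop (fun k => α k v) N z) = fun v =>
      (z⁻¹ * z ^ N) • (1 : Matrix (Fin n) (Fin n) ℂ) +
      (z⁻¹ - 1) • ∑ k ∈ Finset.range N, z ^ k • proj (α k v) :=
    funext fun v => (hf v).loop_eq hz
  have h1 : ∀ k ∈ Finset.range N, IsSmoothAt (fun v => z ^ k • proj (α k v)) w :=
    fun k _ => (hs k).const_smul _
  rw [e, wirtingerMatrix_const_add, wirtingerMatrix_smul _ (IsSmoothAt.sum h1),
    wirtingerMatrix_sum h1]
  simp only [wirtingerMatrix_smul _ (hs _)]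

/-- If `α_k` is holomorphic and the derivative of its sections lies in `α_{k+1}`, then
`(P_k)_z = Q_k (P_k)_z`. -/
lemma flagStep_mul_dz_proj (hs : IsSmoothAt (fun v => proj (α k v)) w)
    (hol : dzbar (fun v => proj (α k v)) w * proj (α k w) = 0)
    (hver : (1 - proj (α (k + 1) w)) * dz (fun v => proj (α k v)) w = 0) :
    flagStep (fun k => α k w) k * dz (fun v => proj (α k v)) w =
      dz (fun v => proj (α k v)) w := by
  rw [flagStep, sub_mul, proj_mul_dz_proj hs hol, sub_zero]
  rw [sub_mul, one_mul, sub_eq_zero] at hver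
  exact hver.symm

lemma IsFlag.loop_mul_step {α : ℕ → Submodule ℂ (EuclideanSpace ℂ (Fin n))} (h : IsFlag α N)
    (hk : k < N) (z : ℂ) : flagLoop α N z * flagStep α k = z ^ k • flagStep α k := by
  rw [flagLoop, Finset.sum_mul, Finset.sum_eq_single k]
  · rw [smul_mul_assoc, h.step_mul_step, if_pos rfl]
  · intro j _ hj
    rw [smul_mul_assoc, h.step_mul_step, if_neg hj, smul_zero]
  · intro hk'
    exact absurd (Finset.mem_range.2 hk) hk'

/-- With `T = Σ P_k`, the loop `Φ` of the flag satisfies `Φ_z = (λ⁻¹ - 1) Φ T_z`. -/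
lemma dz_flagLoop (hf : ∀ v, IsFlag (fun k => α k v) N)
    (hs : ∀ k, IsSmoothAt (fun v => proj (α k v)) w)
    (hol : ∀ k, dzbar (fun v => proj (α k v)) w * proj (α k w) = 0)
    (hver : ∀ k, (1 - proj (α (k + 1) w)) * dz (fun v => proj (α k v)) w = 0) {z : ℂ}
    (hz : z ≠ 0) : dz (fun v => flagLoop (fun k => α k v) N z) w =
      (z⁻¹ - 1) • (flagLoop (fun k => α k w) N z *
        dz (fun v => ∑ k ∈ Finset.range N, proj (α k v)) w) := by
  rw [dz_eq, wirtingerMatrix_flagLoop hf hs hz, dz_eq, wirtingerMatrix_sum fun k _ => hs k,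
    Finset.mul_sum]
  congr 1
  refine Finset.sum_congr rfl fun k hk => ?_
  rw [← dz_eq, ← flagStep_mul_dz_proj (hs k) (hol k) (hver k), ← mul_assoc,
    (hf w).loop_mul_step (Finset.mem_range.1 hk), smul_mul_assoc]

/-- With `T = Σ P_k`, the loop `Φ` of the flag satisfies `Φ_z̄ = (λ⁻¹ - 1) T_z̄ Φ`. -/
lemma dzbar_flagLoop (hf : ∀ v, IsFlag (fun k => α k v) N)
    (hs : ∀ k, IsSmoothAt (fun v => proj (α k v)) w)
    (hol : ∀ k, dzbar (fun v => proj (α k v)) w * proj (α k w) = 0)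
    (hver : ∀ k, (1 - proj (α (k + 1) w)) * dz (fun v => proj (α k v)) w = 0) {z : ℂ}
    (hz : z ≠ 0) : dzbar (fun v => flagLoop (fun k => α k v) N z) w =
      (z⁻¹ - 1) • (dzbar (fun v => ∑ k ∈ Finset.range N, proj (α k v)) w *
        flagLoop (fun k => α k w) N z) := by
  rw [dzbar_eq, wirtingerMatrix_flagLoop hf hs hz, dzbar_eq, wirtingerMatrix_sum fun k _ => hs k,
    Finset.sum_mul]
  congr 1
  refine Finset.sum_congr rfl fun k hk => ?_
  have h := congrArg Matrix.conjTranspose (flagStep_mul_dz_proj (hs k) (hol k) (hver k))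
  rw [Matrix.conjTranspose_mul, flagStep_conjTranspose, dz_proj_conjTranspose (hs k)] at h
  rw [← dzbar_eq, ← h, mul_assoc, (hf w).step_mul_loop (Finset.mem_range.1 hk), mul_smul_comm]

/-- A polynomial identity that holds at all points of the unit circle but `1`. -/
lemma coeff_eq_of_circle {N : ℕ} {S R : ℕ → Matrix (Fin n) (Fin n) ℂ}
    (h : ∀ l : Circle, l ≠ 1 →
      ∑ k ∈ Finset.range N, (l : ℂ) ^ k • S k = ∑ k ∈ Finset.range N, (l : ℂ) ^ k • R k) :
    ∀ k < N, S k = R k := by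
  intro k hk
  ext i j
  have hp : ∑ k ∈ Finset.range N, (Polynomial.C (S k i j)) * X ^ k =
      ∑ k ∈ Finset.range N, (Polynomial.C (R k i j)) * X ^ k := by
    refine Polynomial.eq_of_infinite_eval_eq _ _ ?_
    refine (infinite_unitCircle.sdiff (Set.finite_singleton (1 : ℂ))).mono ?_
    rintro z ⟨hz, hz1⟩
    have h1 := congrFun (congrFun (h ⟨z, hz⟩ fun h0 => hz1 (congrArg Subtype.val h0)) i) j
    simp only [Matrix.sum_apply, Matrix.smul_apply, smul_eq_mul] at h1
    simp only [Set.mem_ofPred_eq, eval_finsetSum, eval_mul, eval_C, eval_pow, eval_X]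
    simpa only [mul_comm] using h1
  have h2 := congrArg (fun p : ℂ[X] => p.coeff k) hp
  simpa [Polynomial.coeff_X_pow, hk] using h2

/-- If the loop of a flag satisfies the extended solution equation at `w`, then the derivatives of
the sections of `α_k` lie in `α_{k+1}`: comparison of the powers of `λ` in `Q_j Φ_z` gives
`Q_j (P_k)_z = 0` for `j ≠ k`. -/
lemma one_sub_proj_mul_dz_proj (hf : ∀ v, IsFlag (fun k => α k v) N)
    (hs : ∀ k, IsSmoothAt (fun v => proj (α k v)) w) {P : Matrix (Fin n) (Fin n) ℂ}
    (hP : ∀ l : Circle, (flagLoop (fun k => α k w) N l)⁻¹ *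
      dz (fun v => flagLoop (fun k => α k v) N l) w = (1 - (l : ℂ)⁻¹) • P) (k : ℕ) :
    (1 - proj (α (k + 1) w)) * dz (fun v => proj (α k v)) w = 0 := by
  rcases le_or_gt N k with hk | hk
  · have htop : α (k + 1) w = ⊤ := top_le_iff.1 ((hf w).top ▸ (hf w).mono (Nat.le_succ_of_le hk))
    rw [htop, proj_top, sub_self, zero_mul]
  have h1 : ∀ l : Circle, l ≠ 1 →
      ∑ k ∈ Finset.range N, (l : ℂ) ^ k • dz (fun v => proj (α k v)) w =
        -(flagLoop (fun k => α k w) N l * P) := by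
    intro l hl
    have hu := (hf w).loop_inv l
    have hdet : IsUnit (flagLoop (fun k => α k w) N l).det :=
      (Matrix.isUnit_iff_isUnit_det _).1 (IsUnit.of_mul_eq_one_right _ hu)
    have h2 := congrArg (fun X => flagLoop (fun k => α k w) N l * X) (hP l)
    simp only [Matrix.mul_nonsing_inv_cancel_left _ _ hdet] at h2
    rw [dz_eq, wirtingerMatrix_flagLoop hf hs l.coe_ne_zero, mul_smul_comm] at h2
    have hne : (l : ℂ)⁻¹ - 1 ≠ 0 := fun h0 => hl (by
      rw [sub_eq_zero, inv_eq_one] at h0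
      exact Circle.ext h0)
    rw [← neg_sub (l : ℂ)⁻¹ 1, neg_smul, ← smul_neg] at h2
    simp only [dz_eq]
    exact smul_right_injective _ hne h2
  have h3 : ∀ j < N, j ≠ k → flagStep (fun k => α k w) j * dz (fun v => proj (α k v)) w = 0 := by
    intro j hj hjk
    have := coeff_eq_of_circle (N := N)
      (S := fun k => flagStep (fun k => α k w) j * dz (fun v => proj (α k v)) w)
      (R := fun k => if k = j then -(flagStep (fun k => α k w) j * P) else 0) (fun l hl => ?_) k hk
    · simpa [Ne.symm hjk] using this
    · have h4 := congrArg (fun X => flagStep (fun k => α k w) j * X) (h1 l hl)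
      simp only [Finset.mul_sum, mul_smul_comm, mul_neg, ← mul_assoc] at h4
      rw [(hf w).step_mul_loop hj, smul_mul_assoc] at h4
      rw [h4, Finset.sum_eq_single j]
      · simp
      · intro b _ hb
        simp [hb]
      · intro hj'
        exact absurd (Finset.mem_range.2 hj) hj'
  have h5 : (1 : Matrix (Fin n) (Fin n) ℂ) - proj (α (k + 1) w) =
      ∑ j ∈ Finset.Ico (k + 1) N, flagStep (fun k => α k w) j := by
    rw [← (hf w).sum_step_top, ← (hf w).sum_step (k + 1),
      Finset.sum_Ico_eq_sub _ (Nat.succ_le_of_lt hk)]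
  rw [h5, Finset.sum_mul]
  refine Finset.sum_eq_zero fun j hj => ?_
  have := Finset.mem_Ico.1 hj
  exact h3 j this.2 (by omega)

end FlagDerivative

/-! ### Harmonicity -/

section Harmonic

variable {n : ℕ} {w : ℂ}

/-- The harmonic map equation for `φ` with `φ² = 1`, `φ_z = -2 φ T_z` and `φ_z̄ = 2 φ T_z̄`: it
states that `T_{zz̄} + [T_z̄, T_z] = 0`, which is the equality of the mixed derivatives of
`φ`. -/
lemma harmonic_of_dz_eq {φ T : ℂ → Matrix (Fin n) (Fin n) ℂ}
    (hφs : ∀ᶠ v in 𝓝 w, IsSmoothAt φ v) (hTs : ∀ᶠ v in 𝓝 w, IsSmoothAt T v)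
    (hφ : ∀ v, φ v * φ v = 1)
    (h1 : ∀ᶠ v in 𝓝 w, dz φ v = (-2 : ℂ) • (φ v * dz T v))
    (h2 : ∀ᶠ v in 𝓝 w, dzbar φ v = (2 : ℂ) • (φ v * dzbar T v)) :
    dzbar (fun v => (1 / 2 : ℂ) • ((φ v)⁻¹ * dz φ v)) w +
      ((1 / 2 : ℂ) • ((φ w)⁻¹ * dzbar φ w) * (1 / 2 : ℂ) • ((φ w)⁻¹ * dz φ w) -
        (1 / 2 : ℂ) • ((φ w)⁻¹ * dz φ w) * (1 / 2 : ℂ) • ((φ w)⁻¹ * dzbar φ w)) = 0 := by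
  have hinv : ∀ v, (φ v)⁻¹ = φ v := fun v => Matrix.inv_eq_left_inv (hφ v)
  have hsw := hφs.self_of_nhds
  have hTw := hTs.self_of_nhds
  have hdT : IsSmoothAt (dz T) w := by
    rw [dz_eq]
    exact hTw.wirtingerMatrix
  have hdbT : IsSmoothAt (dzbar T) w := hTw.wirtingerMatrix
  have hA : (fun v => (1 / 2 : ℂ) • ((φ v)⁻¹ * dz φ v)) =ᶠ[𝓝 w] fun v => (-1 : ℂ) • dz T v := by
    filter_upwards [h1] with v hv
    rw [hv, hinv, mul_smul_comm, ← mul_assoc, hφ, one_mul, smul_smul]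
    norm_num
  have hB : (1 / 2 : ℂ) • ((φ w)⁻¹ * dzbar φ w) = dzbar T w := by
    rw [h2.self_of_nhds, hinv, mul_smul_comm, ← mul_assoc, hφ, one_mul, smul_smul]
    norm_num
  have e1 : dzbar (dz φ) w =
      (-2 : ℂ) • ((2 : ℂ) • (φ w * dzbar T w) * dz T w + φ w * dzbar (dz T) w) := by
    rw [dzbar_eq, wirtingerMatrix_congr h1, wirtingerMatrix_smul _ (hsw.mul hdT),
      wirtingerMatrix_mul hsw hdT, ← dzbar_eq, ← dzbar_eq, h2.self_of_nhds]
  have e2 : dz (dzbar φ) w =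
      (2 : ℂ) • ((-2 : ℂ) • (φ w * dz T w) * dzbar T w + φ w * dz (dzbar T) w) := by
    rw [dz_eq, wirtingerMatrix_congr h2, wirtingerMatrix_smul _ (hsw.mul hdbT),
      wirtingerMatrix_mul hsw hdbT, ← dz_eq, ← dz_eq, h1.self_of_nhds]
  have e3 : dzbar (dz φ) w = dz (dzbar φ) w := by
    rw [dz_eq, dzbar_eq, dzbar_eq, dz_eq, wirtingerMatrix_comm hsw]
  have e4 : dzbar (dz T) w = dz (dzbar T) w := by
    rw [dz_eq, dzbar_eq, dzbar_eq, dz_eq, wirtingerMatrix_comm hTw]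
  have e5 : φ w * (dzbar (dz T) w + (dzbar T w * dz T w - dz T w * dzbar T w)) = 0 := by
    rw [e3, e2, ← e4] at e1
    have h4 : (4 : ℂ) • (φ w * (dzbar (dz T) w + (dzbar T w * dz T w - dz T w * dzbar T w))) =
        (2 : ℂ) • ((-2 : ℂ) • (φ w * dz T w) * dzbar T w + φ w * dzbar (dz T) w) -
        (-2 : ℂ) • ((2 : ℂ) • (φ w * dzbar T w) * dz T w + φ w * dzbar (dz T) w) := by
      simp only [mul_add, mul_sub, smul_mul_assoc, mul_assoc]
      module
    rw [e1, sub_self] at h4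
    exact (smul_eq_zero.1 h4).resolve_left (by norm_num)
  have e6 : dzbar (dz T) w + (dzbar T w * dz T w - dz T w * dzbar T w) = 0 := by
    have := congrArg (fun X => φ w * X) e5
    simpa only [← mul_assoc, hφ, one_mul, mul_zero] using this
  have hA' : (1 / 2 : ℂ) • ((φ w)⁻¹ * dz φ w) = (-1 : ℂ) • dz T w := hA.self_of_nhds
  rw [dzbar_eq, wirtingerMatrix_congr hA, wirtingerMatrix_smul _ hdT, ← dzbar_eq, hA', hB,
    mul_smul_comm, smul_mul_assoc, ← smul_sub, ← smul_add, e6, smul_zero]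

end Harmonic

/-! ### Solutions of the extended solution equation and their flags -/

section Vertical

variable {n : ℕ}

/-- For strictly upper triangular `B'`, the equations `b_k' = b_{k-1,k}' b_{k-1}` for its columns
say that each `b_k'` is in the span of the columns of `b` with index at least `k - 1`: its
coordinates with respect to columns of index at least `k` vanish by triangularity. -/
lemma IsUnitriangular.forall_mem_lastColumns_iff {b B' : Matrix (Fin n) (Fin n) ℂ}
    (hb : IsUnitriangular b) (hB : ∀ i j, j ≤ i → B' i j = 0) :
    (∀ j : Fin n, (WithLp.toLp 2 fun i => B' i j : EuclideanSpace ℂ (Fin n)) ∈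
      lastColumns b (n - j + 1)) ↔
      ∀ i j k : Fin n, (k : ℕ) = j + 1 → B' i k = b i j * B' j k := by
  constructor
  · intro h i j k hk
    set c : Fin n → ℂ := b⁻¹ *ᵥ fun i => B' i k with hc
    have hlow : ∀ p : Fin n, (p : ℕ) + 1 < k → c p = 0 := fun p hp =>
      (hb.mem_lastColumns_iff.1 (h k)) p (by omega)
    have hbc : ∀ i, B' i k = ∑ l, b i l * c l := fun i => by
      have e : b *ᵥ c = fun i => B' i k := by
        rw [hc, Matrix.mulVec_mulVec, hb.mul_inv, Matrix.one_mulVec]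
      exact (congrFun e i).symm
    have hhigh : ∀ d : ℕ, ∀ p : Fin n, n - p = d → k ≤ p → c p = 0 := by
      intro d
      induction d using Nat.strong_induction_on with
      | _ d ih =>
      intro p hp hkp
      have h1 := hbc p
      rw [hB p k hkp, Finset.sum_eq_single p] at h1
      · rwa [hb.diag, one_mul, eq_comm] at h1
      · intro q _ hq
        rcases lt_or_gt_of_ne hq with hlt | hgt
        · rw [hb.lower hlt, zero_mul]
        · have hgt' : (p : ℕ) < q := hgt
          rw [ih (n - q) (by omega) q rfl (hkp.trans hgt.le), mul_zero]
      · intro h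
        exact absurd (Finset.mem_univ p) h
    have hone : ∀ i, B' i k = b i j * c j := fun i => by
      rw [hbc i, Finset.sum_eq_single j]
      · intro q _ hq
        have hq' : (q : ℕ) ≠ j := fun h => hq (Fin.ext h)
        rcases lt_or_gt_of_ne hq' with hlt | hgt
        · rw [hlow q (by omega), mul_zero]
        · rw [hhigh _ q rfl (Fin.le_def.2 (by omega)), mul_zero]
      · intro h
        exact absurd (Finset.mem_univ j) h
    rw [hone i, hone j, hb.diag, one_mul]
  · intro h k
    rcases Nat.eq_zero_or_pos (k : ℕ) with hk | hk
    · have e : (WithLp.toLp 2 fun i => B' i k : EuclideanSpace ℂ (Fin n)) = 0 := by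
        ext i
        exact hB i k (Fin.le_def.2 (by omega))
      rw [e]
      exact Submodule.zero_mem _
    · let j : Fin n := ⟨k - 1, by omega⟩
      have hj : (k : ℕ) = j + 1 := by simp only [j]; omega
      have e : (WithLp.toLp 2 fun i => B' i k : EuclideanSpace ℂ (Fin n)) =
          B' j k • WithLp.toLp 2 fun i => b i j := by
        ext i
        exact (h i j k hj).trans (mul_comm _ _)
      rw [e]
      exact Submodule.smul_mem _ _ (column_mem_lastColumns b (by omega))

variable {α : ℕ → ℂ → Submodule ℂ (EuclideanSpace ℂ (Fin n))} {c : ℂ → Matrix (Fin n) (Fin n) ℂ}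
  {w : ℂ}

/-- Where the flag is spanned by holomorphic columns, the condition `(1 - P_{k+1}) (P_k)_z = 0`
says that the derivatives of the columns spanning `α_k` lie in `α_{k+1}`. -/
lemma one_sub_proj_mul_dz_iff (hc : ∀ i j, AnalyticAt ℂ (fun v => c v i j) w)
    (hα : ∀ᶠ v in 𝓝 w, ∀ k, α k v = lastColumns (c v) k) {k : ℕ}
    (hs : IsSmoothAt (fun v => proj (α k v)) w)
    (hol : dzbar (fun v => proj (α k v)) w * proj (α k w) = 0) :
    (1 - proj (α (k + 1) w)) * dz (fun v => proj (α k v)) w = 0 ↔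
      ∀ j : Fin n, n ≤ j + k →
        (WithLp.toLp 2 fun i => deriv (fun v => c v i j) w : EuclideanSpace ℂ (Fin n)) ∈
          lastColumns (c w) (k + 1) := by
  have hw := hα.self_of_nhds
  set E := dz (fun v => proj (α k v)) w with hE
  have hderiv : ∀ j : Fin n, n ≤ j + k → E *ᵥ (fun i => c w i j) =
      (fun i => deriv (fun v => c v i j) w) -
        proj (α k w) *ᵥ fun i => deriv (fun v => c v i j) w := by
    intro j hj
    funext i
    have hd : ∀ p, DifferentiableAt ℂ (fun v => c v p j) w := fun p => (hc p j).differentiableAt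
    have h0 : ∀ p, wirtinger (-Complex.I) (fun v => c v p j) w = deriv (fun v => c v p j) w :=
      fun p => by
        rw [wirtinger_holomorphic (hd p), neg_mul, Complex.I_mul_I]
        ring
    have h1 : (fun v => ∑ p, proj (α k v) i p * c v p j) =ᶠ[𝓝 w] fun v => c v i j := by
      filter_upwards [hα] with v hv
      rw [hv k]
      exact proj_lastColumns_mul_apply (c v) i hj
    have h2 := wirtinger_congr (c := -Complex.I) h1
    rw [h0, wirtinger_sum fun p _ => (hs.differentiableAt i p).fun_mul
      ((hd p).restrictScalars ℝ)] at h2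
    change ∑ p, E i p * c w p j = deriv (fun v => c v i j) w -
      ∑ p, proj (α k w) i p * deriv (fun v => c v p j) w
    rw [← h2, ← Finset.sum_sub_distrib]
    refine Finset.sum_congr rfl fun p _ => ?_
    rw [wirtinger_mul (hs.differentiableAt i p) ((hd p).restrictScalars ℝ), h0,
      add_sub_cancel_right, hE, dz_eq]
    rfl
  have hle : α k w ≤ α (k + 1) w := by
    rw [hw, hw]
    exact lastColumns_mono _ (Nat.le_succ k)
  have hkey : ∀ j : Fin n, n ≤ j + k → ((1 - proj (α (k + 1) w)) * E) *ᵥ (fun i => c w i j) =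
      (fun i => deriv (fun v => c v i j) w) -
        proj (α (k + 1) w) *ᵥ fun i => deriv (fun v => c v i j) w := by
    intro j hj
    rw [← Matrix.mulVec_mulVec, hderiv j hj, Matrix.sub_mulVec, Matrix.one_mulVec,
      Matrix.mulVec_sub, Matrix.mulVec_mulVec, proj_mul_proj_of_le hle]
    abel
  constructor
  · intro h j hj
    have h1 := hkey j hj
    rw [h, Matrix.zero_mulVec, eq_comm, sub_eq_zero] at h1
    rw [← hw]
    exact mem_iff_proj_mulVec.2 h1.symm
  · intro h
    have hEP : E * proj (α k w) = E := dz_proj_mul_proj hs hol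
    rw [← hEP, ← mul_assoc]
    refine matrix_ext_mulVec fun v => ?_
    rw [← Matrix.mulVec_mulVec, Matrix.zero_mulVec]
    have hmem := proj_mulVec_mem (α k w) v
    have hker : ∀ x ∈ α k w, ((1 - proj (α (k + 1) w)) * E) *ᵥ x.ofLp = 0 := by
      intro x hx
      rw [hw] at hx
      induction hx using Submodule.span_induction with
      | mem x hx =>
        obtain ⟨j, hj, rfl⟩ := hx
        have h2 := h j hj
        rw [← hw] at h2
        exact (hkey j hj).trans (sub_eq_zero.2 (mem_iff_proj_mulVec.1 h2).symm)
      | zero => simp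
      | add x y _ _ hx hy => rw [WithLp.ofLp_add, Matrix.mulVec_add, hx, hy, add_zero]
      | smul c x _ hx => rw [WithLp.ofLp_smul, Matrix.mulVec_smul, hx, smul_zero]
    exact hker _ hmem

/-- The preceding conditions for all `k` amount to the extended solution equation for the
columns. -/
lemma forall_one_sub_proj_mul_dz_iff (hc : ∀ i j, AnalyticAt ℂ (fun v => c v i j) w)
    (hu : ∀ v, IsUnitriangular (c v)) (hα : ∀ᶠ v in 𝓝 w, ∀ k, α k v = lastColumns (c v) k)
    (hs : ∀ k, IsSmoothAt (fun v => proj (α k v)) w)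
    (hol : ∀ k, dzbar (fun v => proj (α k v)) w * proj (α k w) = 0) :
    (∀ k, (1 - proj (α (k + 1) w)) * dz (fun v => proj (α k v)) w = 0) ↔
      ∀ i j k : Fin n, (k : ℕ) = j + 1 →
        deriv (fun v => c v i k) w = c w i j * deriv (fun v => c v j k) w := by
  have h0 : ∀ i j, j ≤ i → (Matrix.of fun i j => deriv (fun v => c v i j) w :
      Matrix (Fin n) (Fin n) ℂ) i j = 0 := by
    intro i j hij
    have : (fun v => c v i j) = fun _ => if i = j then 1 else 0 := funext fun v => hu v i j hij
    rw [Matrix.of_apply, this, deriv_const]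
  refine Iff.trans ?_ ((hu w).forall_mem_lastColumns_iff h0)
  constructor
  · intro h j
    exact (one_sub_proj_mul_dz_iff hc hα (hs _) (hol _)).1 (h (n - j)) j (by omega)
  · intro h k
    exact (one_sub_proj_mul_dz_iff hc hα (hs _) (hol _)).2 fun j hj =>
      lastColumns_mono _ (by omega) (h j)

end Vertical

section VerticalSurface

variable {M : Type*} [TopologicalSpace M] {n : ℕ}

lemma eventually_codiscrete_eventually_nhds [T1Space M] {p : M → Prop}
    (h : ∀ᶠ x in codiscrete M, p x) : ∀ᶠ x in codiscrete M, ∀ᶠ y in 𝓝 x, p y := by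
  refine eventually_codiscrete_iff.2 fun x => ?_
  have h1 := eventually_eventually_nhdsWithin.2 (eventually_codiscrete_iff.1 h x)
  filter_upwards [h1, self_mem_nhdsWithin] with y hy hyx
  rwa [isOpen_compl_singleton.nhdsWithin_eq hyx] at hy

variable [ChartedSpace ℂ M] [IsManifold 𝓘(ℂ, ℂ) ω M] {b : M → Matrix (Fin n) (Fin n) ℂ}
  {e : OpenPartialHomeomorph M ℂ} {w : ℂ}

/-- The subbundles of the flag are holomorphic. -/
lemma dzbar_proj_limitFlag_mul (hb : ∀ i j, IsMeromorphic fun x => b x i j)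
    (hu : ∀ x, IsUnitriangular (b x)) (k : ℕ) (he : e ∈ atlas ℂ M) (hw : w ∈ e.target) :
    dzbar (fun v => proj (limitFlag b k (e.symm v))) w * proj (limitFlag b k (e.symm w)) = 0 := by
  rcases le_or_gt k n with hk | hk
  · obtain ⟨s, hs, h1, -⟩ := exists_frame_limitFlag hb hu hk he hw
    have h := dzbar_proj_span_mul hs (h1.mono fun _ h => h.1)
    rw [← h1.self_of_nhds.2] at h
    rw [← h, dzbar_eq, dzbar_eq]
    congr 1
    exact wirtingerMatrix_congr (h1.mono fun v hv => congrArg proj hv.2)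
  · have : ∀ y, limitFlag b k y = ⊤ := fun y => by
      rw [← top_le_iff, ← (isFlag_limitFlag hb hu y).top]
      exact (isFlag_limitFlag hb hu y).mono hk.le
    simp only [this]
    rw [dzbar_eq, wirtingerMatrix_const, zero_mul]

variable [T1Space M]

/-- The extended solution equation for the columns of `b` holds off a closed discrete set if and
only if `(1 - P_{k+1}) (P_k)_z = 0` for the flag of `b`, everywhere and in all charts. -/
lemma eventually_coordDeriv_eq_iff (hb : ∀ i j, IsMeromorphic fun x => b x i j)
    (hu : ∀ x, IsUnitriangular (b x)) :
    (∀ᶠ x in codiscrete M, ∀ i j k : Fin n, (k : ℕ) = j + 1 →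
      coordDeriv (fun y => b y i k) x = b x i j * coordDeriv (fun y => b y j k) x) ↔
    ∀ e ∈ atlas ℂ M, ∀ w ∈ e.target, ∀ k, (1 - proj (limitFlag b (k + 1) (e.symm w))) *
      dz (fun v => proj (limitFlag b k (e.symm v))) w = 0 := by
  have hgood : ∀ᶠ x in codiscrete M, (∀ i j, ∀ e ∈ atlas ℂ M, x ∈ e.source →
      AnalyticAt ℂ ((fun y => b y i j) ∘ e.symm) (e x)) ∧
      ∀ᶠ y in 𝓝 x, ∀ k, limitFlag b k y = lastColumns (b y) k :=
    (eventually_all.2 fun i => eventually_all.2 fun j => (hb i j).eventually_analyticAt).and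
      (eventually_codiscrete_eventually_nhds (eventually_forall_limitFlag_eq hb hu))
  have hiff : ∀ᶠ x in codiscrete M, ∀ e ∈ atlas ℂ M, x ∈ e.source →
      ((∀ k, (1 - proj (limitFlag b (k + 1) (e.symm (e x)))) *
        dz (fun v => proj (limitFlag b k (e.symm v))) (e x) = 0) ↔
      ∀ i j k : Fin n, (k : ℕ) = j + 1 →
        coordDeriv (fun y => b y i k) x = b x i j * coordDeriv (fun y => b y j k) x) := by
    filter_upwards [hgood] with x hx e he hxe
    have hw := e.map_source hxe
    have ht : Tendsto e.symm (𝓝 (e x)) (𝓝 x) := by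
      have := e.continuousAt_symm hw
      rwa [ContinuousAt, e.left_inv hxe] at this
    refine (forall_one_sub_proj_mul_dz_iff (c := fun v => b (e.symm v))
      (α := fun k v => limitFlag b k (e.symm v)) (fun i j => hx.1 i j e he hxe) (fun v => hu _)
      (ht.eventually hx.2) (fun k => isSmoothAt_proj_limitFlag hb hu k he hw)
      fun k => dzbar_proj_limitFlag_mul hb hu k he hw).trans ?_
    refine forall_congr' fun i => forall_congr' fun j => forall_congr' fun k =>
      forall_congr' fun _ => ?_
    rw [coordDeriv_eq_mul he hxe (hx.1 i k e he hxe), coordDeriv_eq_mul he hxe (hx.1 j k e he hxe),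
      ← mul_assoc, mul_left_inj' (deriv_transition_chartAt_ne_zero he hxe), e.left_inv hxe]
    rfl
  constructor
  · intro h e he w hw k
    have hgen := eventually_chart_of_codiscrete (h.and hiff) e hw
    have hcont : ContinuousAt (fun v => (1 - proj (limitFlag b (k + 1) (e.symm v))) *
        dz (fun v => proj (limitFlag b k (e.symm v))) v) w := by
      have h1 := (isSmoothAt_proj_limitFlag hb hu (k + 1) he hw).continuousAt
      have h2 : ContinuousAt (dz fun v => proj (limitFlag b k (e.symm v))) w := by
        rw [dz_eq]
        exact (isSmoothAt_proj_limitFlag hb hu k he hw).wirtingerMatrix.continuousAt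
      exact (continuousAt_const.sub h1).mul h2
    refine tendsto_nhds_unique (hcont.tendsto.mono_left (nhdsWithin_le_nhds (s := {w}ᶜ)))
      (tendsto_const_nhds.congr' ?_)
    filter_upwards [hgen, nhdsWithin_le_nhds (e.open_target.mem_nhds hw)] with v hv hvt
    have := (hv.2 e he (e.map_target hvt)).2 hv.1 k
    rw [e.right_inv hvt] at this
    exact this.symm
  · intro h
    filter_upwards [hiff] with x hx
    exact (hx _ (chart_mem_atlas ℂ x) (mem_chart_source ℂ x)).1
      (h _ (chart_mem_atlas ℂ x) _ (mem_chart_target ℂ x))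

end VerticalSurface

/-! ### Meromorphic matrices and their representatives -/

section Representatives

variable {M : Type*} [TopologicalSpace M] {n : ℕ}

/-- The matrix of classes of functions defined by a matrix-valued function. -/
def germMatrix (b : M → Matrix (Fin n) (Fin n) ℂ) : Matrix (Fin n) (Fin n) (FunGerm M) :=
  Matrix.of fun i j => ((fun x => b x i j : M → ℂ) : FunGerm M)

lemma germMatrix_eq_iff {b b' : M → Matrix (Fin n) (Fin n) ℂ} :
    germMatrix b = germMatrix b' ↔ b =ᶠ[codiscrete M] b' := by
  have h1 : germMatrix b = germMatrix b' ↔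
      ∀ i j, (fun x => b x i j) =ᶠ[codiscrete M] fun x => b' x i j := by
    simp only [← Matrix.ext_iff, germMatrix, Matrix.of_apply, Germ.coe_eq]
  rw [h1]
  simp only [EventuallyEq, ← eventually_all]
  exact eventually_congr (Eventually.of_forall fun x => Matrix.ext_iff)

lemma secondTranspose_germMatrix_mul (b : M → Matrix (Fin n) (Fin n) ℂ) :
    secondTranspose (germMatrix b) * germMatrix b =
      germMatrix fun x => secondTranspose (b x) * b x := by
  ext i j
  have h : (fun x => (secondTranspose (b x) * b x) i j) =
      ∑ l : Fin n, (fun x => b x l.rev i.rev) * fun x => b x l j := by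
    funext x
    simp [Matrix.mul_apply, secondTranspose]
  rw [germMatrix, germMatrix, Matrix.of_apply, h, Matrix.mul_apply]
  exact (map_sum (Germ.coeRingHom (codiscrete M)) _ _).symm

lemma germMatrix_one : germMatrix (fun _ : M => (1 : Matrix (Fin n) (Fin n) ℂ)) = 1 := by
  ext i j
  rw [germMatrix, Matrix.of_apply, Matrix.one_apply]
  split_ifs with h
  · subst h
    simp only [Matrix.one_apply_eq]
    rfl
  · simp only [Matrix.one_apply_ne h]
    rfl

lemma secondTranspose_germMatrix_mul_eq_one_iff {b : M → Matrix (Fin n) (Fin n) ℂ} :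
    secondTranspose (germMatrix b) * germMatrix b = 1 ↔
      ∀ᶠ x in codiscrete M, secondTranspose (b x) * b x = 1 := by
  rw [secondTranspose_germMatrix_mul, ← germMatrix_one, germMatrix_eq_iff]
  rfl

lemma eventually_isUnitriangular {b : M → Matrix (Fin n) (Fin n) ℂ}
    (h : IsUnitriangular (germMatrix b)) : ∀ᶠ x in codiscrete M, IsUnitriangular (b x) := by
  refine eventually_all.2 fun i => eventually_all.2 fun j => ?_
  by_cases hij : j ≤ i
  · have h1 : ((fun x => b x i j : M → ℂ) : FunGerm M) =
        ((fun _ => if i = j then 1 else 0 : M → ℂ) : FunGerm M) := by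
      have h2 := h i j hij
      rw [germMatrix, Matrix.of_apply] at h2
      rw [h2]
      split_ifs <;> rfl
    filter_upwards [Germ.coe_eq.1 h1] with x hx _ using hx
  · exact Eventually.of_forall fun x h' => absurd h' hij

variable [ChartedSpace ℂ M]

/-- `b` is a meromorphic matrix whose values are all upper unitriangular. -/
structure IsMeroUnitriangular (b : M → Matrix (Fin n) (Fin n) ℂ) : Prop where
  mero : ∀ i j, IsMeromorphic fun x => b x i j
  uni : ∀ x, IsUnitriangular (b x)

lemma exists_representative {B : Matrix (Fin n) (Fin n) (FunGerm M)}
    (hB : B ∈ meroGroupR M (xiOne n)) :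
    ∃ b : M → Matrix (Fin n) (Fin n) ℂ, IsMeroUnitriangular b ∧ germMatrix b = B := by
  obtain ⟨hm, hu, -⟩ := mem_meroGroupR_iff.1 hB
  choose f hf hfB using hm
  refine ⟨fun x => Matrix.of fun i j => if j ≤ i then (if i = j then 1 else 0) else f i j x,
    ⟨fun i j => ?_, fun x i j hij => ?_⟩, ?_⟩
  · by_cases hij : j ≤ i
    · simp only [Matrix.of_apply, if_pos hij]
      exact isMeromorphic_const _
    · simp only [Matrix.of_apply, if_neg hij]
      exact hf i j
  · rw [Matrix.of_apply, if_pos hij]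
  · ext i j
    by_cases hij : j ≤ i
    · simp only [germMatrix, Matrix.of_apply, if_pos hij]
      rw [hu i j hij]
      split_ifs <;> rfl
    · simp only [germMatrix, Matrix.of_apply, if_neg hij]
      exact hfB i j

/-- A representative with unitriangular values of a meromorphic unitriangular matrix. -/
noncomputable def representative (B : Matrix (Fin n) (Fin n) (FunGerm M)) :
    M → Matrix (Fin n) (Fin n) ℂ :=
  Classical.epsilon fun b => IsMeroUnitriangular b ∧ germMatrix b = B

lemma representative_spec {B : Matrix (Fin n) (Fin n) (FunGerm M)}
    (hB : B ∈ meroGroupR M (xiOne n)) :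
    IsMeroUnitriangular (representative B) ∧ germMatrix (representative B) = B :=
  Classical.epsilon_spec (exists_representative hB)

lemma IsMeroUnitriangular.mem_meroGroupR {b : M → Matrix (Fin n) (Fin n) ℂ}
    (hb : IsMeroUnitriangular b) (h : ∀ᶠ x in codiscrete M, secondTranspose (b x) * b x = 1) :
    germMatrix b ∈ meroGroupR M (xiOne n) := by
  refine mem_meroGroupR_iff.2 ⟨fun i j => ⟨_, hb.mero i j, rfl⟩, fun i j hij => ?_,
    secondTranspose_germMatrix_mul_eq_one_iff.2 h⟩
  have h1 : (fun x => b x i j) = fun _ => if i = j then 1 else 0 := funext fun x => hb.uni x i j hij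
  rw [germMatrix, Matrix.of_apply, h1]
  split_ifs <;> rfl

end Representatives

/-! ### The extended solution of a meromorphic unitriangular matrix -/

section FlagMap

variable {M : Type*} [TopologicalSpace M] {n : ℕ}

/-- The map `[b γ]` for a meromorphic unitriangular matrix `b`, independent of the loop parameter:
at each point it is the loop of the extended flag of spans of last columns of `b`. -/
noncomputable def flagMap (b : M → Matrix (Fin n) (Fin n) ℂ) (x : M) (l : Circle) :
    Matrix (Fin n) (Fin n) ℂ := flagLoop (fun k => limitFlag b k x) n l

variable [ChartedSpace ℂ M] [IsManifold 𝓘(ℂ, ℂ) ω M] {b : M → Matrix (Fin n) (Fin n) ℂ}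

namespace IsMeroUnitriangular

lemma isFlag (hb : IsMeroUnitriangular b) (x : M) : IsFlag (fun k => limitFlag b k x) n :=
  isFlag_limitFlag hb.mero hb.uni x

lemma eventually_flagMap_eq (hb : IsMeroUnitriangular b) :
    ∀ᶠ x in codiscrete M, flagMap b x = fun l : Circle => flagLoop (lastColumns (b x)) n l := by
  filter_upwards [eventually_forall_limitFlag_eq hb.mero hb.uni] with x hx
  funext l
  rw [flagMap, funext hx]

lemma eventually_isIwasawaFactor (hb : IsMeroUnitriangular b) :
    ∀ᶠ x in codiscrete M, IsIwasawaFactor (fun l => b x * geodesic (xiOne n) l) (flagMap b x) := by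
  filter_upwards [hb.eventually_flagMap_eq] with x hx
  rw [hx]
  exact (hb.uni x).isIwasawaFactor

lemma isProjection (hb : IsMeroUnitriangular b) :
    IsProjection (xiOne n) (fun x => (b x).map C) (flagMap b) := by
  filter_upwards [hb.eventually_isIwasawaFactor] with x hx
  simpa only [map_C_map_eval] using hx

lemma continuous_flagMap (hb : IsMeroUnitriangular b) (l : Circle) :
    Continuous fun x => flagMap b x l :=
  continuous_pi fun i => continuous_pi fun j =>
    (contMDiff_flagLoop_apply hb.mero hb.uni n l i j).continuous

/-- Reality holds off a closed discrete set, and hence everywhere by continuity. -/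
lemma secondTranspose_flagMap_mul (hb : IsMeroUnitriangular b)
    (h : ∀ᶠ x in codiscrete M, secondTranspose (b x) * b x = 1) (x : M) (l : Circle) :
    secondTranspose (flagMap b x l) * flagMap b x l = (l : ℂ) ^ (n - 1) • 1 := by
  have hc := hb.continuous_flagMap l
  have hcT : Continuous fun x => secondTranspose (flagMap b x l) :=
    continuous_pi fun i => continuous_pi fun j =>
      (continuous_apply i.rev).comp ((continuous_apply j.rev).comp hc)
  refine congrFun (eq_of_eventually_codiscrete (hcT.mul hc)
    (continuous_const (y := (l : ℂ) ^ (n - 1) • (1 : Matrix (Fin n) (Fin n) ℂ))) ?_) x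
  filter_upwards [h, hb.eventually_isIwasawaFactor] with x hx hx'
  exact real_of_orthogonal hx hx' l

/-- A unitriangular matrix is determined by its extended solution. -/
lemma isConstProjection_iff (hb : IsMeroUnitriangular b) {B : Matrix (Fin n) (Fin n) (FunGerm M)}
    (hB : B ∈ meroGroupR M (xiOne n)) :
    IsConstProjection (xiOne n) B (flagMap b) ↔ B = germMatrix b := by
  constructor
  · rintro ⟨b', hb', hp⟩
    have e : germMatrix b' = B := Matrix.ext hb'
    have hu : IsUnitriangular (germMatrix b') := by
      rw [e]
      exact (mem_meroGroupR_iff.1 hB).2.1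
    rw [← e, germMatrix_eq_iff]
    filter_upwards [eventually_isUnitriangular hu, hp, hb.eventually_isIwasawaFactor]
      with x h1 h2 h3
    simp only [map_C_map_eval] at h2
    exact (hb.uni x).eq_of_isIwasawaFactor h1 h3 h2
  · rintro rfl
    exact ⟨b, fun _ _ => rfl, hb.isProjection⟩

lemma isSmoothAt_flagLoop (hb : IsMeroUnitriangular b) {e : OpenPartialHomeomorph M ℂ}
    (he : e ∈ atlas ℂ M) {w : ℂ} (hw : w ∈ e.target) (z : ℂ) :
    IsSmoothAt (fun v => flagLoop (fun k => limitFlag b k (e.symm v)) n z) w :=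
  IsSmoothAt.sum fun k _ => IsSmoothAt.const_smul _ fun i j =>
    (isSmoothAt_proj_limitFlag hb.mero hb.uni (k + 1) he hw i j).sub
      (isSmoothAt_proj_limitFlag hb.mero hb.uni k he hw i j)

variable [T1Space M]

lemma germMatrix_mem_solR_iff (hb : IsMeroUnitriangular b)
    (hB : germMatrix b ∈ meroGroupR M (xiOne n)) :
    germMatrix b ∈ solR M (xiOne n) ↔
    ∀ e ∈ atlas ℂ M, ∀ w ∈ e.target, ∀ k, (1 - proj (limitFlag b (k + 1) (e.symm w))) *
      dz (fun v => proj (limitFlag b k (e.symm v))) w = 0 := by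
  rw [mem_solR_iff, ← eventually_coordDeriv_eq_iff hb.mero hb.uni]
  simp only [hB, true_and, eventually_all]
  refine forall_congr' fun i => forall_congr' fun j => forall_congr' fun k =>
    forall_congr' fun _ => ?_
  exact Germ.coe_eq

/-- Here `Φ⁻¹ Φ_z = (λ⁻¹ - 1) T_z`, with `T` the sum of the projections onto the subbundles. -/
lemma isExtendedSolution (hb : IsMeroUnitriangular b) (hB : germMatrix b ∈ solR M (xiOne n)) :
    IsExtendedSolution (flagMap b) := by
  have hver := (hb.germMatrix_mem_solR_iff (mem_solR_iff.1 hB).1).1 hB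
  refine ⟨fun x => (hb.isFlag x).isBasedLoop, contMDiff_flagLoop hb.mero hb.uni n,
    fun e he w hw => ⟨-dz (fun v => ∑ k ∈ Finset.range n, proj (limitFlag b k (e.symm v))) w,
      fun l => ?_⟩⟩
  have h := dz_flagLoop (w := w) (α := fun k v => limitFlag b k (e.symm v)) (N := n)
    (fun v => hb.isFlag _) (fun k => isSmoothAt_proj_limitFlag hb.mero hb.uni k he hw)
    (fun k => dzbar_proj_limitFlag_mul hb.mero hb.uni k he hw) (hver e he w hw) l.coe_ne_zero
  have hdet : IsUnit (flagMap b (e.symm w) l).det := (Matrix.isUnit_iff_isUnit_det _).1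
    (IsUnit.of_mul_eq_one_right _ ((hb.isFlag (e.symm w)).loop_inv l))
  change (flagMap b (e.symm w) l)⁻¹ *
    dz (fun v => flagLoop (fun k => limitFlag b k (e.symm v)) n l) w = _
  rw [h, mul_smul_comm]
  change _ • ((flagMap b (e.symm w) l)⁻¹ * (flagMap b (e.symm w) l * _)) = _
  rw [Matrix.nonsing_inv_mul_cancel_left _ _ hdet, smul_neg, ← neg_smul, neg_sub]

/-- The converse of `isExtendedSolution`. -/
lemma germMatrix_mem_solR (hb : IsMeroUnitriangular b)
    (hB : germMatrix b ∈ meroGroupR M (xiOne n)) (h : IsExtendedSolution (flagMap b)) :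
    germMatrix b ∈ solR M (xiOne n) := by
  refine (hb.germMatrix_mem_solR_iff hB).2 fun e he w hw k => ?_
  obtain ⟨P, hP⟩ := h.2.2 e he w hw
  exact one_sub_proj_mul_dz_proj (α := fun k v => limitFlag b k (e.symm v)) (N := n)
    (fun v => hb.isFlag _) (fun k => isSmoothAt_proj_limitFlag hb.mero hb.uni k he hw) hP k

lemma mem_s1Solutions {r : ℕ} {b : M → Matrix (Fin (r + 1)) (Fin (r + 1)) ℂ}
    (hb : IsMeroUnitriangular b) (hB : germMatrix b ∈ solR M (xiOne (r + 1))) :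
    flagMap b ∈ s1Solutions M (r + 1) r := by
  have ho := secondTranspose_germMatrix_mul_eq_one_iff.1
    (mem_meroGroupR_iff.1 (mem_solR_iff.1 hB).1).2.2
  refine ⟨hb.isExtendedSolution hB, fun x => ⟨(hb.isFlag x).isBasedLoop, ⟨_, fun l => rfl⟩,
    hb.secondTranspose_flagMap_mul ho x⟩, fun x l k => ?_⟩
  rw [flagMap, Circle.coe_mul, (hb.isFlag x).loop_mul]
  rfl

/-- At `λ = -1` the derivatives of `Φ` are `φ_z = -2 φ T_z` and `φ_z̄ = -2 T_z̄ φ = 2 φ T_z̄`. -/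
lemma isHarmonicMap (hb : IsMeroUnitriangular b) (hB : germMatrix b ∈ solR M (xiOne n)) :
    IsHarmonicMap fun x => flagMap b x (-1) := by
  have hver := (hb.germMatrix_mem_solR_iff (mem_solR_iff.1 hB).1).1 hB
  refine ⟨fun x => (hb.isFlag x).loop_mem_unitaryGroup _,
    contMDiff_flagLoop_apply hb.mero hb.uni n _, fun e he w hw => ?_⟩
  set φ : ℂ → Matrix (Fin n) (Fin n) ℂ := fun v => flagMap b (e.symm v) (-1) with hφ
  set T : ℂ → Matrix (Fin n) (Fin n) ℂ :=
    fun v => ∑ k ∈ Finset.range n, proj (limitFlag b k (e.symm v)) with hT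
  have hnear : ∀ᶠ v in 𝓝 w, v ∈ e.target := e.open_target.mem_nhds hw
  have hsq : ∀ v, φ v * φ v = 1 := fun v => by
    have h := (hb.isFlag (e.symm v)).loop_mul (-1) (-1)
    rw [neg_mul_neg, one_mul, (hb.isFlag (e.symm v)).loop_one] at h
    exact h.symm
  have hTs : ∀ v ∈ e.target, IsSmoothAt T v := fun v hv =>
    IsSmoothAt.sum fun k _ => isSmoothAt_proj_limitFlag hb.mero hb.uni k he hv
  have hφs : ∀ v ∈ e.target, IsSmoothAt φ v := fun v hv => hb.isSmoothAt_flagLoop he hv _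
  have h1 : ∀ v ∈ e.target, dz φ v = (-2 : ℂ) • (φ v * dz T v) := fun v hv => by
    have h := dz_flagLoop (w := v) (α := fun k v => limitFlag b k (e.symm v)) (N := n)
      (fun v => hb.isFlag _) (fun k => isSmoothAt_proj_limitFlag hb.mero hb.uni k he hv)
      (fun k => dzbar_proj_limitFlag_mul hb.mero hb.uni k he hv) (hver e he v hv)
      (z := -1) (by norm_num)
    rw [show ((-1 : ℂ)⁻¹ - 1) = -2 by norm_num] at h
    exact h
  have h2 : ∀ v ∈ e.target, dzbar φ v = (2 : ℂ) • (φ v * dzbar T v) := fun v hv => by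
    have h := dzbar_flagLoop (w := v) (α := fun k v => limitFlag b k (e.symm v)) (N := n)
      (fun v => hb.isFlag _) (fun k => isSmoothAt_proj_limitFlag hb.mero hb.uni k he hv)
      (fun k => dzbar_proj_limitFlag_mul hb.mero hb.uni k he hv) (hver e he v hv)
      (z := -1) (by norm_num)
    rw [show ((-1 : ℂ)⁻¹ - 1) = -2 by norm_num] at h
    have h3 : dzbar φ v = (-2 : ℂ) • (dzbar T v * φ v) := h
    -- `φ² = 1` moves the factor `φ` to the other side
    have h4 := wirtingerMatrix_mul (c := Complex.I) (hφs v hv) (hφs v hv)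
    simp only [hsq] at h4
    rw [wirtingerMatrix_const, ← dzbar_eq, h3, smul_mul_assoc, mul_assoc, hsq, mul_one,
      mul_smul_comm] at h4
    have h5 : dzbar T v = -(φ v * (dzbar T v * φ v)) := by
      have h6 : (-2 : ℂ) • (dzbar T v + φ v * (dzbar T v * φ v)) = 0 := by
        rw [smul_add]
        exact h4.symm
      exact eq_neg_of_add_eq_zero_left ((smul_eq_zero.1 h6).resolve_left (by norm_num))
    rw [h3]
    conv_rhs => rw [h5, mul_neg, ← mul_assoc, hsq, one_mul, smul_neg, ← neg_smul]
  exact harmonic_of_dz_eq (hnear.mono hφs) (hnear.mono hTs) hsq (hnear.mono h1) (hnear.mono h2)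

end IsMeroUnitriangular

/-- Every non-degenerate `S¹`-invariant extended solution of type `(1, …, 1)` comes from a
unitriangular solution: the matrix `a` is independent of the loop parameter by invariance, and
orthogonal by reality. -/
lemma exists_flagMap_eq [T1Space M] {r : ℕ}
    {Φ : M → Circle → Matrix (Fin (r + 1)) (Fin (r + 1)) ℂ} (hΦ : Φ ∈ ndSolutions M (r + 1)) :
    ∃ b : M → Matrix (Fin (r + 1)) (Fin (r + 1)) ℂ, IsMeroUnitriangular b ∧
      germMatrix b ∈ solR M (xiOne (r + 1)) ∧ IsNondegenerate (germMatrix b) ∧ flagMap b = Φ := by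
  obtain ⟨⟨hext, hreal, hinv⟩, a, hmero, hgrp, hproj, hnd⟩ := hΦ
  let b : M → Matrix (Fin (r + 1)) (Fin (r + 1)) ℂ := fun x => (a x).map fun p => p.coeff 0
  have hb : IsMeroUnitriangular b := by
    refine ⟨fun i j => hmero i j 0, fun x i j hij => ?_⟩
    change (a x i j).coeff 0 = _
    rw [(hgrp x i j).1 ((xiOne_le_iff i j).2 hij)]
    split_ifs <;> simp
  have hiw : ∀ᶠ x in codiscrete M,
      IsIwasawaFactor (fun l => b x * geodesic (xiOne (r + 1)) l) (Φ x) := by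
    filter_upwards [hproj] with x hx
    have h := exists_const_of_s1Invariant (hgrp x) (hinv x) hx
    rw [h] at hx
    simpa only [map_C_map_eval] using hx
  have ho : ∀ᶠ x in codiscrete M, secondTranspose (b x) * b x = 1 := by
    filter_upwards [hiw] with x hx
    exact (hb.uni x).orthogonal_of_real hx (hreal x).2.2
  have hΦc : ∀ l : Circle, Continuous fun x => Φ x l := fun l =>
    continuous_pi fun i => continuous_pi fun j =>
      (hext.2.1 i j).continuous.comp (Continuous.prodMk_left l)
  have heq : flagMap b = Φ := by
    funext x l
    refine congrFun (eq_of_eventually_codiscrete (hb.continuous_flagMap l) (hΦc l) ?_) x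
    filter_upwards [hiw, hb.eventually_isIwasawaFactor] with x h1 h2
    rw [h2.unique h1]
  refine ⟨b, hb, hb.germMatrix_mem_solR (hb.mem_meroGroupR ho) ?_, hnd, heq⟩
  rwa [heq]

end FlagMap

/-! ### The parametrization -/

section Parametrization

variable {M : Type*} [TopologicalSpace M] [ChartedSpace ℂ M] [T1Space M]
  {m : ℕ} {μ : Fin m → FunGerm M}

/-- The extended solution with parameters `μ`, as a product of unitons. -/
noncomputable def parametrizedSolution (m : ℕ) (μ : Fin m → FunGerm M) (x : M) (l : Circle) :
    Matrix (Fin (2 * m + 1)) (Fin (2 * m + 1)) ℂ :=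
  unitonProduct (2 * m) (fun k => limitFlag (representative (solutionMatrix m μ)) k x) l

variable [IsManifold 𝓘(ℂ, ℂ) ω M]

lemma representative_solutionMatrix (hμ : μ ∈ paramWeakND M m) :
    IsMeroUnitriangular (representative (solutionMatrix m μ)) ∧
      germMatrix (representative (solutionMatrix m μ)) = solutionMatrix m μ :=
  representative_spec (solutionMatrix_spec hμ).1

lemma parametrizedSolution_eq (hμ : μ ∈ paramWeakND M m) :
    parametrizedSolution m μ = flagMap (representative (solutionMatrix m μ)) := by
  funext x l
  exact ((representative_solutionMatrix hμ).1.isFlag x).unitonProduct_eq _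

lemma isConstProjection_parametrizedSolution_iff (hμ : μ ∈ paramWeakND M m)
    {B : Matrix (Fin (2 * m + 1)) (Fin (2 * m + 1)) (FunGerm M)}
    (hB : B ∈ meroGroupR M (xiOne (2 * m + 1))) :
    IsConstProjection (xiOne (2 * m + 1)) B (parametrizedSolution m μ) ↔
      B = solutionMatrix m μ := by
  obtain ⟨hb, hB'⟩ := representative_solutionMatrix hμ
  rw [parametrizedSolution_eq hμ, hb.isConstProjection_iff hB, hB']

/-- The explicit formulae for the extended solution with parameters `μ` and its harmonic map. -/
lemma exists_flag_parametrizedSolution (hμ : μ ∈ paramWeakND M m) :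
    ∃ (b : M → Matrix (Fin (2 * m + 1)) (Fin (2 * m + 1)) ℂ)
      (α : ℕ → M → Submodule ℂ (EuclideanSpace ℂ (Fin (2 * m + 1)))),
      (∀ i j, ((fun x => b x i j : M → ℂ) : FunGerm M) = solutionMatrix m μ i j) ∧
      (∀ k ≤ 2 * m + 1, IsHolSubbundle k (α k)) ∧
      (∀ k ≤ 2 * m + 1, ∀ᶠ x in codiscrete M, α k x = lastColumns (b x) k) ∧
      (∀ (x : M) (l : Circle),
        parametrizedSolution m μ x l = unitonProduct (2 * m) (fun k => α k x) l) ∧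
      ∀ x : M, parametrizedSolution m μ x (-1) =
        cartan (evenSum (2 * m) fun k => α k x) := by
  obtain ⟨hb, hB⟩ := representative_solutionMatrix hμ
  refine ⟨_, limitFlag (representative (solutionMatrix m μ)), Matrix.ext_iff.2 hB,
    fun k hk => isHolSubbundle_limitFlag hb.mero hb.uni hk,
    fun k _ => eventually_limitFlag_eq hb.mero hb.uni k, fun x l => rfl, fun x => ?_⟩
  rw [(hb.isFlag x).cartan_evenSum, parametrizedSolution_eq hμ]
  rfl

variable [ConnectedSpace M]

lemma parametrizedSolution_mem (hμ : μ ∈ paramWeakND M m) :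
    parametrizedSolution m μ ∈ s1Solutions M (2 * m + 1) (2 * m) := by
  obtain ⟨hb, hB⟩ := representative_solutionMatrix hμ
  rw [parametrizedSolution_eq hμ]
  exact hb.mem_s1Solutions (hB.symm ▸ solutionMatrix_mem_solR hμ)

lemma isHarmonicMap_parametrizedSolution (hμ : μ ∈ paramWeakND M m) :
    IsHarmonicMap fun x => parametrizedSolution m μ x (-1) := by
  obtain ⟨hb, hB⟩ := representative_solutionMatrix hμ
  rw [parametrizedSolution_eq hμ]
  exact hb.isHarmonicMap (hB.symm ▸ solutionMatrix_mem_solR hμ)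

variable (M m) in
lemma bijOn_parametrizedSolution :
    Set.BijOn (parametrizedSolution m) (paramND M m) (ndSolutions M (2 * m + 1)) := by
  refine ⟨fun μ hμ => ?_, fun μ hμ μ' hμ' h => ?_, fun Φ hΦ => ?_⟩
  · have hμ' := paramND_subset hμ
    obtain ⟨hb, hB⟩ := representative_solutionMatrix hμ'
    refine ⟨parametrizedSolution_mem hμ',
      fun x => (representative (solutionMatrix m μ) x).map C, fun i j q => ?_,
      fun x => (hb.uni x).map_C_mem_groupC, ?_, ?_⟩
    · simp only [Matrix.map_apply, coeff_C]
      split_ifs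
      exacts [hb.mero i j, isMeromorphic_const 0]
    · rw [parametrizedSolution_eq hμ']
      exact hb.isProjection
    · simp only [Matrix.map_apply, coeff_C_zero]
      change IsNondegenerate (germMatrix (representative (solutionMatrix m μ)))
      rw [hB]
      exact isNondegenerate_solutionMatrix hμ
  · have h1 := (isConstProjection_parametrizedSolution_iff (paramND_subset hμ)
      (solutionMatrix_spec (paramND_subset hμ)).1).2 rfl
    rw [h, isConstProjection_parametrizedSolution_iff (paramND_subset hμ')
      (solutionMatrix_spec (paramND_subset hμ)).1] at h1
    exact (bijOn_solutionMatrix M m).injOn hμ hμ' h1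
  · obtain ⟨b, hb, hB, hnd, rfl⟩ := exists_flagMap_eq hΦ
    have hpar := parameters_mem_paramND hB hnd
    refine ⟨parameters m (germMatrix b), hpar, ?_⟩
    have hsol := solutionMatrix_parameters hB fun k hk => hnd (k + 1) (by omega)
    have hrep := (representative_solutionMatrix (paramND_subset hpar)).2
    rw [hsol, germMatrix_eq_iff] at hrep
    rw [parametrizedSolution_eq (paramND_subset hpar), hsol]
    funext x l
    rw [flagMap, flagMap, limitFlag_congr hrep]

end Parametrization

end HarmonicOn

theorem mainTheorem3 (M : Type*) [TopologicalSpace M] [T2Space M] [ConnectedSpace M]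
    [ChartedSpace ℂ M] [IsManifold 𝓘(ℂ, ℂ) ω M] (m : ℕ) :
    ∃ (A : (Fin m → HarmonicOn.FunGerm M) →
          Matrix (Fin (2 * m + 1)) (Fin (2 * m + 1)) (HarmonicOn.FunGerm M))
      (h : (Fin m → HarmonicOn.FunGerm M) →
          M → Circle → Matrix (Fin (2 * m + 1)) (Fin (2 * m + 1)) ℂ),
      -- `A μ` is the unique complex-orthogonal unitriangular matrix with the prescribed entries
      (∀ μ ∈ HarmonicOn.paramWeakND M m, ∀ B,
        (B ∈ HarmonicOn.meroGroupR M (HarmonicOn.xiOne (2 * m + 1)) ∧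
          HarmonicOn.HasEntries m μ B) ↔ B = A μ) ∧
      -- the bijections onto solutions of the extended solution equation, and their inverse
      Set.BijOn A (HarmonicOn.paramND M m)
        {B | B ∈ HarmonicOn.solR M (HarmonicOn.xiOne (2 * m + 1)) ∧
          HarmonicOn.IsNondegenerate B} ∧
      Set.BijOn A (HarmonicOn.paramWeakND M m)
        {B | B ∈ HarmonicOn.solR M (HarmonicOn.xiOne (2 * m + 1)) ∧
          HarmonicOn.IsNondegenerate (HarmonicOn.removeBorder B)} ∧
      Set.InvOn (HarmonicOn.parameters m) A (HarmonicOn.paramWeakND M m)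
        {B | B ∈ HarmonicOn.solR M (HarmonicOn.xiOne (2 * m + 1)) ∧
          HarmonicOn.IsNondegenerate (HarmonicOn.removeBorder B)} ∧
      -- the bijection onto non-degenerate `S¹`-invariant extended solutions of type `(1, …, 1)`
      Set.BijOn h (HarmonicOn.paramND M m) (HarmonicOn.ndSolutions M (2 * m + 1)) ∧
      -- `h μ = [A μ γ]`, with `A μ` determined by `h μ`, and the explicit formulae
      (∀ μ ∈ HarmonicOn.paramWeakND M m,
        h μ ∈ HarmonicOn.s1Solutions M (2 * m + 1) (2 * m) ∧
        (∀ B ∈ HarmonicOn.meroGroupR M (HarmonicOn.xiOne (2 * m + 1)),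
          HarmonicOn.IsConstProjection (HarmonicOn.xiOne (2 * m + 1)) B (h μ) ↔ B = A μ) ∧
        HarmonicOn.IsHarmonicMap (fun x => h μ x (-1)) ∧
        ∃ (b : M → Matrix (Fin (2 * m + 1)) (Fin (2 * m + 1)) ℂ)
          (α : ℕ → M → Submodule ℂ (EuclideanSpace ℂ (Fin (2 * m + 1)))),
          (∀ i j, ((fun x => b x i j : M → ℂ) : HarmonicOn.FunGerm M) = A μ i j) ∧
          (∀ k ≤ 2 * m + 1, HarmonicOn.IsHolSubbundle k (α k)) ∧
          (∀ k ≤ 2 * m + 1, ∀ᶠ x in codiscrete M, α k x = HarmonicOn.lastColumns (b x) k) ∧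
          (∀ (x : M) (l : Circle),
            h μ x l = HarmonicOn.unitonProduct (2 * m) (fun k => α k x) l) ∧
          ∀ x : M, h μ x (-1) =
            HarmonicOn.cartan (HarmonicOn.evenSum (2 * m) fun k => α k x)) := by
  open HarmonicOn in
  exact ⟨solutionMatrix m, parametrizedSolution m, fun μ hμ B => eq_solutionMatrix_iff hμ.1 B,
    bijOn_solutionMatrix M m, bijOn_solutionMatrix_weak M m, invOn_parameters_solutionMatrix M m,
    bijOn_parametrizedSolution M m, fun μ hμ => ⟨parametrizedSolution_mem hμ,
      fun B hB => isConstProjection_parametrizedSolution_iff hμ hB,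
      isHarmonicMap_parametrizedSolution hμ, exists_flag_parametrizedSolution hμ⟩⟩
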